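/- Let $\Gamma$ be a finite non-empty alphabet and let $\mathcal F$ be a Muller condition over $\Gamma$, i.e. a family of non-empty subsets of $\Gamma$. Let $L_{\mathcal F}\subseteq\Gamma^\omega$ be the set of words $w$ for which the set $\mathrm{Inf}(w)$ of letters occurring infinitely often belongs to $\mathcal F$. **Games and memory.** A game is played on a finite directed graph whose edges carry colours in $\Gamma\cup\{\varepsilon\}$; every position has an outgoing edge, no cycle is labelled only by $\varepsilon$, and the existential player wins a play if its sequence of colours, with the $\varepsilon$'s omitted, is in $L_{\mathcal F}$. A memory structure has a set $M$ of states (its size is $|M|$), an initial state, an update function $M\times E\to M$, and a next-move function. Let $\mathrm{mem}_{gen}(L_{\mathcal F})$ be the least $n\ge 1$ such that in every such game won by the existential player she has a winning strategy given by a memory structure of size at most $n$. **Automata.** The transitions of an automaton are tuples $(q,a,c,q')$ with an input letter $a$ and an output letter $c$; acceptance of a run depends on its sequence of outputs. A Rabin condition is a finite family of pairs $(G_i,R_i)$ of disjoint sets of output letters; an output word satisfies it if for some $i$ infinitely many of its letters are in $G_i$ and only finitely many are in $R_i$. An automaton is good-for-games (GFG) if it has a resolver: an initial state and a function that chooses the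 next transition from the finite word read so far and the next letter, such that the induced run is accepting for every word accepted by the automaton. **Trees.** A Zielonka tree of $\mathcal F$ is a finite tree with nodes labelled by non-empty subsets of $\Gamma$, whose root is labelled $\Gamma$; a node labelled $X$ is round if $X\in\mathcal F$ and square otherwise, and it has exactly one child for each maximal non-empty $Y\subseteq X$ with $Y\in\mathcal F\Leftrightarrow X\notin\mathcal F$, labelled $Y$. It is ordered: the children of each node are totally ordered from left to right. The number $\mathrm{mem}(T)$ is $1$ if $T$ has a single node, and otherwise the sum (if the root is round) or the maximum (if it is square) of the numbers of the subtrees rooted at the children of the root. For a node $n$ and a leaf $l$ strictly below $n$, $\mathrm{jump}_n(l)$ is the set of leaves below the child of $n$ that follows, cyclically, the child of $n$ above $l$; $\mathrm{jump}_l(l)=\{l\}$. A map $\eta$ from the leaves to $\{1,\dots,\mathrm{mem}(T)\}$ has property $(\star)$ if $\eta(l_1)\ne\eta(l_2)$ whenever $l_1,l_2$ are leaves below two different children of a round node. For a leaf $l$ and a letter $c$ let $n(l,c)$ be the last (deepest) ancestor of $l$, possibly $l$ itself, whose label contains $c$, and let $s(l,c)$ be the leftmost leaf in $\mathrm{jump}_{n(l,c)}(l)$.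 For $\eta$ with property $(\star)$ let $\mathcal R_{T,\eta}$ be the automaton with states $\{1,\dots,\mathrm{mem}(T)\}$, whose initial state is the image of the leftmost leaf, whose output letters are the nodes of $T$, whose transitions are $(\eta(l),c,n(l,c),\eta(s(l,c)))$ for all leaves $l$ and letters $c$, and with one Rabin pair for each round node $n$, namely $G_n=\{n\}$ and $R_n=\{n' : n \text{ is not an ancestor of } n'\}$ (every node counting as an ancestor of itself). The Zielonka tree parity automaton $\mathcal P_T$ has the leaves as its states, the leftmost leaf as its initial state, and the transitions from $l$ to $s(l,c)$ on reading $c$, with the priority of the node $n(l,c)$ as output: priorities decrease by one from each node to its children, round nodes have even and square nodes odd ones. A run of $\mathcal P_T$ is accepting if the maximal priority seen infinitely often is even. **Statement.** For every Muller condition $\mathcal F$ there is a GFG Rabin automaton recognising $L_{\mathcal F}$ with exactly $\mathrm{mem}_{gen}(L_{\mathcal F})$ states. In more detail, $\mathcal F$ has an ordered Zielonka tree, and for every ordered Zielonka tree $T$ of $\mathcal F$: 1. there is a labelling $\eta$ of the leaves by $\{1,\dots,\mathrm{mem}(T)\}$ with property $(\star)$ that maps the leftmost leaf to $1$; 2.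 for every labelling $\eta$ with property $(\star)$, the Rabin automaton $\mathcal R_{T,\eta}$ recognises $L_{\mathcal F}$, is GFG, and has $\mathrm{mem}(T)=\mathrm{mem}_{gen}(L_{\mathcal F})$ states; a resolver is given by $\mathcal P_T$: if $\mathcal P_T$ is in state $l$ after the word read so far and the next letter is $c$, take the transition $(\eta(l),c,n(l,c),\eta(s(l,c)))$; 3. $\mathcal P_T$ is deterministic and recognises $L_{\mathcal F}$. Moreover, there is a polynomial-time algorithm that, given an ordered Zielonka tree $T$ (with its labels and the shapes of its nodes) of any Muller condition over any finite alphabet, outputs $\mathcal R_{T,\eta}$ (its states, initial state, transitions and Rabin pairs) for some labelling $\eta$ as in 1. -/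

import Mathlib

open Filter

/-! ## Infinite words and winning conditions -/

section Words

universe u v

/-- The set of letters that occur infinitely often in an infinite word. -/
def infOcc {A : Type u} (w : ℕ → A) : Set A := {a | ∃ᶠ i in atTop, w i = a}

/-- The language of the Muller condition `F`. -/
def mullerLanguage {A : Type u} (F : Set (Set A)) : Set (ℕ → A) := {w | infOcc w ∈ F}

/-- A Rabin condition over the alphabet `C`: a finite family of disjoint pairs `(green i, red i)`. -/
structure RabinCondition (C : Type v) where
  ι : Type
  finite_ι : Finite ι
  green : ι → Set C
  red : ι → Set C
  disj : ∀ i, green i ∩ red i = ∅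

/-- The language of a Rabin condition. -/
def RabinCondition.language {C : Type v} (R : RabinCondition C) : Set (ℕ → C) :=
  {w | ∃ i, (infOcc w ∩ R.green i).Nonempty ∧ infOcc w ∩ R.red i = ∅}

/-- The language of the parity condition: the maximal number seen infinitely often exists and is
even. -/
def parityLanguage : Set (ℕ → ℕ) := {w | ∃ m, IsGreatest (infOcc w) m ∧ Even m}

end Words

/-! ## Games and memory -/

section Games

universe u

/-- A `Γ`-coloured game on a finite graph. An edge is a triple `(source, colour, target)`; the colour
`none` is the empty label `ε`. -/
structure Game (Γ : Type u) where
  V : Type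
  finite_V : Finite V
  /-- the positions of the existential player; all the other ones belong to the universal player -/
  exist : Set V
  E : Set (V × Option Γ × V)
  x₀ : V
  total : ∀ x, ∃ e ∈ E, e.1 = x
  /-- no cycle is labelled exclusively by `ε` -/
  no_eps_cycle : ∀ x, ¬ Relation.TransGen (fun y z => (y, none, z) ∈ E) x x

namespace Game

variable {Γ : Type u} (G : Game Γ)

abbrev Edge : Type u := G.V × Option Γ × G.V

/-- The last position of a partial play (`x₀` for the empty one). -/
def last (π : List G.Edge) : G.V := (π.getLast?.map fun e => e.2.2).getD G.x₀

/-- Finite paths of the game that start in `x₀`. -/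
inductive IsPartialPlay : List G.Edge → Prop
  | nil : IsPartialPlay []
  | snoc (π : List G.Edge) (e : G.Edge) : IsPartialPlay π → e ∈ G.E → e.1 = G.last π →
      IsPartialPlay (π ++ [e])

/-- The prefix of length `i` of an infinite sequence of edges. -/
def pre (π : ℕ → G.Edge) (i : ℕ) : List G.Edge := (List.range i).map π

/-- Infinite paths of the game that start in `x₀`. -/
def IsPlay (π : ℕ → G.Edge) : Prop := ∀ i, G.IsPartialPlay (G.pre π i)

/-- `w` is the sequence of colours of `π`, with the labels `ε` omitted. -/
def IsColouring (π : ℕ → G.Edge) (w : ℕ → Γ) : Prop :=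
  ∃ f : ℕ → ℕ, StrictMono f ∧ (∀ i, (π (f i)).2.1 = some (w i)) ∧
    ∀ j, (π j).2.1 ≠ none → ∃ i, f i = j

/-- The play `π` is winning for the existential player. -/
def IsWinningPlay (W : Set (ℕ → Γ)) (π : ℕ → G.Edge) : Prop := ∃ w ∈ W, G.IsColouring π w

/-- `s` is a strategy for the existential player. -/
def IsStrategy (s : List G.Edge → G.Edge) : Prop :=
  ∀ π, G.IsPartialPlay π → G.last π ∈ G.exist → s π ∈ G.E ∧ (s π).1 = G.last π

/-- The play `π` is consistent with `s`. -/
def Consistent (s : List G.Edge → G.Edge) (π : ℕ → G.Edge) : Prop :=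
  ∀ i, G.last (G.pre π i) ∈ G.exist → π i = s (G.pre π i)

/-- `s` is a winning strategy for the existential player, for the winning condition `W`. -/
def IsWinningStrategy (W : Set (ℕ → Γ)) (s : List G.Edge → G.Edge) : Prop :=
  G.IsStrategy s ∧ ∀ π, G.IsPlay π → G.Consistent s π → G.IsWinningPlay W π

/-- The existential player wins the game with winning condition `W`. -/
def WonByExist (W : Set (ℕ → Γ)) : Prop := ∃ s, G.IsWinningStrategy W s

/-- A (finite) memory structure for the game. -/
structure Memory where
  M : Type
  finite_M : Finite M
  m₀ : M
  update : M → G.Edge → M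
  /-- `next m x` matters only for the positions `x` of the existential player -/
  next : M → G.V → G.Edge
  next_mem : ∀ m, ∀ x ∈ G.exist, next m x ∈ G.E ∧ (next m x).1 = x

/-- The strategy induced by a memory structure. -/
def Memory.strategy {G : Game Γ} (μ : G.Memory) (π : List G.Edge) : G.Edge :=
  μ.next (π.foldl μ.update μ.m₀) (G.last π)

end Game

/-- The memory requirements of the winning condition `W`: the least `n ≥ 1` such that in every
`W`-game won by the existential player, she has a winning strategy given by a memory of size at most
`n`. (A memory structure has an initial state, hence size at least `1`.) -/
noncomputable def memgen {Γ : Type u} (W : Set (ℕ → Γ)) : ℕ :=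
  sInf {n | 1 ≤ n ∧ ∀ G : Game Γ, G.WonByExist W →
    ∃ μ : G.Memory, Nat.card μ.M ≤ n ∧ G.IsWinningStrategy W μ.strategy}

end Games

/-! ## Automata and good-for-gameness -/

section Automata

universe u v

/-- Non-deterministic automata over infinite words, with input alphabet `A`, and with acceptance
condition `acc` over the output alphabet `C` of their transitions. -/
structure Automaton (A : Type u) (C : Type v) where
  Q : Type
  finite_Q : Finite Q
  init : Set Q
  init_nonempty : init.Nonempty
  trans : Set (Q × A × C × Q)
  acc : Set (ℕ → C)

namespace Automaton

variable {A : Type u} {C : Type v} (𝒜 : Automaton A C)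

abbrev Transition : Type (max u v) := 𝒜.Q × A × C × 𝒜.Q

/-- The number of states. -/
noncomputable def size : ℕ := Nat.card 𝒜.Q

/-- `ρ` is a path over the word `w` that starts in `q`. -/
def IsRunFrom (q : 𝒜.Q) (w : ℕ → A) (ρ : ℕ → 𝒜.Transition) : Prop :=
  (ρ 0).1 = q ∧ ∀ i, ρ i ∈ 𝒜.trans ∧ (ρ i).2.1 = w i ∧ (ρ i).2.2.2 = (ρ (i + 1)).1

/-- The outputs along `ρ` satisfy the acceptance condition. -/
def IsAccepting (ρ : ℕ → 𝒜.Transition) : Prop := (fun i => (ρ i).2.2.1) ∈ 𝒜.acc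

/-- The language accepted by the automaton. -/
def language : Set (ℕ → A) :=
  {w | ∃ q ∈ 𝒜.init, ∃ ρ, 𝒜.IsRunFrom q w ρ ∧ 𝒜.IsAccepting ρ}

/-- One initial state, and exactly one transition from every state for every letter. -/
def IsDeterministic : Prop :=
  (∃ q, 𝒜.init = {q}) ∧ ∀ q a, ∃! p : C × 𝒜.Q, (q, a, p.1, p.2) ∈ 𝒜.trans

/-- The acceptance condition is the Rabin condition `R`. -/
def IsRabinWith (R : RabinCondition C) : Prop := 𝒜.acc = R.language

/-- The initial state `r₀` and the function `r` form a resolver. -/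
def IsResolver (r₀ : 𝒜.Q) (r : List A → A → 𝒜.Transition) : Prop :=
  r₀ ∈ 𝒜.init ∧ (∀ u a, r u a ∈ 𝒜.trans) ∧
    ∀ w ∈ 𝒜.language,
      𝒜.IsRunFrom r₀ w (fun i => r ((List.range i).map w) (w i)) ∧
      𝒜.IsAccepting (fun i => r ((List.range i).map w) (w i))

/-- Good-for-games automata. -/
def IsGFG : Prop := ∃ r₀ r, 𝒜.IsResolver r₀ r

end Automaton

end Automata

/-! ## Ordered Zielonka trees -/

section Trees

universe u

/-- Finite ordered trees whose nodes carry a set of letters and are either round (`true`) or square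
(`false`). The children of a node are numbered `0, …, k - 1` from left to right. -/
inductive ZTree (Γ : Type u) : Type u
  | node (label : Set Γ) (round : Bool) (k : ℕ) (child : Fin k → ZTree Γ) : ZTree Γ

namespace ZTree

variable {Γ : Type u}

def rootLabel : ZTree Γ → Set Γ
  | node lab _ _ _ => lab

def rootRound : ZTree Γ → Bool
  | node _ b _ _ => b

/-- The number of children of the root. -/
def rootArity : ZTree Γ → ℕ
  | node _ _ k _ => k

/-- The memory of a tree. -/
def memory : ZTree Γ → ℕ
  | node _ b k child =>
    if k = 0 then 1
    else if b = true then ∑ i : Fin k, memory (child i)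
    else Finset.univ.sup fun i : Fin k => memory (child i)

/-- The largest number of edges on a branch. -/
def height : ZTree Γ → ℕ
  | node _ _ k child => Finset.univ.sup fun i : Fin k => height (child i) + 1

/-- The nodes of a tree are named by their addresses: `[]` is the root, and `n ++ [i]` is the child
number `i` of `n`. This is the subtree rooted at an address, if the latter is a node. -/
def sub : ZTree Γ → List ℕ → Option (ZTree Γ)
  | t, [] => some t
  | node _ _ k child, i :: p => if h : i < k then sub (child ⟨i, h⟩) p else none

/-- The nodes of a tree. -/
def Node (T : ZTree Γ) : Type := {p : List ℕ // (T.sub p).isSome = true}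

variable {T : ZTree Γ}

/-- The subtree rooted at a node. -/
def Node.subtree (n : T.Node) : ZTree Γ := (T.sub n.1).get n.2

/-- The label of a node. -/
def Node.label (n : T.Node) : Set Γ := n.subtree.rootLabel

/-- The number of children of a node. -/
def Node.arity (n : T.Node) : ℕ := n.subtree.rootArity

def Node.IsRound (n : T.Node) : Prop := n.subtree.rootRound = true

/-- `n` is an ancestor of `m` (possibly `m` itself). -/
def Node.IsAncestor (n m : T.Node) : Prop := n.1 <+: m.1

variable (T) in
/-- The leaves of a tree. -/
def Leaf : Type := {n : T.Node // n.arity = 0}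

/-- The leaf `l` is below the child number `i` of `n`. -/
def Leaf.BelowChild (l : T.Leaf) (n : T.Node) (i : ℕ) : Prop := (n.1 ++ [i]) <+: l.1.1

/-- `l` is the leftmost leaf in the set `S`. The leaves are ordered from left to right by the
lexicographic order of their addresses. -/
def IsLeftmost (S : Set T.Leaf) (l : T.Leaf) : Prop := l ∈ S ∧ ∀ l' ∈ S, l.1.1 ≤ l'.1.1

/-- The set `jump_n(l)`: the leaves below the child of `n` that cyclically follows the child of `n`
above `l`; if `n = l`, then only `l` itself. -/
def jump (n : T.Node) (l : T.Leaf) : Set T.Leaf :=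
  {l' | (n = l.1 ∧ l' = l) ∨ ∃ i, l.BelowChild n i ∧ l'.BelowChild n ((i + 1) % n.arity)}

/-- `n` is the last ancestor of `l` whose label contains `c`. -/
def IsLastAncestor (n : T.Node) (l : T.Leaf) (c : Γ) : Prop :=
  n.IsAncestor l.1 ∧ c ∈ n.label ∧
    ∀ n' : T.Node, n'.IsAncestor l.1 → c ∈ n'.label → n'.IsAncestor n

/-- Reading `c` in the leaf `l` produces `n` and leads to the leaf `l'`. -/
def Step (l : T.Leaf) (c : Γ) (n : T.Node) (l' : T.Leaf) : Prop :=
  IsLastAncestor n l c ∧ IsLeftmost (jump n l) l'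

/-- `Y` is a maximal one among the non-empty subsets of `X` that lie in `F` if and only if `X` does
not. -/
def IsMaxAlternation (F : Set (Set Γ)) (X Y : Set Γ) : Prop :=
  Maximal (fun Z => Z.Nonempty ∧ Z ⊆ X ∧ (Z ∈ F ↔ X ∉ F)) Y

/-- The nodes are partitioned and labelled as in a Zielonka tree; only the label of the root is
arbitrary. Each of the maximal sets labels exactly one child. -/
def Alternates (F : Set (Set Γ)) : ZTree Γ → Prop
  | node lab b _ child =>
    (b = true ↔ lab ∈ F) ∧
    Function.Injective (fun i => (child i).rootLabel) ∧
    (∀ Y, (∃ i, (child i).rootLabel = Y) ↔ IsMaxAlternation F lab Y) ∧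
    ∀ i, Alternates F (child i)

/-- `T` is an (ordered) Zielonka tree for `F`. -/
def IsZielonkaTree (F : Set (Set Γ)) (T : ZTree Γ) : Prop :=
  T.rootLabel = Set.univ ∧ T.Alternates F

theorem finite_addresses (T : ZTree Γ) : {p : List ℕ | (T.sub p).isSome = true}.Finite := by
  induction T with
  | node lab b k child ih =>
    have h : {p : List ℕ | ((node lab b k child).sub p).isSome = true} ⊆
        {[]} ∪ ⋃ i : Fin k, (fun p => (i : ℕ) :: p) ''
          {p | ((child i).sub p).isSome = true} := by
      intro p hp
      cases p with
      | nil => exact Or.inl rfl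
      | cons i p =>
        right
        simp only [Set.mem_ofPred_eq, sub] at hp
        split_ifs at hp with hi
        · exact Set.mem_iUnion.2 ⟨⟨i, hi⟩, p, hp, rfl⟩
        · simp at hp
    exact ((Set.finite_singleton _).union
      (Set.finite_iUnion fun i => (ih i).image _)).subset h

instance (T : ZTree Γ) : Finite T.Node := T.finite_addresses.to_subtype

instance (T : ZTree Γ) : Finite T.Leaf := Subtype.finite

theorem exists_leaf_address (T : ZTree Γ) : ∃ p t, T.sub p = some t ∧ t.rootArity = 0 := by
  induction T with
  | node lab b k child ih =>
    by_cases hk : k = 0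
    · exact ⟨[], node lab b k child, by simp [sub], hk⟩
    · obtain ⟨p, t, hp, ht⟩ := ih ⟨0, Nat.pos_of_ne_zero hk⟩
      exact ⟨0 :: p, t, by simpa [sub, Nat.pos_of_ne_zero hk] using hp, ht⟩

theorem exists_leftmost (T : ZTree Γ) : ∃ l : T.Leaf, IsLeftmost Set.univ l := by
  obtain ⟨p, t, hp, ht⟩ := T.exists_leaf_address
  have : Nonempty T.Leaf :=
    ⟨⟨⟨p, by simp [hp]⟩, by simpa [Node.arity, Node.subtree, hp] using ht⟩⟩
  obtain ⟨l, hl⟩ := Finite.exists_min (fun l : T.Leaf => l.1.1)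
  exact ⟨l, Set.mem_univ _, fun l' _ => hl l'⟩

/-- Property (⋆): leaves below two different children of a round node have different images. -/
def IsStarLabelling (η : T.Leaf → Fin T.memory) : Prop :=
  ∀ n : T.Node, n.IsRound → ∀ i j, i ≠ j → ∀ l₁ l₂ : T.Leaf,
    l₁.BelowChild n i → l₂.BelowChild n j → η l₁ ≠ η l₂

/-- The leftmost leaf is mapped to the first state. -/
def IsNormalized (η : T.Leaf → Fin T.memory) : Prop :=
  ∀ l : T.Leaf, IsLeftmost Set.univ l → (η l : ℕ) = 0

variable (T) in
/-- One Rabin pair for each round node `n`: green in `n`, and red in all the nodes that do not have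
`n` as an ancestor. -/
def rabinCondition : RabinCondition T.Node where
  ι := {n : T.Node // n.IsRound}
  finite_ι := Subtype.finite
  green n := {n.1}
  red n := {m | m ≠ n.1 ∧ ¬ n.1.IsAncestor m}
  disj n := by
    ext m
    simp only [Set.mem_inter_iff, Set.mem_singleton_iff, Set.mem_ofPred_eq, Set.mem_empty_iff_false,
      iff_false]
    rintro ⟨h, h', -⟩
    exact h' h

/-- The Rabin automaton given by the tree `T` and the labelling `η` of its leaves. The initial state
is the image of the leftmost leaf. -/
def rabinAutomaton (η : T.Leaf → Fin T.memory) : Automaton Γ T.Node where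
  Q := Fin T.memory
  finite_Q := inferInstance
  init := η '' {l | IsLeftmost Set.univ l}
  init_nonempty := Set.Nonempty.image η T.exists_leftmost
  trans := {t | ∃ l l' : T.Leaf, Step l t.2.1 t.2.2.1 l' ∧ t.1 = η l ∧ t.2.2.2 = η l'}
  acc := T.rabinCondition.language

/-- The priority of a node: consecutive along the branches, larger for ancestors, even exactly on the
levels that have round nodes (in a Zielonka tree round and square nodes alternate). -/
def Node.priority (n : T.Node) : ℕ :=
  (if T.rootRound = true then 2 * ((T.height + 1) / 2) else 2 * (T.height / 2) + 1) - n.1.length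

variable (T) in
/-- The Zielonka tree parity automaton: its states are the leaves. -/
def parityAutomaton : Automaton Γ ℕ where
  Q := T.Leaf
  finite_Q := inferInstance
  init := {l | IsLeftmost Set.univ l}
  init_nonempty := T.exists_leftmost
  trans := {t | ∃ n : T.Node, Step t.1 t.2.1 n t.2.2.2 ∧ t.2.2.1 = n.priority}
  acc := parityLanguage

/-- `(r₀, r)` is the strategy in the Rabin automaton of `η` that uses the run of the parity automaton
as its memory: `m u` is the state of the latter after the finite word `u`, and the strategy always
takes the transition that corresponds to the step of the parity automaton. -/
def IsGivenByParityAutomaton (η : T.Leaf → Fin T.memory) (r₀ : (rabinAutomaton η).Q)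
    (r : List Γ → Γ → (rabinAutomaton η).Transition) : Prop :=
  ∃ m : List Γ → T.parityAutomaton.Q,
    m [] ∈ T.parityAutomaton.init ∧ r₀ = η (m []) ∧
    ∀ u c, ∃ n : T.Node, Step (m u) c n (m (u ++ [c])) ∧
      (m u, c, n.priority, m (u ++ [c])) ∈ T.parityAutomaton.trans ∧
      r u c = (η (m u), c, n, η (m (u ++ [c])))

end ZTree

end Trees

/-! ## A model of computation -/

section Computation

/-- The data on which programs operate: binary trees. -/
inductive Data : Type
  | nil : Data
  | cons : Data → Data → Data

namespace Data

def size : Data → ℕ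
  | nil => 1
  | cons a b => size a + size b + 1

def head : Data → Data
  | nil => nil
  | cons a _ => a

def tail : Data → Data
  | nil => nil
  | cons _ b => b

def ofList : List Data → Data
  | [] => nil
  | d :: ds => cons d (ofList ds)

/-- Natural numbers in unary. -/
def ofNat : ℕ → Data
  | 0 => nil
  | n + 1 => cons nil (ofNat n)

open Classical in
/-- Truth values. -/
noncomputable def ofProp (p : Prop) : Data := if p then cons nil nil else nil

end Data

/-- The expressions of a first-order functional language over `Data`. `arg` is the argument of the
function whose body is being evaluated, `ite c a b` is `b` if `c` is `nil` and `a` otherwise, and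
`call f a` applies the function number `f` of the program to `a`. -/
inductive Expr : Type
  | arg : Expr
  | nil : Expr
  | cons : Expr → Expr → Expr
  | head : Expr → Expr
  | tail : Expr → Expr
  | ite : Expr → Expr → Expr → Expr
  | call : ℕ → Expr → Expr

/-- A program is a finite list of bodies of mutually recursive functions. -/
abbrev Program : Type := List Expr

/-- `Eval P v e d t`: in the program `P`, with argument `v`, the expression `e` evaluates to `d` in
`t` steps. Copying the argument costs its size, and every other operation costs one step, so that all
the data built within `t` steps have size at most `t`. -/
inductive Eval (P : Program) : Data → Expr → Data → ℕ → Prop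
  | arg (v : Data) : Eval P v Expr.arg v v.size
  | nil (v : Data) : Eval P v Expr.nil Data.nil 1
  | cons {v : Data} {a b : Expr} {x y : Data} {s t : ℕ} :
      Eval P v a x s → Eval P v b y t → Eval P v (Expr.cons a b) (Data.cons x y) (s + t + 1)
  | head {v : Data} {a : Expr} {x : Data} {s : ℕ} :
      Eval P v a x s → Eval P v (Expr.head a) x.head (s + 1)
  | tail {v : Data} {a : Expr} {x : Data} {s : ℕ} :
      Eval P v a x s → Eval P v (Expr.tail a) x.tail (s + 1)
  | ite_true {v : Data} {c a b : Expr} {x y z : Data} {s t : ℕ} :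
      Eval P v c (Data.cons x y) s → Eval P v a z t → Eval P v (Expr.ite c a b) z (s + t + 1)
  | ite_false {v : Data} {c a b : Expr} {z : Data} {s t : ℕ} :
      Eval P v c Data.nil s → Eval P v b z t → Eval P v (Expr.ite c a b) z (s + t + 1)
  | call {v : Data} {f : ℕ} {a body : Expr} {x y : Data} {s t : ℕ} :
      Eval P v a x s → P[f]? = some body → Eval P x body y t →
        Eval P v (Expr.call f a) y (s + t + 1)

/-- Started on the input `x`, the first function of `P` returns `y` after `t` steps. -/
def Program.Computes (P : Program) (x y : Data) (t : ℕ) : Prop :=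
  ∃ body, P[0]? = some body ∧ Eval P x body y t

end Computation

/-! ## Encodings of trees and automata -/

section Encodings

universe u v

/-- The encoding of a tree over the alphabet `Γ`, the letters of which are numbered by `e`. A node is
encoded by its shape, the characteristic word of its label, and the list of its subtrees. -/
noncomputable def ZTree.encode {Γ : Type u} {k : ℕ} (e : Γ ≃ Fin k) : ZTree Γ → Data
  | ZTree.node lab b m child =>
    Data.ofList [Data.ofProp (b = true),
      Data.ofList (List.ofFn fun j : Fin k => Data.ofProp (e.symm j ∈ lab)),
      Data.ofList (List.ofFn fun i : Fin m => ZTree.encode e (child i))]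

/-- `d` encodes the automaton `𝒜` with the Rabin condition `R`: it consists of lists of the states,
of the initial states, of the transitions and of the Rabin pairs (one pair of lists for each index),
where states, letters and output letters are encoded by `encQ`, `encA` and `encC`. -/
def IsRabinCode {A : Type u} {C : Type v} (𝒜 : Automaton A C) (R : RabinCondition C)
    (encQ : 𝒜.Q → Data) (encA : A → Data) (encC : C → Data) (d : Data) : Prop :=
  ∃ (states inits : List 𝒜.Q) (ts : List 𝒜.Transition) (idx : List R.ι)
    (pairs : List (List C × List C)),
    (states.Nodup ∧ ∀ q, q ∈ states) ∧
    (∀ q, q ∈ inits ↔ q ∈ 𝒜.init) ∧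
    (∀ t, t ∈ ts ↔ t ∈ 𝒜.trans) ∧
    (idx.Nodup ∧ ∀ i, i ∈ idx) ∧
    List.Forall₂ (fun i p => (∀ c, c ∈ p.1 ↔ c ∈ R.green i) ∧ ∀ c, c ∈ p.2 ↔ c ∈ R.red i)
      idx pairs ∧
    d = Data.ofList
      [Data.ofList (states.map encQ),
       Data.ofList (inits.map encQ),
       Data.ofList (ts.map fun t =>
        Data.ofList [encQ t.1, encA t.2.1, encC t.2.2.1, encQ t.2.2.2]),
       Data.ofList (pairs.map fun p =>
        Data.cons (Data.ofList (p.1.map encC)) (Data.ofList (p.2.map encC)))]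

/-- `d` encodes the Rabin automaton given by a tree and a labelling of its leaves. States and letters
are encoded as numbers, nodes as lists of numbers. -/
def ZTree.IsCodeOfRabinAutomaton {Γ : Type u} {k : ℕ} (e : Γ ≃ Fin k) {T : ZTree Γ}
    (η : T.Leaf → Fin T.memory) (d : Data) : Prop :=
  IsRabinCode (ZTree.rabinAutomaton η) T.rabinCondition
    (fun q : Fin T.memory => Data.ofNat q) (fun c => Data.ofNat (e c))
    (fun n => Data.ofList (n.1.map Data.ofNat)) d

end Encodings

/-! Correctness of the automata. In an infinite sequence of jumps one node `n` is used infinitely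
often and almost all nodes used lie below it (`exists_top_node`). From then on the child of `n`
above the current leaf changes only at jumps at `n`, and then cyclically. So every child of `n` is
left infinitely often, each time on a letter outside its label (`frequently_leave_child`,
`frequently_mem_limit`). Hence the letters read infinitely often form a subset of the label of `n`
that is contained in no child's label. By maximality of the children's labels, this set is in `F`
iff `n` is round (`IsZielonkaTree.infOcc_mem_iff`). Since `n` has the largest priority seen
infinitely often, the parity automaton is correct.

The Rabin automaton glues leaves with equal `η`. Acceptance by the pair of a round node `n` makes
`n` the top node of the run, and (⋆) guarantees that switching between glued leaves below `n` does
not change the child of `n`; so the same argument applies. Conversely, the run of the parity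
automaton, mapped through `η`, is accepting whenever the word is in the language, and it is
determined letter by letter: this is the resolver.

Upper bound on the memory. A winning strategy yields the forest of its consistent histories. By
induction on the Zielonka tree, histories receive a tag below `memory` and an ordinal rank, such
that after each edge one may jump to any history with the same tag and no larger rank without losing
(`Alternates.exists_closure`). Tags of the children are kept apart at round nodes (sum) and shared
at square nodes (maximum), where the rank separates them. The memory stores the tag, and the player
imitates the strategy at a history of least rank with this tag and the current position.

Lower bound. Keep at each square node one child of largest memory; the leaves of the pruned tree are
at least `memory` in number. In `answerGame` the existential player names a leaf and the universal
player answers with a set of letters. If some leaf `l₀` is never named, every answer can be the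
label of a square ancestor of `l₀`. These labels form a chain, so the limit set is the label of a
square node. Hence each leaf needs its own memory state (`exists_leaf_of_memory`). A square root is
handled through its children.

Complexity. Under `leafNumber` the states of the leaves below a node fill an interval. The
transitions with output `n` therefore lead from whole intervals to the first state of another one
and can be collected bottom-up, without enumerating leaves. A small calculus of polynomial-time
functions, with a recursion scheme along trees, turns this into a program. -/

/-! ### Cyclic counters and prefixes of lists -/

theorem frequently_exists_finite {ι α : Type*} [Finite ι] {f : Filter α} {p : ι → α → Prop}
    (h : ∃ᶠ n in f, ∃ i, p i n) : ∃ i, ∃ᶠ n in f, p i n := by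
  by_contra! hc
  exact h ((eventually_all.2 hc).mono fun n hn ⟨i, hi⟩ => hn i hi)

/-- A cyclic counter that is advanced infinitely often is advanced infinitely often at each of its
values. -/
theorem frequently_switch_of_cyclic {k : ℕ} {a : ℕ → ℕ} {sw : ℕ → Prop} (h0 : ∀ᶠ n in atTop, a n < k)
    (h1 : ∀ᶠ n in atTop, (sw n → a (n + 1) = (a n + 1) % k) ∧ (¬ sw n → a (n + 1) = a n))
    (hf : ∃ᶠ n in atTop, sw n) {j : ℕ} (hj : j < k) : ∃ᶠ n in atTop, sw n ∧ a n = j := by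
  have step : ∀ i, (∃ᶠ n in atTop, sw n ∧ a n = i) → ∃ᶠ n in atTop, sw n ∧ a n = (i + 1) % k := by
    intro i hi
    rw [frequently_atTop] at hi ⊢
    intro N
    obtain ⟨N₁, hN₁⟩ := eventually_atTop.1 h1
    obtain ⟨n, hn, hsw, rfl⟩ := hi (max N N₁)
    obtain ⟨m, hm, hswm⟩ := frequently_atTop.1 hf (n + 1)
    classical
    have hex : ∃ m, n + 1 ≤ m ∧ sw m := ⟨m, hm, hswm⟩
    -- The next switch after `n`: the counter moves once at `n` and is then constant up to that
    -- time.
    refine ⟨Nat.find hex, by have := (Nat.find_spec hex).1; omega, (Nat.find_spec hex).2, ?_⟩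
    have key : ∀ m, n + 1 ≤ m → m ≤ Nat.find hex → a m = (a n + 1) % k := by
      intro m hm
      induction m, hm using Nat.le_induction with
      | base => exact fun _ => (hN₁ n (by omega)).1 hsw
      | succ m hm ih =>
        intro hle
        rw [← ih (by omega)]
        exact (hN₁ m (by omega)).2 fun hs => Nat.find_min hex (by omega) ⟨hm, hs⟩
    exact key _ (Nat.find_spec hex).1 le_rfl
  have iter : ∀ s i, (∃ᶠ n in atTop, sw n ∧ a n = i % k) →
      ∃ᶠ n in atTop, sw n ∧ a n = (i + s) % k := by
    intro s
    induction s with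
    | zero => exact fun i h => h
    | succ s ih =>
      intro i h
      have := step _ (ih i h)
      rwa [Nat.mod_add_mod] at this
  obtain ⟨i, hi⟩ : ∃ i : Fin k, ∃ᶠ n in atTop, sw n ∧ a n = i :=
    frequently_exists_finite ((hf.and_eventually h0).mono fun n hn => ⟨⟨a n, hn.2⟩, hn.1, rfl⟩)
  -- Some value `i` is advanced infinitely often, by the pigeonhole principle; `j + k - i` further
  -- advances lead to `j` modulo `k`. The summand `k` keeps the subtraction from being truncated.
  have := iter (j + k - i) i (by rwa [Nat.mod_eq_of_lt i.2])
  rwa [show (i : ℕ) + (j + k - i) = j + k by omega, Nat.add_mod_right, Nat.mod_eq_of_lt hj] at this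

theorem List.IsPrefix.exists_snoc {α : Type*} {p q : List α} (h : p <+: q) (hne : p ≠ q) :
    ∃ i, p ++ [i] <+: q := by
  obtain ⟨r, rfl⟩ := h
  cases r with
  | nil => simp at hne
  | cons i r => exact ⟨i, r, by simp⟩

theorem List.snoc_prefix_iff {α : Type*} {p q : List α} {i : α} :
    p ++ [i] <+: q ↔ p <+: q ∧ q[p.length]? = some i := by
  constructor
  · rintro ⟨r, rfl⟩
    simp
  · rintro ⟨⟨r, rfl⟩, h⟩
    cases r with
    | nil => simp at h
    | cons j r =>
      simp at h
      exact ⟨r, by simp [h]⟩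

/-! ### Addresses, leaves and steps in ordered trees -/

namespace ZTree

universe u
variable {Γ : Type u} {T : ZTree Γ}

theorem sub_append (T : ZTree Γ) (p q : List ℕ) : T.sub (p ++ q) = (T.sub p).bind fun t => t.sub q := by
  induction p generalizing T with
  | nil => simp [sub]
  | cons i p ih =>
    obtain ⟨lab, b, k, ch⟩ := T
    simp only [List.cons_append, sub]
    split_ifs
    · exact ih _
    · rfl

theorem Node.sub_eq (n : T.Node) : T.sub n.1 = some n.subtree := by
  simp [Node.subtree]

theorem Node.ext {n m : T.Node} (h : n.1 = m.1) : n = m := Subtype.ext h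

theorem Leaf.ext {l m : T.Leaf} (h : l.1.1 = m.1.1) : l = m := Subtype.ext (Subtype.ext h)

theorem Node.subtree_eq_of_sub {n : T.Node} {t : ZTree Γ} (h : T.sub n.1 = some t) :
    n.subtree = t := by
  simpa [h] using n.sub_eq.symm

theorem isSome_sub_singleton (t : ZTree Γ) (i : ℕ) : (t.sub [i]).isSome = true ↔ i < t.rootArity := by
  obtain ⟨lab, b, k, ch⟩ := t
  simp only [sub, rootArity]
  split_ifs with h <;> simp [h]

theorem isSome_sub_of_prefix {p q : List ℕ} (h : p <+: q) (hq : (T.sub q).isSome = true) :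
    (T.sub p).isSome = true := by
  obtain ⟨r, rfl⟩ := h
  rw [sub_append] at hq
  cases hp : T.sub p with
  | none => simp [hp] at hq
  | some t => rfl

theorem Node.isSome_sub_snoc (n : T.Node) (i : ℕ) :
    (T.sub (n.1 ++ [i])).isSome = true ↔ i < n.arity := by
  rw [sub_append, n.sub_eq]
  exact isSome_sub_singleton _ _

/-- The child number `i` of a node. -/
def Node.child (n : T.Node) (i : ℕ) (h : i < n.arity) : T.Node :=
  ⟨n.1 ++ [i], (n.isSome_sub_snoc i).2 h⟩

theorem Node.sub_child (n : T.Node) {i : ℕ} (h : i < n.arity) :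
    n.subtree.sub [i] = some (n.child i h).subtree := by
  have := (n.child i h).sub_eq
  simpa [Node.child, sub_append, n.sub_eq] using this

theorem Leaf.lt_arity {l : T.Leaf} {n : T.Node} {i : ℕ} (h : l.BelowChild n i) : i < n.arity :=
  (n.isSome_sub_snoc i).1 (isSome_sub_of_prefix h l.1.2)

theorem Leaf.BelowChild.isAncestor {l : T.Leaf} {n : T.Node} {i : ℕ} (h : l.BelowChild n i) :
    n.IsAncestor l.1 := (List.prefix_append _ _).trans h

theorem Leaf.BelowChild.unique {l : T.Leaf} {n : T.Node} {i j : ℕ} (h : l.BelowChild n i)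
    (h' : l.BelowChild n j) : i = j := by
  have h := (List.snoc_prefix_iff.1 h).2
  have h' := (List.snoc_prefix_iff.1 h').2
  rw [h] at h'
  exact Option.some.inj h'

theorem Leaf.exists_belowChild {l : T.Leaf} {n : T.Node} (h : n.IsAncestor l.1) (hne : n ≠ l.1) :
    ∃ i, l.BelowChild n i :=
  List.IsPrefix.exists_snoc h fun h => hne (Node.ext h)

theorem Leaf.eq_of_isAncestor {l : T.Leaf} {n : T.Node} (h : l.1.IsAncestor n) : n = l.1 := by
  by_contra hne
  obtain ⟨i, hi⟩ := List.IsPrefix.exists_snoc h fun h => hne (Node.ext h.symm)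
  have := (l.1.isSome_sub_snoc i).1 (isSome_sub_of_prefix hi n.2)
  rw [l.2] at this
  omega

theorem Node.exists_leaf (n : T.Node) : ∃ l : T.Leaf, n.IsAncestor l.1 := by
  obtain ⟨p, t, hp, ht⟩ := n.subtree.exists_leaf_address
  have h : T.sub (n.1 ++ p) = some t := by simp [sub_append, n.sub_eq, hp]
  exact ⟨⟨⟨n.1 ++ p, by simp [h]⟩,
    (congrArg rootArity (Node.subtree_eq_of_sub h)).trans ht⟩, List.prefix_append _ _⟩

theorem IsLeftmost.unique {S : Set T.Leaf} {l l' : T.Leaf} (h : IsLeftmost S l)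
    (h' : IsLeftmost S l') : l = l' :=
  Leaf.ext (le_antisymm (h.2 _ h'.1) (h'.2 _ h.1))

theorem exists_isLeftmost {S : Set T.Leaf} (h : S.Nonempty) : ∃ l, IsLeftmost S l := by
  obtain ⟨l, hl, hmin⟩ := Set.exists_min_image S (fun l => l.1.1) S.toFinite h
  exact ⟨l, hl, hmin⟩

theorem jump_nonempty {n : T.Node} {l : T.Leaf} (h : n.IsAncestor l.1) : (jump n l).Nonempty := by
  by_cases hn : n = l.1
  · exact ⟨l, Or.inl ⟨hn, rfl⟩⟩
  · obtain ⟨i, hi⟩ := Leaf.exists_belowChild h hn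
    have hlt := Leaf.lt_arity hi
    obtain ⟨l', hl'⟩ := (n.child ((i + 1) % n.arity) (Nat.mod_lt _ (by omega))).exists_leaf
    exact ⟨l', Or.inr ⟨i, hi, hl'⟩⟩

theorem isAncestor_of_mem_jump {n : T.Node} {l l' : T.Leaf} (h : l' ∈ jump n l) :
    n.IsAncestor l'.1 := by
  rcases h with ⟨rfl, rfl⟩ | ⟨i, -, h⟩
  · exact List.prefix_rfl
  · exact h.isAncestor

/-- The labels decrease along the branches of the tree. -/
def IsDecreasing (T : ZTree Γ) : Prop :=
  ∀ (n : T.Node) (i : ℕ) (h : i < n.arity), (n.child i h).label ⊆ n.label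

theorem IsDecreasing.label_subset (hT : T.IsDecreasing) {n m : T.Node} (h : n.IsAncestor m) :
    m.label ⊆ n.label := by
  obtain ⟨p, hp⟩ := m
  obtain ⟨r, hr⟩ := h
  dsimp only at hr
  induction r using List.reverseRecOn generalizing p with
  | nil =>
    rw [List.append_nil] at hr
    subst hr
    exact le_rfl
  | append_singleton r i ih =>
    subst hr
    rw [← List.append_assoc] at hp
    have h1 := isSome_sub_of_prefix (List.prefix_append _ _) hp
    let m' : T.Node := ⟨n.1 ++ r, h1⟩
    have h2 := hT m' i ((m'.isSome_sub_snoc i).1 hp)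
    refine Set.Subset.trans (le_of_eq ?_) (h2.trans (ih _ h1 rfl))
    congr 1
    exact Node.ext (by simp [Node.child, m'])

/-- `n` is the last ancestor of `l` whose label contains `S`. -/
def IsLastAncestorOfSet (n : T.Node) (l : T.Leaf) (S : Set Γ) : Prop :=
  n.IsAncestor l.1 ∧ S ⊆ n.label ∧
    ∀ i (h : i < n.arity), l.BelowChild n i → ¬ S ⊆ (n.child i h).label

/-- Since labels decrease along branches, it suffices to test the single child towards the leaf. The
form with sets is what the answers in the lower bound game need: there a whole set of letters takes
the place of one letter. -/
theorem isLastAncestor_iff (hT : T.IsDecreasing) {n : T.Node} {l : T.Leaf} {c : Γ} :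
    IsLastAncestor n l c ↔ IsLastAncestorOfSet n l {c} := by
  refine and_congr_right fun hn => and_congr (by simp) ⟨fun h i hi hl hc => ?_, fun h n' hn' hc => ?_⟩
  · have := (h (n.child i hi) hl (by simpa using hc)).length_le
    simp [Node.child] at this
  · by_contra hnn
    have hnn' : n.1 <+: n'.1 := by
      rcases le_total n.1.length n'.1.length with hle | hle
      · exact List.prefix_of_prefix_length_le hn hn' hle
      · exact absurd (List.prefix_of_prefix_length_le hn' hn hle) hnn
    obtain ⟨i, hi⟩ := List.IsPrefix.exists_snoc hnn' (fun h => hnn (by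
      rw [Node.IsAncestor, h]))
    have hl : l.BelowChild n i := hi.trans hn'
    exact h i (Leaf.lt_arity hl) hl (by
      simpa using hT.label_subset (n := n.child i (Leaf.lt_arity hl)) (m := n') hi hc)

theorem exists_isLastAncestorOfSet (l : T.Leaf) {S : Set Γ} (hS : S ⊆ T.rootLabel) :
    ∃ n, IsLastAncestorOfSet n l S := by
  let root : T.Node := ⟨[], by simp [sub]⟩
  have hroot : root.subtree = T := Node.subtree_eq_of_sub (by simp [sub, root])
  obtain ⟨n, hn, hmax⟩ := Set.exists_max_image {n : T.Node | n.IsAncestor l.1 ∧ S ⊆ n.label}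
    (fun n => n.1.length) (Set.toFinite _) ⟨root, List.nil_prefix, by rwa [Node.label, hroot]⟩
  refine ⟨n, hn.1, hn.2, fun i hi hl hS' => ?_⟩
  have := hmax (n.child i hi) ⟨hl, hS'⟩
  simp [Node.child] at this

theorem IsLastAncestor.unique {n n' : T.Node} {l : T.Leaf} {c : Γ} (h : IsLastAncestor n l c)
    (h' : IsLastAncestor n' l c) : n = n' :=
  Node.ext ((h'.2.2 _ h.1 h.2.1).eq_of_length_le (h.2.2 _ h'.1 h'.2.1).length_le)

theorem Step.unique {l : T.Leaf} {c : Γ} {n n' : T.Node} {l' l'' : T.Leaf} (h : Step l c n l')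
    (h' : Step l c n' l'') : n = n' ∧ l' = l'' := by
  obtain rfl := h.1.unique h'.1
  exact ⟨rfl, h.2.unique h'.2⟩

theorem exists_step (hT : T.IsDecreasing) (l : T.Leaf) {c : Γ} (hc : c ∈ T.rootLabel) :
    ∃ n l', Step l c n l' := by
  obtain ⟨n, hn⟩ := exists_isLastAncestorOfSet l (Set.singleton_subset_iff.2 hc)
  obtain ⟨l', hl'⟩ := exists_isLeftmost (jump_nonempty hn.1)
  exact ⟨n, l', (isLastAncestor_iff hT).2 hn, hl'⟩

/-! ### Infinite sequences of jumps -/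

/-- In an infinite sequence of jumps, one of the nodes used infinitely often is an ancestor of
almost all of them. -/
theorem exists_top_node {l : ℕ → T.Leaf} {ν : ℕ → T.Node} (hν : ∀ t, (ν t).IsAncestor (l t).1)
    (hj : ∀ t, l (t + 1) ∈ jump (ν t) (l t)) :
    ∃ n, (∃ᶠ t in atTop, ν t = n) ∧ ∀ᶠ t in atTop, n.IsAncestor (ν t) := by
  have hne : {n | ∃ᶠ t in atTop, ν t = n}.Nonempty :=
    frequently_exists_finite (Frequently.of_forall fun t => ⟨ν t, rfl⟩)
  -- The top node is a shortest address among the nodes used infinitely often.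
  obtain ⟨n, hn, hmin⟩ := Set.exists_min_image _ (fun n : T.Node => n.1.length) (Set.toFinite _) hne
  refine ⟨n, hn, ?_⟩
  have h1 : ∀ᶠ t in atTop, n.1.length ≤ (ν t).1.length := by
    by_contra h
    rw [not_eventually] at h
    obtain ⟨m, hm⟩ := frequently_exists_finite (p := fun (m : T.Node) t =>
      ν t = m ∧ ¬ n.1.length ≤ m.1.length) (h.mono fun t ht => ⟨_, rfl, ht⟩)
    obtain ⟨t, ht⟩ := hm.exists
    exact ht.2 (hmin m (hm.mono fun t ht => ht.1))
  obtain ⟨N, hN⟩ := eventually_atTop.1 h1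
  obtain ⟨t₀, ht₀, hνt₀⟩ := frequently_atTop.1 hn N
  -- Two ancestors of one leaf are comparable, so a node `ν t` that is not shorter than `n` lies
  -- below `n`; a jump at such a node stays below `n`.
  have hanc : ∀ t, N ≤ t → n.IsAncestor (l t).1 → n.IsAncestor (ν t) := fun t ht h =>
    List.prefix_of_prefix_length_le h (hν t) (hN t ht)
  refine eventually_atTop.2 ⟨t₀, fun t ht => hanc t (by omega) ?_⟩
  induction t, ht using Nat.le_induction with
  | base => exact hνt₀ ▸ hν t₀
  | succ t ht ih =>
    exact List.IsPrefix.trans (hanc t (by omega) ih) (isAncestor_of_mem_jump (hj t))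

/-- If the jumps take place below `n`, and infinitely many of them at `n`, then every child of `n`
is left infinitely often. -/
theorem frequently_leave_child {l l' : ℕ → T.Leaf} {ν : ℕ → T.Node} {n : T.Node}
    (hν : ∀ t, (ν t).IsAncestor (l t).1) (hj : ∀ t, l' t ∈ jump (ν t) (l t))
    (hn : ∀ᶠ t in atTop, n.IsAncestor (ν t)) (hf : ∃ᶠ t in atTop, ν t = n)
    (hsame : ∀ t i j, (l' t).BelowChild n i → (l (t + 1)).BelowChild n j → i = j)
    {i : ℕ} (hi : i < n.arity) : ∃ᶠ t in atTop, ν t = n ∧ (l t).BelowChild n i := by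
  -- The entry of the leaf's address at position `n.1.length` is the child of `n` above it. The
  -- default `0` is irrelevant for leaves below `n`, and `n` itself is not a leaf because of `hi`.
  have hb : ∀ m : T.Leaf, n.IsAncestor m.1 → m.BelowChild n (m.1.1[n.1.length]?.getD 0) := by
    intro m hm
    obtain ⟨j, hj⟩ := Leaf.exists_belowChild hm (by rintro rfl; have := m.2; omega)
    have := (List.snoc_prefix_iff.1 hj).2
    rw [this]
    exact hj
  have hl : ∀ᶠ t in atTop, n.IsAncestor (l t).1 := hn.mono fun t ht => List.IsPrefix.trans ht (hν t)
  have hl' : ∀ᶠ t in atTop, n.IsAncestor (l (t + 1)).1 := (tendsto_add_atTop_nat 1).eventually hl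
  have key := frequently_switch_of_cyclic (k := n.arity) (a := fun t => (l t).1.1[n.1.length]?.getD 0)
    (sw := fun t => ν t = n) (hl.mono fun t ht => Leaf.lt_arity (hb _ ht)) ?_ hf hi
  · refine (key.and_eventually hl).mono ?_
    rintro t ⟨⟨h1, rfl⟩, h2⟩
    exact ⟨h1, hb _ h2⟩
  · filter_upwards [hn, hl, hl'] with t h1 h2 h3
    -- A jump at `n` goes to the next child cyclically; a jump strictly below `n` stays under the
    -- same child. In both cases `hsame` transfers the child from `l' t` to `l (t + 1)`.
    refine ⟨fun h => ?_, fun h => ?_⟩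
    · rcases hj t with ⟨h4, -⟩ | ⟨j, hj1, hj2⟩
      · rw [h] at h4
        have := (l t).2
        rw [← h4] at this
        omega
      · rw [h] at hj1 hj2
        rw [(hb _ h2).unique hj1]
        exact (hsame t _ _ hj2 (hb _ h3)).symm
    · obtain ⟨j, hj'⟩ := List.IsPrefix.exists_snoc h1 (fun h' => h (Node.ext h'.symm))
      have e1 : (l t).BelowChild n j := hj'.trans (hν t)
      have e2 : (l' t).BelowChild n j := hj'.trans (isAncestor_of_mem_jump (hj t))
      rw [(hb _ h2).unique e1]
      exact (hsame t _ _ e2 (hb _ h3)).symm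

/-- The set of letters that are read infinitely often in a sequence of jumps below `n`. -/
theorem frequently_mem_limit [Finite Γ] (hT : T.IsDecreasing) {l l' : ℕ → T.Leaf} {ν : ℕ → T.Node}
    {S : ℕ → Set Γ} {n : T.Node} (hS : ∀ t, IsLastAncestorOfSet (ν t) (l t) (S t))
    (hj : ∀ t, l' t ∈ jump (ν t) (l t))
    (hn : ∀ᶠ t in atTop, n.IsAncestor (ν t)) (hf : ∃ᶠ t in atTop, ν t = n)
    (hsame : ∀ t i j, (l' t).BelowChild n i → (l (t + 1)).BelowChild n j → i = j) :
    {c | ∃ᶠ t in atTop, c ∈ S t} ⊆ n.label ∧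
      ∀ i (h : i < n.arity), ¬ {c | ∃ᶠ t in atTop, c ∈ S t} ⊆ (n.child i h).label := by
  constructor
  · intro c hc
    obtain ⟨t, h1, h2⟩ := (hc.and_eventually hn).exists
    exact hT.label_subset h2 ((hS t).2.1 h1)
  · intro i hi hsub
    -- Whenever child `i` is left, some letter of `S t` is outside its label. As the alphabet is
    -- finite, one such letter recurs forever.
    have := frequently_leave_child (fun t => (hS t).1) hj hn hf hsame hi
    obtain ⟨c, hc⟩ := frequently_exists_finite (ι := Γ)
      (p := fun c t => c ∈ S t ∧ c ∉ (n.child i hi).label) (this.mono fun t ht => by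
        obtain ⟨h1, h2⟩ := ht
        have h3 := (hS t).2.2
        rw [h1] at h3
        exact Set.not_subset.1 (h3 i hi h2))
    obtain ⟨t, -, ht⟩ := hc.exists
    exact ht (hsub (hc.mono fun t ht => ht.1))

end ZTree

/-! ### Muller conditions and the labels of Zielonka trees -/

theorem nonempty_infOcc {A : Type*} [Finite A] (w : ℕ → A) : (infOcc w).Nonempty :=
  frequently_exists_finite (Frequently.of_forall fun i => ⟨w i, rfl⟩)

/-- By finiteness of the set of subsets. The use is always the same: a subset of a label on the
other side of `F` is trapped in the label of a child. -/
theorem exists_isMaxAlternation {Γ : Type*} [Finite Γ] {F : Set (Set Γ)} {X Z : Set Γ}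
    (hZ : Z.Nonempty) (hZX : Z ⊆ X) (h : ¬ (Z ∈ F ↔ X ∈ F)) :
    ∃ Y, ZTree.IsMaxAlternation F X Y ∧ Z ⊆ Y := by
  obtain ⟨Y, hZY, hY⟩ := Set.Finite.exists_le_maximal
    (s := {Z : Set Γ | Z.Nonempty ∧ Z ⊆ X ∧ (Z ∈ F ↔ X ∉ F)}) (Set.toFinite _)
    (a := Z) ⟨hZ, hZX, by tauto⟩
  exact ⟨Y, hY, hZY⟩

namespace ZTree

universe u
variable {Γ : Type u} {T : ZTree Γ} {F : Set (Set Γ)}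

theorem sub_nil (T : ZTree Γ) : T.sub [] = some T := by simp [sub]

theorem sub_cons {lab : Set Γ} {b : Bool} {k : ℕ} {ch : Fin k → ZTree Γ} {i : ℕ} (h : i < k)
    (p : List ℕ) : (node lab b k ch).sub (i :: p) = (ch ⟨i, h⟩).sub p := by
  simp [sub, h]

theorem exists_of_sub_cons {lab : Set Γ} {b : Bool} {k : ℕ} {ch : Fin k → ZTree Γ} {i : ℕ}
    {p : List ℕ} {t : ZTree Γ} (h : (node lab b k ch).sub (i :: p) = some t) :
    ∃ h : i < k, (ch ⟨i, h⟩).sub p = some t := by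
  simp only [sub] at h
  split_ifs at h with hi
  exact ⟨hi, h⟩

theorem Alternates.sub {t : ZTree Γ} {p : List ℕ} (hT : T.Alternates F) (h : T.sub p = some t) :
    t.Alternates F := by
  induction p generalizing T with
  | nil =>
    obtain rfl : T = t := by simpa [ZTree.sub] using h
    exact hT
  | cons i p ih =>
    obtain ⟨lab, b, k, ch⟩ := T
    obtain ⟨hi, h⟩ := exists_of_sub_cons h
    exact ih (hT.2.2.2 _) h

theorem Alternates.isRound_iff (hT : T.Alternates F) (n : T.Node) : n.IsRound ↔ n.label ∈ F := by
  have := hT.sub n.sub_eq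
  unfold Node.IsRound Node.label
  generalize n.subtree = t at this ⊢
  obtain ⟨lab, b, k, ch⟩ := t
  exact this.1

theorem Alternates.child_label (hT : T.Alternates F) (n : T.Node) {i : ℕ} (h : i < n.arity) :
    IsMaxAlternation F n.label (n.child i h).label := by
  have h1 := hT.sub n.sub_eq
  have h2 := n.sub_child h
  unfold Node.arity at h
  unfold Node.label
  generalize (n.child i h).subtree = t' at h2 ⊢
  generalize n.subtree = t at h1 h2 ⊢
  obtain ⟨lab, b, k, ch⟩ := t
  obtain ⟨hi, h2⟩ := exists_of_sub_cons h2
  obtain rfl := Option.some.inj ((sub_nil _).symm.trans h2)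
  exact (h1.2.2.1 _).1 ⟨_, rfl⟩

theorem Alternates.exists_child (hT : T.Alternates F) (n : T.Node) {Y : Set Γ}
    (hY : IsMaxAlternation F n.label Y) : ∃ i, ∃ h : i < n.arity, (n.child i h).label = Y := by
  have h1 := hT.sub n.sub_eq
  have key : ∀ t, n.subtree = t → ∃ i, ∃ h : i < n.arity, (n.child i h).label = Y := by
    rintro ⟨lab, b, k, ch⟩ ht
    have hlab : n.label = lab := by rw [Node.label, ht, rootLabel]
    rw [ht] at h1
    obtain ⟨i, hi⟩ := (h1.2.2.1 Y).2 (hlab ▸ hY)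
    have har : (i : ℕ) < n.arity := by rw [Node.arity, ht]; exact i.2
    refine ⟨i, har, ?_⟩
    have h2 := n.sub_child har
    rw [ht, sub_cons i.2] at h2
    rw [Node.label, ← Option.some.inj ((sub_nil _).symm.trans h2)]
    exact hi
  exact key _ rfl

theorem Alternates.isDecreasing (hT : T.Alternates F) : T.IsDecreasing :=
  fun n _ h => (hT.child_label n h).1.2.1

/-- If `Z` and the label of `n` were on different sides of `F`, then `Z` would be contained in a
maximal alternating set, that is, in the label of a child. -/
theorem Alternates.mem_iff_isRound [Finite Γ] (hT : T.Alternates F) {n : T.Node} {Z : Set Γ}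
    (hZ : Z.Nonempty) (hZn : Z ⊆ n.label) (h : ∀ i (h : i < n.arity), ¬ Z ⊆ (n.child i h).label) :
    Z ∈ F ↔ n.IsRound := by
  rw [hT.isRound_iff]
  by_contra hc
  obtain ⟨Y, hY, hZY⟩ := exists_isMaxAlternation hZ hZn hc
  obtain ⟨i, hi, rfl⟩ := hT.exists_child n hY
  exact h i hi hZY

theorem Alternates.rootRound_sub {p : List ℕ} {t : ZTree Γ} (hT : T.Alternates F)
    (h : T.sub p = some t) :
    t.rootRound = true ↔ (T.rootRound = true ↔ Even p.length) := by
  induction p generalizing T with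
  | nil =>
    obtain rfl : T = t := by simpa [ZTree.sub] using h
    simp
  | cons i p ih =>
    obtain ⟨lab, b, k, ch⟩ := T
    obtain ⟨hi, h⟩ := exists_of_sub_cons h
    rw [ih (hT.2.2.2 _) h]
    have h1 := ((hT.2.2.1 _).1 ⟨⟨i, hi⟩, rfl⟩).1.2.2
    have h2 := hT.2.2.2 ⟨i, hi⟩
    have h3 := hT.1
    generalize ch ⟨i, hi⟩ = t' at *
    obtain ⟨lab', b', k', ch'⟩ := t'
    have h4 := h2.1
    simp only [rootLabel, rootRound, List.length_cons, Nat.even_add_one] at *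
    tauto

theorem length_le_height {p : List ℕ} (h : (T.sub p).isSome = true) : p.length ≤ T.height := by
  induction p generalizing T with
  | nil => simp
  | cons i p ih =>
    obtain ⟨lab, b, k, ch⟩ := T
    obtain ⟨t, ht⟩ := Option.isSome_iff_exists.1 h
    obtain ⟨hi, h⟩ := exists_of_sub_cons ht
    have := ih (T := ch ⟨i, hi⟩) (by simp [h])
    simp only [height, List.length_cons]
    exact (Nat.succ_le_succ this).trans
      (Finset.le_sup (f := fun i : Fin k => (ch i).height + 1) (Finset.mem_univ _))

/-- Shows that the subtraction in `Node.priority` is never truncated, so that the parity of a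
priority is that of the difference. -/
theorem Node.length_lt_priority (n : T.Node) : n.1.length ≤
    (if T.rootRound = true then 2 * ((T.height + 1) / 2) else 2 * (T.height / 2) + 1) := by
  have := length_le_height n.2
  split_ifs <;> omega

theorem Alternates.even_priority (hT : T.Alternates F) (n : T.Node) :
    Even n.priority ↔ n.IsRound := by
  have h := n.length_lt_priority
  rw [Node.IsRound, hT.rootRound_sub n.sub_eq, Node.priority, Nat.even_sub h]
  split_ifs with hr
  · simp [hr]
  · simp [hr]

theorem IsZielonkaTree.exists_step (hT : T.IsZielonkaTree F) (l : T.Leaf) (c : Γ) :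
    ∃ n l', Step l c n l' :=
  ZTree.exists_step hT.2.isDecreasing l (hT.1 ▸ Set.mem_univ c)

/-- The common core of both automata. Here `l' t` is the leaf to which a step leads and `l (t + 1)`
the leaf from which the next step starts. They coincide in the parity automaton, while in the Rabin
automaton only their images under `η` do; all that matters is that they are under the same child of
`n`. -/
theorem IsZielonkaTree.infOcc_mem_iff [Finite Γ] (hT : T.IsZielonkaTree F) {w : ℕ → Γ}
    {l l' : ℕ → T.Leaf} {ν : ℕ → T.Node} {n : T.Node} (hs : ∀ t, Step (l t) (w t) (ν t) (l' t))
    (hn : ∀ᶠ t in atTop, n.IsAncestor (ν t)) (hf : ∃ᶠ t in atTop, ν t = n)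
    (hsame : ∀ t i j, (l' t).BelowChild n i → (l (t + 1)).BelowChild n j → i = j) :
    w ∈ mullerLanguage F ↔ n.IsRound := by
  have h := frequently_mem_limit hT.2.isDecreasing (S := fun t => {w t})
    (fun t => (isLastAncestor_iff hT.2.isDecreasing).1 (hs t).1) (fun t => (hs t).2.1) hn hf hsame
  have he : {c | ∃ᶠ t in atTop, c ∈ ({w t} : Set Γ)} = infOcc w := by
    simp [infOcc, eq_comm]
  rw [he] at h
  exact hT.2.mem_iff_isRound (by have := nonempty_infOcc w; exact this) h.1 h.2

/-! ### The Zielonka tree parity automaton -/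

theorem IsZielonkaTree.isDeterministic (hT : T.IsZielonkaTree F) :
    T.parityAutomaton.IsDeterministic := by
  constructor
  · obtain ⟨l, hl⟩ := T.exists_leftmost
    exact ⟨l, Set.eq_singleton_iff_unique_mem.2 ⟨hl, fun l' hl' => IsLeftmost.unique hl' hl⟩⟩
  · intro l c
    obtain ⟨n, l', h⟩ := hT.exists_step l c
    refine ⟨(n.priority, l'), ⟨n, h, rfl⟩, ?_⟩
    rintro ⟨m, l''⟩ ⟨n', h', hm⟩
    obtain ⟨rfl, rfl⟩ := h.unique h'
    exact Prod.ext hm rfl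

/-- Nodes below `n` have longer addresses, hence no larger priorities. -/
theorem infOcc_priority {ν : ℕ → T.Node} {n : T.Node} (hn : ∀ᶠ t in atTop, n.IsAncestor (ν t))
    (hf : ∃ᶠ t in atTop, ν t = n) : IsGreatest (infOcc fun t => (ν t).priority) n.priority := by
  refine ⟨hf.mono fun t ht => congrArg Node.priority ht, fun m hm => ?_⟩
  obtain ⟨t, rfl, ht⟩ := (hm.and_eventually hn).exists
  exact Nat.sub_le_sub_left ht.length_le _

theorem IsZielonkaTree.priority_mem_iff [Finite Γ] (hT : T.IsZielonkaTree F) {w : ℕ → Γ}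
    {l : ℕ → T.Leaf} {ν : ℕ → T.Node} (hs : ∀ t, Step (l t) (w t) (ν t) (l (t + 1))) :
    (fun t => (ν t).priority) ∈ parityLanguage ↔ w ∈ mullerLanguage F := by
  obtain ⟨n, hf, hn⟩ := exists_top_node (fun t => (hs t).1.1) (fun t => (hs t).2.1)
  rw [hT.infOcc_mem_iff hs hn hf fun t i j hi hj => hi.unique hj, ← hT.2.even_priority]
  constructor
  · rintro ⟨m, hm, he⟩
    rwa [(infOcc_priority hn hf).unique hm]
  · exact fun h => ⟨_, infOcc_priority hn hf, h⟩

/-- The run of the parity automaton. -/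
theorem IsZielonkaTree.exists_run (hT : T.IsZielonkaTree F) (w : ℕ → Γ) {l₀ : T.Leaf} :
    ∃ (l : ℕ → T.Leaf) (ν : ℕ → T.Node), l 0 = l₀ ∧ ∀ t, Step (l t) (w t) (ν t) (l (t + 1)) := by
  choose n s hs using hT.exists_step
  let l : ℕ → T.Leaf := fun t => Nat.rec l₀ (fun t m => s m (w t)) t
  exact ⟨l, fun t => n (l t) (w t), rfl, fun t => hs _ _⟩

theorem IsZielonkaTree.language_parityAutomaton [Finite Γ] (hT : T.IsZielonkaTree F) :
    T.parityAutomaton.language = mullerLanguage F := by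
  ext w
  constructor
  · rintro ⟨q, hq, ρ, ⟨h0, hρ⟩, hacc⟩
    choose ν hν using fun t => (hρ t).1
    refine (hT.priority_mem_iff (w := w) (l := fun t => (ρ t).1) (ν := ν) fun t => ?_).1 ?_
    · have := (hν t).1
      rwa [(hρ t).2.1, (hρ t).2.2] at this
    · have h : (fun t => (ρ t).2.2.1) = fun t => (ν t).priority := funext fun t => (hν t).2
      rw [← h]
      exact hacc
  · intro hw
    obtain ⟨l₀, hl₀⟩ := T.exists_leftmost
    obtain ⟨l, ν, h0, hs⟩ := hT.exists_run w (l₀ := l₀)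
    refine ⟨l₀, hl₀, fun t => (l t, w t, (ν t).priority, l (t + 1)), ⟨h0, fun t =>
      ⟨⟨ν t, hs t, rfl⟩, rfl, rfl⟩⟩, (hT.priority_mem_iff hs).2 hw⟩

/-! ### The Rabin automaton -/

variable {η : T.Leaf → Fin T.memory}

/-- Where (⋆) is used. The pair that accepts belongs to a round node which is visited infinitely
often and whose subtree is eventually never left. If `l' t` and `l (t + 1)` were below different
children of it, their images under `η` would differ. -/
theorem IsZielonkaTree.mem_of_accepting_run [Finite Γ] (hT : T.IsZielonkaTree F)
    (hη : IsStarLabelling η) {w : ℕ → Γ} {l l' : ℕ → T.Leaf} {ν : ℕ → T.Node}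
    (hs : ∀ t, Step (l t) (w t) (ν t) (l' t)) (hη' : ∀ t, η (l' t) = η (l (t + 1)))
    (hacc : ν ∈ T.rabinCondition.language) : w ∈ mullerLanguage F := by
  obtain ⟨⟨n, hn⟩, ⟨m, hm, rfl : m = n⟩, hred⟩ := hacc
  -- Otherwise, by finiteness of the tree, a fixed node that is not below `m` would recur forever,
  -- and it is red.
  have hanc : ∀ᶠ t in atTop, m.IsAncestor (ν t) := by
    by_contra h
    rw [not_eventually] at h
    obtain ⟨n', hn'⟩ := frequently_exists_finite (p := fun (n' : T.Node) t =>
      ν t = n' ∧ ¬ m.IsAncestor n') (h.mono fun t ht => ⟨_, rfl, ht⟩)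
    obtain ⟨t, -, ht⟩ := hn'.exists
    refine Set.eq_empty_iff_forall_notMem.1 hred n' ⟨hn'.mono fun t ht => ht.1, ?_, ht⟩
    rintro rfl
    exact ht List.prefix_rfl
  refine (hT.infOcc_mem_iff hs hanc hm fun t i j hi hj => ?_).2 hn
  by_contra hij
  exact hη m hn i j hij _ _ hi hj (hη' t)

/-- The pair of the top node accepts: this node is round because the word is in the language. -/
theorem IsZielonkaTree.rabin_accepting [Finite Γ] (hT : T.IsZielonkaTree F) {w : ℕ → Γ}
    {l : ℕ → T.Leaf} {ν : ℕ → T.Node} (hs : ∀ t, Step (l t) (w t) (ν t) (l (t + 1)))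
    (hw : w ∈ mullerLanguage F) : ν ∈ T.rabinCondition.language := by
  obtain ⟨n, hf, hn⟩ := exists_top_node (fun t => (hs t).1.1) (fun t => (hs t).2.1)
  have hr := (hT.infOcc_mem_iff hs hn hf fun t i j hi hj => hi.unique hj).1 hw
  refine ⟨⟨n, hr⟩, ⟨n, hf, rfl⟩, Set.eq_empty_iff_forall_notMem.2 ?_⟩
  rintro m ⟨hm, -, hnm⟩
  obtain ⟨t, rfl, ht⟩ := (Frequently.and_eventually hm hn).exists
  exact hnm ht

theorem IsZielonkaTree.language_subset_rabinAutomaton [Finite Γ] (hT : T.IsZielonkaTree F)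
    (hη : IsStarLabelling η) : (rabinAutomaton η).language ⊆ mullerLanguage F := by
  rintro w ⟨q, hq, ρ, ⟨h0, hρ⟩, hacc⟩
  choose l l' hs h1 h2 using fun t => (hρ t).1
  refine hT.mem_of_accepting_run hη (w := w) (l := l) (l' := l') (ν := fun t => (ρ t).2.2.1)
    (fun t => ?_) (fun t => ?_) hacc
  · have := hs t
    rwa [(hρ t).2.1] at this
  · exact (h2 t).symm.trans ((hρ t).2.2.trans (h1 (t + 1)))

theorem IsZielonkaTree.language_rabinAutomaton [Finite Γ] (hT : T.IsZielonkaTree F)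
    (hη : IsStarLabelling η) : (rabinAutomaton η).language = mullerLanguage F := by
  refine (hT.language_subset_rabinAutomaton hη).antisymm fun w hw => ?_
  obtain ⟨l₀, hl₀⟩ := T.exists_leftmost
  obtain ⟨l, ν, h0, hs⟩ := hT.exists_run w (l₀ := l₀)
  exact ⟨η l₀, ⟨l₀, hl₀, rfl⟩, fun t => (η (l t), w t, ν t, η (l (t + 1))),
    ⟨congrArg η h0, fun t => ⟨⟨l t, l (t + 1), hs t, rfl, rfl⟩, rfl, rfl⟩⟩, hT.rabin_accepting hs hw⟩

theorem IsZielonkaTree.exists_isGivenByParityAutomaton (hT : T.IsZielonkaTree F)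
    (η : T.Leaf → Fin T.memory) : ∃ r₀ r, IsGivenByParityAutomaton η r₀ r := by
  choose n s hs using hT.exists_step
  obtain ⟨l₀, hl₀⟩ := T.exists_leftmost
  let m : List Γ → T.Leaf := fun u => u.foldl s l₀
  have hm : ∀ u c, m (u ++ [c]) = s (m u) c := fun u c => by simp [m]
  refine ⟨η l₀, fun u c => (η (m u), c, n (m u) c, η (m (u ++ [c]))), m, hl₀, rfl, fun u c =>
    ⟨n (m u) c, ?_, ⟨n (m u) c, ?_, rfl⟩, rfl⟩⟩ <;>
  · rw [hm]
    exact hs _ _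

/-- The induced run is that of the parity automaton with leaves replaced by their images under `η`.
Its outputs satisfy the Rabin condition for every word of the Muller language, which contains the
accepted words. -/
theorem IsZielonkaTree.isResolver [Finite Γ] (hT : T.IsZielonkaTree F) (hη : IsStarLabelling η)
    {r₀ : (rabinAutomaton η).Q} {r : List Γ → Γ → (rabinAutomaton η).Transition}
    (h : IsGivenByParityAutomaton η r₀ r) : (rabinAutomaton η).IsResolver r₀ r := by
  obtain ⟨m, hm0, rfl, hm⟩ := h
  choose n hs _ hr using hm
  have htr : ∀ u c, r u c ∈ (rabinAutomaton η).trans := fun u c => by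
    rw [hr]
    exact ⟨m u, m (u ++ [c]), hs u c, rfl, rfl⟩
  refine ⟨⟨m [], hm0, rfl⟩, htr, fun w hw => ?_⟩
  have hpre : ∀ i, (List.range (i + 1)).map w = (List.range i).map w ++ [w i] := fun i => by
    simp [List.range_succ]
  refine ⟨⟨by simp [hr]; rfl, fun i => ⟨htr _ _, by simp [hr], by simp [hr, hpre]; rfl⟩⟩, ?_⟩
  have hs' : ∀ t, Step (m ((List.range t).map w)) (w t) (n ((List.range t).map w) (w t))
      (m ((List.range (t + 1)).map w)) := fun t => by
    rw [hpre]
    exact hs _ _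
  have := hT.rabin_accepting (l := fun t => m ((List.range t).map w)) hs'
    (hT.language_subset_rabinAutomaton hη hw)
  simp only [Automaton.IsAccepting, hr]
  exact this

/-! ### Existence of Zielonka trees -/

theorem exists_alternates [Finite Γ] (F : Set (Set Γ)) (X : Set Γ) :
    ∃ T : ZTree Γ, T.rootLabel = X ∧ T.Alternates F := by
  induction X using WellFoundedLT.induction with
  | ind X ih =>
    have : Fintype {Y // IsMaxAlternation F X Y} := Fintype.ofFinite _
    let e := Fintype.equivFin {Y // IsMaxAlternation F X Y}
    -- The sets `Y` and `X` are on different sides of `F`, hence the induction on the label is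
    -- well-founded.
    have hlt : ∀ Y, IsMaxAlternation F X Y → Y < X := fun Y hY =>
      lt_of_le_of_ne hY.1.2.1 (by rintro rfl; have := hY.1.2.2; tauto)
    choose t ht1 ht2 using fun Y : {Y // IsMaxAlternation F X Y} => ih Y.1 (hlt _ Y.2)
    classical
    refine ⟨node X (decide (X ∈ F)) _ fun i => t (e.symm i), rfl, by simp, fun i j h => ?_,
      fun Y => ?_, fun i => ht2 _⟩
    · simpa [ht1, Subtype.ext_iff.symm] using h
    · constructor
      · rintro ⟨i, rfl⟩
        rw [ht1]
        exact (e.symm i).2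
      · intro hY
        exact ⟨e ⟨Y, hY⟩, by simp [ht1]⟩

end ZTree

/-! ### Sums over initial segments -/

/-- The sum of the first `i` values of `f`. -/
def offset {k : ℕ} (f : Fin k → ℕ) (i : ℕ) : ℕ := ∑ j ∈ Finset.univ.filter fun j : Fin k => (j : ℕ) < i, f j

theorem offset_zero {k : ℕ} (f : Fin k → ℕ) : offset f 0 = 0 := by simp [offset]

theorem offset_succ {k : ℕ} (f : Fin k → ℕ) (i : Fin k) : offset f (i + 1) = offset f i + f i := by
  have : (Finset.univ.filter fun j : Fin k => (j : ℕ) < i + 1) =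
      insert i (Finset.univ.filter fun j : Fin k => (j : ℕ) < i) := by
    ext j
    simp only [Finset.mem_filter, Finset.mem_univ, true_and, Finset.mem_insert, Fin.ext_iff]
    omega
  rw [offset, this, Finset.sum_insert (by simp), offset, add_comm]

theorem offset_mono {k : ℕ} (f : Fin k → ℕ) : Monotone (offset f) := fun _ _ h =>
  Finset.sum_le_sum_of_subset fun x hx => by
    simp only [Finset.mem_filter, Finset.mem_univ, true_and] at hx ⊢
    omega

theorem offset_add_lt {k : ℕ} {f : Fin k → ℕ} {i : Fin k} {a j : ℕ} (ha : a < f i) (hij : i < j) :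
    offset f i + a < offset f j :=
  calc offset f i + a < offset f (i + 1) := by rw [offset_succ]; omega
    _ ≤ offset f j := offset_mono f hij

theorem offset_eq_sum {k : ℕ} (f : Fin k → ℕ) : offset f k = ∑ i, f i := by simp [offset]

/-- The intervals of length `f i` starting at `offset f i` are disjoint, so a number reveals both
the interval and the position in it. This separates the tags at round nodes as well as the numbers
of leaves. -/
theorem offset_add_inj {k : ℕ} {f : Fin k → ℕ} {i j : Fin k} {a b : ℕ} (ha : a < f i) (hb : b < f j)
    (h : offset f i + a = offset f j + b) : i = j ∧ a = b := by
  have hij : i = j := by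
    rcases lt_trichotomy i j with hlt | rfl | hlt
    · have := offset_add_lt ha hlt
      omega
    · rfl
    · have := offset_add_lt hb hlt
      omega
  subst hij
  exact ⟨rfl, by omega⟩

theorem exists_offset_add {k : ℕ} {f : Fin k → ℕ} {x : ℕ} (h : x < ∑ i, f i) :
    ∃ i : Fin k, ∃ a < f i, x = offset f i + a := by
  rw [← offset_eq_sum] at h
  have key : ∀ m ≤ k, x < offset f m → ∃ i : Fin k, ∃ a < f i, x = offset f i + a := by
    intro m
    induction m with
    | zero => simp [offset_zero]
    | succ m ih =>
      intro hm hx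
      by_cases h' : x < offset f m
      · exact ih (by omega) h'
      · have := offset_succ f ⟨m, hm⟩
        exact ⟨⟨m, hm⟩, x - offset f m, by simp only at this; omega, by simp only; omega⟩
  exact key k le_rfl h

/-! ### Paths in trees of histories -/

section Paths

universe u

variable {Γ E : Type u}

/-- The letters occurring infinitely often in a sequence of edges. -/
def infColours (col : E → Option Γ) (e : ℕ → E) : Set Γ := {c | ∃ᶠ n in atTop, col (e n) = some c}

theorem frequently_shift {p : ℕ → Prop} (N : ℕ) :
    (∃ᶠ n in atTop, p (n + N)) ↔ ∃ᶠ n in atTop, p n := by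
  rw [← frequently_map (m := fun n => n + N) (P := p), map_add_atTop_eq_nat]

theorem infColours_shift (col : E → Option Γ) (e : ℕ → E) (N : ℕ) :
    infColours col (fun n => e (n + N)) = infColours col e := by
  ext c
  exact frequently_shift (p := fun n => col (e n) = some c) N

/-- A set `A` of reversed histories stands for the forest with the edges from `h` to `e :: h ∈ A`.
Its infinite paths satisfy the Muller condition. -/
def PathsWin (F : Set (Set Γ)) (col : E → Option Γ) (A : Set (List E)) : Prop :=
  ∀ (e : ℕ → E) (g : ℕ → List E), (∀ n, g (n + 1) = e n :: g n) → (∀ n, g (n + 1) ∈ A) →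
    infColours col e ∈ F

/-- The Muller condition is even satisfied by the paths that may, after every edge, be continued in
any history with the same tag `τ` and a rank `ρ` that is not larger. -/
def ClosurePathsWin (F : Set (Set Γ)) (col : E → Option Γ) (A : Set (List E)) (τ : List E → ℕ)
    (ρ : List E → Ordinal.{u}) : Prop :=
  ∀ (e : ℕ → E) (g : ℕ → List E), (∀ n, e n :: g n ∈ A) →
    (∀ n, τ (g (n + 1)) = τ (e n :: g n) ∧ ρ (g (n + 1)) ≤ ρ (e n :: g n)) → infColours col e ∈ F

/-- At square nodes ranks become lexicographic tuples. Pulling the order back to `N` and taking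
ranks there collapses them to ordinals again, so that the induction on the tree keeps a single type
of ranks. -/
theorem exists_ordinal_rank {N : Type u} {L : Type*} [LinearOrder L] [WellFoundedLT L] (f : N → L) :
    ∃ ρ : N → Ordinal.{u}, ∀ a b, ρ a ≤ ρ b → f a ≤ f b := by
  have : IsWellFounded N (InvImage (· < ·) f) := ⟨InvImage.wf f wellFounded_lt⟩
  refine ⟨IsWellFounded.rank (InvImage (· < ·) f), fun a b h => ?_⟩
  by_contra! hlt
  exact absurd (IsWellFounded.rank_lt_of_rel (r := InvImage (· < ·) f) hlt) (not_lt.2 h)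

theorem rank_le_rank {N : Type u} {r : N → N → Prop} [IsWellFounded N r] {a b : N}
    (h : ∀ c, r c a → r c b) : IsWellFounded.rank r a ≤ IsWellFounded.rank r b := by
  rw [IsWellFounded.rank_eq]
  exact Ordinal.iSup_le fun c => Order.succ_le_of_lt (IsWellFounded.rank_lt_of_rel (h c c.2))

theorem eventually_const_of_antitone {L : Type*} [LinearOrder L] [WellFoundedLT L] {f : ℕ → L}
    (hf : ∀ n, f (n + 1) ≤ f n) : ∃ N, ∀ n, N ≤ n → f n = f N := by
  obtain ⟨_, ⟨N, rfl⟩, hN⟩ := wellFounded_lt.has_min (Set.range f) ⟨f 0, 0, rfl⟩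
  exact ⟨N, fun n hn => (antitone_nat_of_succ_le hf hn).antisymm (not_lt.1 (hN _ ⟨n, rfl⟩))⟩

/-! ### Tags and ranks of histories at the nodes of a Zielonka tree -/

section Closure

variable {F : Set (Set Γ)} {col : E → Option Γ} {A : Set (List E)}

theorem infColours_subset {X : Set Γ} {e : ℕ → E} (h : ∀ n c, col (e n) = some c → c ∈ X) :
    infColours col e ⊆ X := fun c hc => by
  obtain ⟨n, hn⟩ := Frequently.exists hc
  exact h n c hn

variable [Finite Γ]

theorem exists_infColours {p : Γ → Prop} {e : ℕ → E}
    (h : ∃ᶠ n in atTop, ∃ c, col (e n) = some c ∧ p c) : ∃ c ∈ infColours col e, p c := by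
  obtain ⟨c, hc⟩ := frequently_exists_finite (p := fun c n => col (e n) = some c ∧ p c) h
  obtain ⟨n, hn⟩ := hc.exists
  exact ⟨c, hc.mono fun n hn => hn.1, hn.2⟩

/-- All non-empty subsets of `X` are on the same side of `F` as `X`. So if `X ∉ F` the forest has no
infinite path at all, and if `X ∈ F` it has none without colours. The rank of the corresponding
extension relation makes this survive the passage to closure paths: along them it would decrease
forever unless coloured edges recur and `X ∈ F`. -/
theorem exists_closure_of_leaf (hF : ∅ ∉ F) {X : Set Γ} (hX : ∀ Y, ¬ ZTree.IsMaxAlternation F X Y)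
    (hA : PathsWin F col A) (hcol : ∀ e h, e :: h ∈ A → ∀ c, col e = some c → c ∈ X) :
    ∃ ρ, ClosurePathsWin F col A (fun _ => 0) ρ := by
  have hiff : ∀ Z : Set Γ, Z.Nonempty → Z ⊆ X → (Z ∈ F ↔ X ∈ F) := fun Z hZ hZX => by
    by_contra hc
    obtain ⟨Y, hY, -⟩ := exists_isMaxAlternation hZ hZX hc
    exact hX Y hY
  let r : List E → List E → Prop := fun h' h => ∃ e, h' = e :: h ∧ h' ∈ A ∧ (X ∈ F → col e = none)
  have hr : IsWellFounded (List E) r := by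
    rw [isWellFounded_iff, wellFounded_iff_isEmpty_descending_chain]
    refine ⟨fun ⟨g, hg⟩ => ?_⟩
    choose e he hgA hnone using hg
    have h1 := hA e g he hgA
    have h2 : infColours col e ⊆ X := infColours_subset fun n => hcol _ (g n) (he n ▸ hgA n)
    rcases Set.eq_empty_or_nonempty (infColours col e) with h3 | h3
    · exact hF (h3 ▸ h1)
    · obtain ⟨c, hc⟩ := h3
      obtain ⟨n, hn⟩ := Frequently.exists hc
      rw [hnone n ((hiff _ ⟨c, hc⟩ h2).1 h1)] at hn
      cases hn
  refine ⟨IsWellFounded.rank r, fun e g he hg => ?_⟩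
  have hfreq : ∃ᶠ n in atTop, ∃ c, col (e n) = some c ∧ X ∈ F := by
    by_contra hcon
    rw [not_frequently] at hcon
    obtain ⟨N, hN⟩ := eventually_atTop.1 hcon
    refine not_strictAnti_of_wellFoundedLT (fun n => IsWellFounded.rank r (g (n + N)))
      (strictAnti_nat_of_succ_lt fun n => ?_)
    have := (hg (n + N)).2
    rw [show n + 1 + N = n + N + 1 by omega]
    refine this.trans_lt (IsWellFounded.rank_lt_of_rel ⟨_, rfl, he _, fun hXF => ?_⟩)
    cases hc : col (e (n + N)) with
    | none => rfl
    | some c => exact absurd ⟨c, hc, hXF⟩ (hN (n + N) (by omega))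
  obtain ⟨c, hc, hXF⟩ := exists_infColours hfreq
  exact (hiff _ ⟨c, hc⟩ (infColours_subset fun n => hcol _ _ (he n))).2 hXF

/-! ### Round nodes -/

open Classical in
/-- A cyclic counter, advanced whenever an edge has a colour outside of the current set. -/
noncomputable def cyclicIndex (col : E → Option Γ) {k : ℕ} (hk : 0 < k) (Y : Fin k → Set Γ) :
    List E → Fin k
  | [] => ⟨0, hk⟩
  | e :: h =>
    if ∃ c, col e = some c ∧ c ∉ Y (cyclicIndex col hk Y h) then
      ⟨(cyclicIndex col hk Y h + 1) % k, Nat.mod_lt _ hk⟩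
    else cyclicIndex col hk Y h

/-- A cyclic counter points to a child label `Y i`. If it advances forever, each `Y j` misses a
recurring colour, and the limit set is in `F` by maximality. If it stops at `i`, the remaining path
lives in the forest `B i` with colours in `Y i`, where the induction hypothesis applies. A closure
path must not disturb the counter; this is why the tag encodes it, which costs the sum of the
children's memories. -/
theorem exists_closure_of_round {k : ℕ} (hk : 0 < k) {X : Set Γ} {Y : Fin k → Set Γ} (hXF : X ∈ F)
    (hY : ∀ Z, ZTree.IsMaxAlternation F X Z → ∃ i, Y i = Z) (mem : Fin k → ℕ)
    (ih : ∀ i (B : Set (List E)), PathsWin F col B →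
      (∀ e h, e :: h ∈ B → ∀ c, col e = some c → c ∈ Y i) →
      ∃ τ ρ, (∀ h, τ h < mem i) ∧ ClosurePathsWin F col B τ ρ)
    (hA : PathsWin F col A) (hcol : ∀ e h, e :: h ∈ A → ∀ c, col e = some c → c ∈ X) :
    ∃ τ ρ, (∀ h, τ h < ∑ i, mem i) ∧ ClosurePathsWin F col A τ ρ := by
  let idx := cyclicIndex col hk Y
  let B : Fin k → Set (List E) := fun i =>
    {x | x ∈ A ∧ ∃ e h, x = e :: h ∧ idx h = i ∧ ∀ c, col e = some c → c ∈ Y i}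
  choose τ ρ hτ hρ using fun i => ih i (B i) (fun e g h1 h2 => hA e g h1 fun n => (h2 n).1)
    (by
      rintro e h ⟨-, e', h', heq, -, hc⟩
      obtain ⟨rfl, rfl⟩ := List.cons.inj heq
      exact hc)
  refine ⟨fun h => offset mem (idx h) + τ (idx h) h, fun h => ρ (idx h) h, fun h => ?_, ?_⟩
  · rw [← offset_eq_sum]
    exact offset_add_lt (hτ _ _) (idx h).2
  · intro e g he hg
    have hg1 : ∀ n, idx (g (n + 1)) = idx (e n :: g n) := fun n =>
      (offset_add_inj (hτ _ _) (hτ _ _) (hg n).1).1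
    have hg2 : ∀ n, τ (idx (e n :: g n)) (g (n + 1)) = τ (idx (e n :: g n)) (e n :: g n) := fun n => by
      have := (offset_add_inj (hτ _ _) (hτ _ _) (hg n).1).2
      rwa [hg1] at this
    have hg3 : ∀ n, ρ (idx (e n :: g n)) (g (n + 1)) ≤ ρ (idx (e n :: g n)) (e n :: g n) := fun n => by
      have := (hg n).2
      dsimp only at this
      rwa [hg1] at this
    by_cases hsw : ∃ᶠ n in atTop, ∃ c, col (e n) = some c ∧ c ∉ Y (idx (g n))
    · have hno : ∀ j, ¬ infColours col e ⊆ Y j := by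
        intro j hj
        have h1 : ∃ᶠ n in atTop, (∃ c, col (e n) = some c ∧ c ∉ Y (idx (g n))) ∧ (idx (g n) : ℕ) = j := by
          refine frequently_switch_of_cyclic (k := k) (Eventually.of_forall fun n => (idx (g n)).2)
            (Eventually.of_forall fun n => ?_) hsw j.2
          rw [hg1]
          constructor
          · intro h
            simp only [idx, cyclicIndex]
            rw [if_pos h]
          · intro h
            simp only [idx, cyclicIndex]
            rw [if_neg h]
        obtain ⟨c, hc, hcj⟩ := exists_infColours (p := fun c => c ∉ Y j) (h1.mono fun n hn => by
          obtain ⟨h2, h3⟩ := hn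
          rwa [Fin.ext h3] at h2)
        exact hcj (hj hc)
      have hne : (infColours col e).Nonempty := by
        by_contra h
        rw [Set.not_nonempty_iff_eq_empty] at h
        -- The empty set would be contained in the label of the first child, which exists as `0 <
        -- k`.
        exact hno ⟨0, hk⟩ (h ▸ Set.empty_subset _)
      by_contra hcon
      obtain ⟨Z, hZ, hsub⟩ := exists_isMaxAlternation hne
        (infColours_subset fun n => hcol _ _ (he n)) (F := F) (by tauto)
      obtain ⟨i, rfl⟩ := hY Z hZ
      exact hno i hsub
    · rw [not_frequently] at hsw
      obtain ⟨N, hN⟩ := eventually_atTop.1 hsw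
      have hidx : ∀ n, N ≤ n → idx (e n :: g n) = idx (g n) := fun n hn => by
        simp only [idx, cyclicIndex]
        rw [if_neg (hN n hn)]
      have hconst : ∀ n, N ≤ n → idx (g n) = idx (g N) := fun n hn => by
        induction n, hn using Nat.le_induction with
        | base => rfl
        | succ n hn ihn => rw [hg1, hidx n hn, ihn]
      rw [← infColours_shift col e N]
      refine hρ (idx (g N)) (fun n => e (n + N)) (fun n => g (n + N)) (fun n => ⟨he _, _, _, rfl,
        hconst _ (by omega), fun c hc => ?_⟩) fun n => ?_
      · by_contra hcn
        rw [← hconst (n + N) (by omega)] at hcn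
        exact hN (n + N) (by omega) ⟨c, hc, hcn⟩
      · have h1 := hg2 (n + N)
        have h2 := hg3 (n + N)
        rw [hidx _ (by omega), hconst _ (by omega)] at h1 h2
        rw [show n + 1 + N = n + N + 1 by omega]
        exact ⟨h1, h2⟩

end Closure

end Paths

section Closure

universe u

variable {Γ E : Type u} {F : Set (Set Γ)} {col : E → Option Γ} {A : Set (List E)}

/-! ### Square nodes -/

/-- There is a path from `h` to `h'` in the forest given by `A`. -/
def HistoryReach (A : Set (List E)) (h h' : List E) : Prop :=
  h <:+ h' ∧ ∀ v, h <:+ v → v <:+ h' → v ≠ h → v ∈ A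

theorem HistoryReach.cons {h h' : List E} {e : E} (hA : e :: h ∈ A) (hr : HistoryReach A (e :: h) h') :
    HistoryReach A h h' := by
  refine ⟨(List.suffix_cons e h).trans hr.1, fun v h1 h2 h3 => ?_⟩
  by_cases hv : v = e :: h
  · exact hv ▸ hA
  · refine hr.2 v (List.suffix_of_suffix_length_le hr.1 h2 ?_) h2 hv
    have h4 : h.length ≠ v.length := fun h4 => h3 (h1.eq_of_length h4).symm
    have := h1.length_le
    simp only [List.length_cons]
    omega

/-- Some edge that can be reached from the first history and ends in the second one has a colour
outside of the current set; the index of the current set is advanced. -/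
def ReachOutside (col : E → Option Γ) (A : Set (List E)) {k : ℕ} (Y : Fin k → Set Γ)
    (y x : List E × Fin k) : Prop :=
  HistoryReach A x.1 y.1 ∧ (y.2 : ℕ) = (x.2 + 1) % k ∧
    ∃ e h, y.1 = e :: h ∧ x.1 <:+ h ∧ ∃ c, col e = some c ∧ c ∉ Y x.2

/-- An infinite sequence of longer and longer histories is contained in an infinite path. -/
theorem exists_path_of_chain {h : ℕ → List E} (hr : ∀ n, HistoryReach A (h n) (h (n + 1)))
    (hlt : ∀ n, (h n).length < (h (n + 1)).length) :
    ∃ (e : ℕ → E) (g : ℕ → List E), (∀ n, g (n + 1) = e n :: g n) ∧ (∀ n, g (n + 1) ∈ A) ∧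
      ∀ n, ∃ m, n ≤ m ∧ h (n + 1) = e m :: g m := by
  have hsuf : ∀ n m, n ≤ m → h n <:+ h m := fun n m hnm => by
    induction m, hnm using Nat.le_induction with
    | base => exact List.suffix_rfl
    | succ m _ ih => exact ih.trans (hr m).1
  have hlen : ∀ n, (h 0).length + n ≤ (h n).length := fun n => by
    induction n with
    | zero => simp
    | succ n ih => have := hlt n; omega
  have hA : ∀ n v, v <:+ h n → (h 0).length < v.length → v ∈ A := fun n => by
    induction n with
    | zero => exact fun v hv hl => absurd hv.length_le (by omega)
    | succ n ih =>
      intro v hv hl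
      by_cases hvn : v.length ≤ (h n).length
      · exact ih v (List.suffix_of_suffix_length_le hv (hr n).1 hvn) hl
      · exact (hr n).2 v (List.suffix_of_suffix_length_le (hr n).1 hv (by omega)) hv
          (by rintro rfl; exact hvn le_rfl)
  -- The histories are nested suffixes of unbounded length. The path consists of their suffixes of
  -- length `(h 0).length + m`, which `huniq` shows not to depend on the history they are taken
  -- from.
  let g : ℕ → List E := fun m => (h m).drop ((h m).length - ((h 0).length + m))
  have hgs : ∀ m, g m <:+ h m := fun m => List.drop_suffix _ _
  have hgl : ∀ m, (g m).length = (h 0).length + m := fun m => by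
    have := hlen m
    simp only [g, List.length_drop]
    omega
  have huniq : ∀ n m v, v <:+ h n → v.length = (h 0).length + m → v = g m := by
    intro n m v hv hl
    have h1 := hv.trans (hsuf n (max n m) (le_max_left _ _))
    have h2 := (hgs m).trans (hsuf m (max n m) (le_max_right _ _))
    exact (List.suffix_of_suffix_length_le h1 h2 (by rw [hl, hgl])).eq_of_length (by rw [hl, hgl])
  have hstep : ∀ m, ∃ e, g (m + 1) = e :: g m := by
    intro m
    cases hg : g (m + 1) with
    | nil =>
      have := hgl (m + 1)
      rw [hg] at this
      simp at this
    | cons e x =>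
      have hl := hgl (m + 1)
      have hs := hgs (m + 1)
      rw [hg] at hl hs
      rw [huniq (m + 1) m x ((List.suffix_cons e x).trans hs) (by simp at hl; omega)]
      exact ⟨e, rfl⟩
  choose e he using hstep
  refine ⟨e, g, he, fun n => hA (n + 1) _ (hgs _) (by rw [hgl]; omega), fun n => ?_⟩
  have := hlen (n + 1)
  -- The index of the last edge of `h (n + 1)`, counted from the end of `h 0`.
  refine ⟨(h (n + 1)).length - (h 0).length - 1, by omega, ?_⟩
  rw [← he]
  exact huniq (n + 1) _ _ List.suffix_rfl (by omega)

variable [Finite Γ]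

/-- An infinite descending chain yields an infinite path. It wins, so its limit set is in `F`; as `X
∉ F`, this set is contained in some `Y i`. But the chain goes cyclically through all indices and
sees a colour outside of `Y i` each time it is at `i`. -/
theorem wellFounded_reachOutside (hF : ∅ ∉ F) {k : ℕ} {X : Set Γ} {Y : Fin k → Set Γ} (hXF : X ∉ F)
    (hY : ∀ Z, ZTree.IsMaxAlternation F X Z → ∃ i, Y i = Z)
    (hA : PathsWin F col A) (hcol : ∀ e h, e :: h ∈ A → ∀ c, col e = some c → c ∈ X) :
    IsWellFounded _ (ReachOutside col A Y) := by
  rw [isWellFounded_iff, wellFounded_iff_isEmpty_descending_chain]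
  refine ⟨fun ⟨f, hf⟩ => ?_⟩
  have hlt : ∀ n, (f n).1.length < (f (n + 1)).1.length := fun n => by
    obtain ⟨-, -, e, h, h1, h2, -⟩ := hf n
    have := h2.length_le
    rw [h1, List.length_cons]
    omega
  obtain ⟨e, g, hg, hgA, hm⟩ := exists_path_of_chain (fun n => (hf n).1) hlt
  have hwin := hA e g hg hgA
  have hne : (infColours col e).Nonempty := by
    rw [Set.nonempty_iff_ne_empty]
    exact fun h => hF (h ▸ hwin)
  obtain ⟨Z, hZ, hsub⟩ := exists_isMaxAlternation hne
    (infColours_subset fun n => hcol _ _ (hg n ▸ hgA n)) (F := F) (by tauto)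
  obtain ⟨i, rfl⟩ := hY Z hZ
  have hfi := frequently_switch_of_cyclic (k := k) (a := fun n => ((f n).2 : ℕ)) (sw := fun _ => True)
    (Eventually.of_forall fun n => (f n).2.2)
    (Eventually.of_forall fun n => ⟨fun _ => (hf n).2.1, fun h => absurd trivial h⟩)
    (Frequently.of_forall fun _ => trivial) i.2
  have hbad : ∃ᶠ m in atTop, ∃ c, col (e m) = some c ∧ c ∉ Y i := by
    rw [frequently_atTop] at hfi ⊢
    intro N
    obtain ⟨n, hn, -, hni⟩ := hfi N
    obtain ⟨m, hnm, hem⟩ := hm n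
    obtain ⟨-, -, e', h', h1, -, h2⟩ := hf n
    obtain ⟨rfl, rfl⟩ := List.cons.inj (h1.symm.trans hem)
    rw [Fin.ext hni] at h2
    exact ⟨m, by omega, h2⟩
  obtain ⟨c, hc, hci⟩ := exists_infColours hbad
  exact hci (hsub hc)

/-- The child responsible for a history is read off from the least value `κ` of the pairs of a
`ReachOutside` rank and an index. Along edges of the forest `κ` never grows, and an edge that keeps
it has its colour in the chosen child's label. Making `κ` the leading part of the rank forces it to
be eventually constant on closure paths, so that one child takes over. The tag need not mention the
child, and the maximum of the memories suffices. -/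
theorem exists_closure_of_square (hF : ∅ ∉ F) {k : ℕ} (hk : 0 < k) {X : Set Γ} {Y : Fin k → Set Γ}
    (hXF : X ∉ F) (hY : ∀ Z, ZTree.IsMaxAlternation F X Z → ∃ i, Y i = Z) (mem : Fin k → ℕ)
    (ih : ∀ i (B : Set (List E)), PathsWin F col B →
      (∀ e h, e :: h ∈ B → ∀ c, col e = some c → c ∈ Y i) →
      ∃ τ ρ, (∀ h, τ h < mem i) ∧ ClosurePathsWin F col B τ ρ)
    (hA : PathsWin F col A) (hcol : ∀ e h, e :: h ∈ A → ∀ c, col e = some c → c ∈ X) :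
    ∃ τ ρ, (∀ h, τ h < Finset.univ.sup mem) ∧ ClosurePathsWin F col A τ ρ := by
  have hwf := wellFounded_reachOutside hF hXF hY hA hcol
  let μ : List E × Fin k → Ordinal.{u} := IsWellFounded.rank (ReachOutside col A Y)
  have hne : (Finset.univ : Finset (Fin k)).Nonempty := ⟨⟨0, hk⟩, Finset.mem_univ _⟩
  let κ : List E → Ordinal.{u} ×ₗ Fin k := fun h => Finset.univ.inf' hne fun i => toLex (μ (h, i), i)
  have hκle : ∀ h i, κ h ≤ toLex (μ (h, i), i) := fun h i => Finset.inf'_le _ (Finset.mem_univ i)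
  have hκmem : ∀ h, ∃ i, κ h = toLex (μ (h, i), i) := fun h => by
    obtain ⟨i, -, hi⟩ := Finset.exists_mem_eq_inf' hne fun i : Fin k => toLex (μ (h, i), i)
    exact ⟨i, hi⟩
  have hκmono : ∀ e h, e :: h ∈ A → κ (e :: h) ≤ κ h := fun e h heA => by
    obtain ⟨i, hi⟩ := hκmem h
    rw [hi]
    -- Whatever can be reached from `e :: h` can be reached from `h`, hence ranks do not grow along
    -- edges.
    refine (hκle _ i).trans (Prod.Lex.toLex_mono ⟨rank_le_rank fun c hc => ?_, le_rfl⟩)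
    obtain ⟨h1, h2, e', h', h3, h4, h5⟩ := hc
    exact ⟨h1.cons heA, h2, e', h', h3, (List.suffix_cons e h).trans h4, h5⟩
  have hκcol : ∀ e h, e :: h ∈ A → κ (e :: h) = κ h → ∀ c, col e = some c →
      c ∈ Y (ofLex (κ h)).2 := fun e h heA heq c hc => by
    by_contra hcY
    obtain ⟨i, hi⟩ := hκmem h
    rw [hi] at hcY
    -- A colour outside of the current set makes `e :: h` with the next index a smaller element, and
    -- `κ` would drop.
    have hlt : μ (e :: h, ⟨(i + 1) % k, Nat.mod_lt _ hk⟩) < μ (h, i) := by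
      refine IsWellFounded.rank_lt_of_rel (r := ReachOutside col A Y)
        ⟨⟨List.suffix_cons e h, fun v h1 h2 h3 => ?_⟩, rfl, e, h, rfl, List.suffix_rfl, c, hc, hcY⟩
      rcases List.suffix_cons_iff.1 h2 with rfl | h2
      · exact heA
      · exact absurd (h2.eq_of_length_le h1.length_le) h3
    refine absurd (hκle (e :: h) ⟨(i + 1) % k, Nat.mod_lt _ hk⟩) (not_le.2 ?_)
    rw [heq, hi]
    exact Prod.Lex.toLex_lt_toLex.2 (Or.inl hlt)
  -- The edges along which `κ` keeps the value `x`; their colours lie in the label of the child that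
  -- `x` selects.
  let B : Ordinal.{u} ×ₗ Fin k → Set (List E) := fun x =>
    {y | y ∈ A ∧ ∃ e h, y = e :: h ∧ κ h = x ∧ κ y = x}
  choose τ ρ hτ hρ using fun x => ih (ofLex x).2 (B x)
    (fun e g h1 h2 => hA e g h1 fun n => (h2 n).1) (by
      rintro e h ⟨heA, e', h', heq, h1, h2⟩ c hc
      obtain ⟨rfl, rfl⟩ := List.cons.inj heq
      rw [← h1]
      exact hκcol _ _ heA (h2.trans h1.symm) c hc)
  obtain ⟨ρ', hρ'⟩ := exists_ordinal_rank fun h : List E =>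
    (toLex (κ h, ρ (κ h) h) : (Ordinal.{u} ×ₗ Fin k) ×ₗ Ordinal.{u})
  refine ⟨fun h => τ (κ h) h, ρ', fun h => (hτ _ _).trans_le (Finset.le_sup (Finset.mem_univ _)), ?_⟩
  intro e g he hg
  have hg1 : ∀ n, κ (g (n + 1)) ≤ κ (e n :: g n) := fun n => by
    rcases Prod.Lex.toLex_le_toLex.1 (hρ' _ _ (hg n).2) with h | h
    · exact h.le
    · exact h.1.le
  obtain ⟨N, hN⟩ := eventually_const_of_antitone (f := fun n => κ (g n)) fun n => (hg1 n).trans (hκmono _ _ (he n))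
  -- `κ` cannot drop along an edge after time `N`, because the next history of the closure path
  -- would inherit the smaller value.
  have hN' : ∀ n, N ≤ n → κ (e n :: g n) = κ (g N) := fun n hn =>
    ((hκmono _ _ (he n)).trans_eq (hN n hn)).antisymm ((hN (n + 1) (by omega)).symm.trans_le (hg1 n))
  rw [← infColours_shift col e N]
  refine hρ (κ (g N)) (fun n => e (n + N)) (fun n => g (n + N)) (fun n =>
    ⟨he _, _, _, rfl, hN _ (by omega), hN' _ (by omega)⟩) fun n => ?_
  have h0 : n + 1 + N = n + N + 1 := by omega
  have h1 := (hg (n + N)).1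
  have h2 := hρ' _ _ (hg (n + N)).2
  dsimp only at h1
  rw [hN (n + N + 1) (by omega), hN' (n + N) (by omega)] at h1 h2
  rw [h0]
  refine ⟨h1, ?_⟩
  rcases Prod.Lex.toLex_le_toLex.1 h2 with h | h
  · exact absurd h (lt_irrefl _)
  · exact h.2

theorem ZTree.Alternates.exists_closure (hF : ∅ ∉ F) {T : ZTree Γ} (hT : T.Alternates F)
    (A : Set (List E)) (hA : PathsWin F col A)
    (hcol : ∀ e h, e :: h ∈ A → ∀ c, col e = some c → c ∈ T.rootLabel) :
    ∃ τ ρ, (∀ h, τ h < T.memory) ∧ ClosurePathsWin F col A τ ρ := by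
  induction T generalizing A with
  | node X b k ch ih =>
    rcases Nat.eq_zero_or_pos k with rfl | hk
    · obtain ⟨ρ, hρ⟩ := exists_closure_of_leaf hF
        (fun Y hY => by obtain ⟨i, -⟩ := (hT.2.2.1 Y).2 hY; exact i.elim0) hA hcol
      exact ⟨_, ρ, fun _ => by simp [memory], hρ⟩
    · have hY : ∀ Z, IsMaxAlternation F X Z → ∃ i, (ch i).rootLabel = Z := fun Z => (hT.2.2.1 Z).2
      have ih' := fun i B => ih i (hT.2.2.2 i) B
      by_cases hb : b = true
      · have := exists_closure_of_round hk (hT.1.1 hb) hY (fun i => (ch i).memory) ih' hA hcol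
        simpa [memory, hk.ne', hb] using this
      · have := exists_closure_of_square hF hk (fun h => hb (hT.1.2 h)) hY (fun i => (ch i).memory)
          ih' hA hcol
        simpa [memory, hk.ne', hb] using this

end Closure

/-! ### Plays, their colours, and the memory obtained from ranked histories -/

namespace Game

universe u

variable {Γ : Type u} {G : Game Γ}

theorem last_snoc (π : List G.Edge) (e : G.Edge) : G.last (π ++ [e]) = e.2.2 := by simp [last]

theorem pre_succ (π : ℕ → G.Edge) (i : ℕ) : G.pre π (i + 1) = G.pre π i ++ [π i] := by
  simp [pre, List.range_succ]

theorem last_pre_succ (π : ℕ → G.Edge) (i : ℕ) : G.last (G.pre π (i + 1)) = (π i).2.2 := by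
  rw [pre_succ, last_snoc]

theorem isPartialPlay_snoc_iff {π : List G.Edge} {e : G.Edge} :
    G.IsPartialPlay (π ++ [e]) ↔ G.IsPartialPlay π ∧ e ∈ G.E ∧ e.1 = G.last π := by
  constructor
  · generalize hx : π ++ [e] = x
    rintro (_ | ⟨π', e', h1, h2, h3⟩)
    · simp at hx
    · obtain ⟨rfl, h⟩ := List.append_inj' hx rfl
      obtain rfl := List.cons.inj h |>.1
      exact ⟨h1, h2, h3⟩
  · exact fun h => .snoc _ _ h.1 h.2.1 h.2.2

theorem isPlay_iff {π : ℕ → G.Edge} :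
    G.IsPlay π ↔ ∀ i, π i ∈ G.E ∧ (π i).1 = G.last (G.pre π i) := by
  constructor
  · intro h i
    have := h (i + 1)
    rw [pre_succ] at this
    exact (isPartialPlay_snoc_iff.1 this).2
  · intro h i
    induction i with
    | zero => exact .nil
    | succ i ih => rw [pre_succ]; exact .snoc _ _ ih (h i).1 (h i).2

theorem IsPlay.target_eq {π : ℕ → G.Edge} (h : G.IsPlay π) (i : ℕ) : (π i).2.2 = (π (i + 1)).1 := by
  rw [(isPlay_iff.1 h (i + 1)).2, last_pre_succ]

/-- On a tail without colours a position would be repeated, as there are only finitely many, and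
this is a forbidden cycle. -/
theorem IsPlay.frequently_ne_none {π : ℕ → G.Edge} (h : G.IsPlay π) :
    ∃ᶠ i in atTop, (π i).2.1 ≠ none := by
  intro hcon
  obtain ⟨N, hN⟩ := eventually_atTop.1 hcon
  have hstep : ∀ i, N ≤ i → ((π i).1, none, (π (i + 1)).1) ∈ G.E := fun i hi => by
    have h1 := (isPlay_iff.1 h i).1
    have h2 : (π i).2.1 = none := not_not.1 (hN i hi)
    rwa [← h.target_eq, ← h2]
  have hpath : ∀ i j, N ≤ i → i < j →
      Relation.TransGen (fun y z => (y, none, z) ∈ G.E) (π i).1 (π j).1 := by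
    intro i j hi hij
    induction j, hij using Nat.le_induction with
    | base => exact .single (hstep i hi)
    | succ j hj ih => exact ih.tail (hstep j (by omega))
  have := G.finite_V
  obtain ⟨i, j, hij, heq⟩ := Finite.exists_ne_map_eq_of_infinite fun i : ℕ => (π (N + i)).1
  rcases lt_or_gt_of_ne hij with hlt | hlt
  · have := hpath (N + i) (N + j) (by omega) (by omega)
    rw [heq] at this
    exact G.no_eps_cycle _ this
  · have := hpath (N + j) (N + i) (by omega) (by omega)
    rw [heq] at this
    exact G.no_eps_cycle _ this

theorem IsColouring.infOcc_eq {π : ℕ → G.Edge} {w : ℕ → Γ} (h : G.IsColouring π w) :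
    infOcc w = infColours (fun e : G.Edge => e.2.1) π := by
  obtain ⟨f, hf, hw, hsurj⟩ := h
  ext c
  constructor
  · intro hc
    exact hf.tendsto_atTop.frequently (Frequently.mono hc fun i hi => (hw i).trans (congrArg some hi))
  · intro hc
    refine frequently_atTop.2 fun N => ?_
    obtain ⟨n, hn, hcn⟩ := frequently_atTop.1 hc (f N)
    obtain ⟨i, rfl⟩ := hsurj n (by simp [hcn])
    refine ⟨i, hf.le_iff_le.1 hn, ?_⟩
    exact Option.some.inj ((hw i).symm.trans hcn)

theorem IsPlay.exists_isColouring {π : ℕ → G.Edge} (h : G.IsPlay π) : ∃ w, G.IsColouring π w := by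
  have hinf : {i | (π i).2.1 ≠ none}.Infinite :=
    Nat.frequently_atTop_iff_infinite.1 h.frequently_ne_none
  have hmem : ∀ i, (π (Nat.nth (fun i => (π i).2.1 ≠ none) i)).2.1 ≠ none :=
    Nat.nth_mem_of_infinite hinf
  choose w hw using fun i => Option.ne_none_iff_exists'.1 (hmem i)
  refine ⟨w, _, Nat.nth_strictMono hinf, hw, fun j hj => ?_⟩
  have : j ∈ Set.range (Nat.nth fun i => (π i).2.1 ≠ none) := by
    rw [Nat.range_nth_of_infinite hinf]
    exact hj
  exact this

/-- The Muller condition sees only the colours recurring along the play, so the re-indexing that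
omits the `ε` can be forgotten from here on. -/
theorem IsPlay.isWinningPlay_iff {F : Set (Set Γ)} {π : ℕ → G.Edge} (h : G.IsPlay π) :
    G.IsWinningPlay (mullerLanguage F) π ↔ infColours (fun e : G.Edge => e.2.1) π ∈ F := by
  constructor
  · rintro ⟨w, hw, hc⟩
    rw [← hc.infOcc_eq]
    exact hw
  · intro hF
    obtain ⟨w, hw⟩ := h.exists_isColouring
    exact ⟨w, by rwa [mullerLanguage, Set.mem_ofPred_eq, hw.infOcc_eq], hw⟩

/-! ### Histories consistent with a strategy -/

/-- Reversed partial plays consistent with the strategy `σ`. -/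
def ConsistentHistory (σ : List G.Edge → G.Edge) : List G.Edge → Prop
  | [] => True
  | e :: h => ConsistentHistory σ h ∧ e ∈ G.E ∧ e.1 = G.last h.reverse ∧
      (G.last h.reverse ∈ G.exist → e = σ h.reverse)

variable {σ : List G.Edge → G.Edge}

theorem ConsistentHistory.isPartialPlay {h : List G.Edge} (hh : ConsistentHistory σ h) :
    G.IsPartialPlay h.reverse := by
  induction h with
  | nil => exact .nil
  | cons e h ih =>
    rw [List.reverse_cons]
    exact .snoc _ _ (ih hh.1) hh.2.1 hh.2.2.1

theorem ConsistentHistory.of_suffix {h h' : List G.Edge} (hh : ConsistentHistory σ h)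
    (hs : h' <:+ h) : ConsistentHistory σ h' := by
  induction h with
  | nil => rwa [List.suffix_nil.1 hs]
  | cons e h ih =>
    rcases List.suffix_cons_iff.1 hs with rfl | hs
    · exact hh
    · exact ih hh.1 hs

theorem IsWinningStrategy.pathsWin {F : Set (Set Γ)} (hσ : G.IsWinningStrategy (mullerLanguage F) σ) :
    PathsWin F (fun e : G.Edge => e.2.1) {h | ConsistentHistory σ h} := by
  intro e g hg hgA
  set L := (g 0).length with hL
  -- The path may start in any history `g 0`. Prepending the latter gives a play from `x₀`, and a
  -- finite prefix does not change the recurring colours.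
  let π : ℕ → G.Edge := fun i => if h : i < (g 0).reverse.length then (g 0).reverse[i] else e (i - L)
  have hπ : ∀ n, π (L + n) = e n := fun n => by
    simp only [π, List.length_reverse]
    rw [dif_neg (by omega), Nat.add_sub_cancel_left]
  have hpre : ∀ n, G.pre π (L + n) = (g n).reverse := fun n => by
    induction n with
    | zero =>
      refine List.ext_getElem (by simp [pre, hL]) fun i h1 h2 => ?_
      simp only [pre, List.getElem_map, List.getElem_range, π]
      rw [dif_pos h2]
    | succ n ih => rw [← add_assoc, pre_succ, ih, hπ, hg, List.reverse_cons]
  have hcons : ∀ i, ConsistentHistory σ (G.pre π i).reverse := fun i => by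
    refine ConsistentHistory.of_suffix (hgA i) ?_
    rw [← List.reverse_reverse (g (i + 1)), List.reverse_suffix, ← hpre]
    exact (List.prefix_iff_eq_take.2 (by
      simp only [pre, List.length_map, List.length_range, ← List.map_take, List.take_range]
      rw [min_eq_left (by omega)]))
  have hcons' : ∀ i, π i ∈ G.E ∧ (π i).1 = G.last (G.pre π i) ∧
      (G.last (G.pre π i) ∈ G.exist → π i = σ (G.pre π i)) := fun i => by
    have := hcons (i + 1)
    rw [pre_succ, List.reverse_append, List.reverse_singleton, List.singleton_append] at this
    have := this.2
    rwa [List.reverse_reverse] at this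
  have hplay : G.IsPlay π := isPlay_iff.2 fun i => ⟨(hcons' i).1, (hcons' i).2.1⟩
  have hwin := hplay.isWinningPlay_iff.1 (hσ.2 π hplay fun i => (hcons' i).2.2)
  rw [← infColours_shift _ _ L] at hwin
  simpa only [add_comm _ L, hπ] using hwin

/-- The existential player needs no more memory than the Zielonka tree prescribes. -/
theorem exists_memory_of_wonByExist [Finite Γ] {F : Set (Set Γ)} (hF : ∅ ∉ F) {T : ZTree Γ}
    (hT : T.IsZielonkaTree F) (G : Game Γ) (hG : G.WonByExist (mullerLanguage F)) :
    ∃ μ : G.Memory, Nat.card μ.M ≤ T.memory ∧ G.IsWinningStrategy (mullerLanguage F) μ.strategy := by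
  classical
  obtain ⟨σ, hσ⟩ := hG
  obtain ⟨τ, ρ, hτ, hρ⟩ := hT.2.exists_closure hF _ hσ.pathsWin
    (fun _ _ _ c _ => by rw [hT.1]; exact Set.mem_univ c)
  let P : ℕ → G.V → List G.Edge → Prop := fun m x h =>
    ConsistentHistory σ h ∧ G.last h.reverse = x ∧ τ h = m
  -- A history of least rank among those with a given tag and last position. Where there is none,
  -- the value `[]` is never used in a play, by `hex` below.
  have hbest : ∀ m x, ∃ h, (∃ h', P m x h') → P m x h ∧ ∀ h', P m x h' → ρ h ≤ ρ h' := by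
    intro m x
    by_cases hex : ∃ h, P m x h
    · obtain ⟨h, hh, hmin⟩ := (InvImage.wf ρ wellFounded_lt).has_min {h | P m x h} hex
      exact ⟨h, fun _ => ⟨hh, fun h' hh' => not_lt.1 (hmin h' hh')⟩⟩
    · exact ⟨[], fun h => absurd h hex⟩
  choose best hbest using hbest
  choose d hdE hd using G.total
  let μ : G.Memory :=
    { M := Fin T.memory
      finite_M := inferInstance
      m₀ := ⟨τ [], hτ _⟩
      -- After the edge `e` the imitated history is `best m e.1` extended by `e`; only its tag is
      -- remembered.
      update := fun m e => ⟨τ (e :: best m e.1), hτ _⟩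
      next := fun m x => if ∃ h, P m x h then σ (best m x).reverse else d x
      next_mem := fun m x hx => by
        split_ifs with hex
        · obtain ⟨⟨h1, h2, -⟩, -⟩ := hbest _ _ hex
          have := hσ.1 _ h1.isPartialPlay (by rwa [h2])
          rwa [h2] at this
        · exact ⟨hdE x, hd x⟩ }
  refine ⟨μ, by simp [μ], fun π _ hx => μ.next_mem _ _ hx, fun π hπ hcons => ?_⟩
  rw [hπ.isWinningPlay_iff]
  let m : ℕ → Fin T.memory := fun n => (G.pre π n).foldl μ.update μ.m₀
  let g : ℕ → List G.Edge := fun n => best (m n) (G.last (G.pre π n))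
  have hm : ∀ n, m (n + 1) = μ.update (m n) (π n) := fun n => by
    simp only [m, pre_succ, List.foldl_append, List.foldl_cons, List.foldl_nil]
  have hplay := isPlay_iff.1 hπ
  have hm' : ∀ n, (m (n + 1) : ℕ) = τ (π n :: g n) := fun n => by
    rw [hm]
    simp only [μ, g, ← (hplay n).2]
  have hvalid : ∀ n, P (m n) (G.last (G.pre π n)) (g n) → ConsistentHistory σ (π n :: g n) := by
    intro n hn
    refine ⟨hn.1, (hplay n).1, (hplay n).2.trans hn.2.1.symm, fun hx => ?_⟩
    rw [hn.2.1] at hx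
    rw [hcons n hx]
    exact if_pos ⟨_, hn⟩
  have hex : ∀ n, ∃ h, P (m n) (G.last (G.pre π n)) h := by
    intro n
    induction n with
    | zero => exact ⟨[], trivial, rfl, rfl⟩
    | succ n ih =>
      refine ⟨π n :: g n, hvalid n (hbest _ _ ih).1, ?_, (hm' n).symm⟩
      rw [List.reverse_cons, last_snoc, last_pre_succ]
  -- The imitated histories form a closure path: the next one has the same tag as the extended
  -- previous one, and by minimality no larger rank.
  refine hρ π g (fun n => hvalid n (hbest _ _ (hex n)).1) fun n => ?_
  have h1 := hbest _ _ (hex (n + 1))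
  refine ⟨h1.1.2.2.trans (hm' n), h1.2 _ ⟨hvalid n (hbest _ _ (hex n)).1, ?_, (hm' n).symm⟩⟩
  rw [List.reverse_cons, last_snoc, last_pre_succ]

end Game

theorem List.nil_le_of_linearOrder {α : Type*} [LinearOrder α] (p : List α) : [] ≤ p := by
  cases p with
  | nil => exact le_rfl
  | cons i p => exact le_of_lt List.Lex.nil

theorem List.append_le_append_of_le {α : Type*} [LinearOrder α] (p : List α) {q r : List α}
    (h : q ≤ r) : p ++ q ≤ p ++ r := by
  induction p with
  | nil => exact h
  | cons a p ih => exact List.cons_le_cons a ih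

namespace ZTree

universe u

variable {Γ : Type u} {T : ZTree Γ}

/-! ### A labelling of the leaves -/

theorem memory_pos (T : ZTree Γ) : 0 < T.memory := by
  induction T with
  | node lab b k ch ih =>
    rcases Nat.eq_zero_or_pos k with rfl | hk
    · simp [memory]
    · simp only [memory, hk.ne', if_false]
      split_ifs
      · exact Finset.sum_pos (fun i _ => ih i) ⟨⟨0, hk⟩, Finset.mem_univ _⟩
      · exact (ih ⟨0, hk⟩).trans_le (Finset.le_sup (f := fun i => (ch i).memory) (Finset.mem_univ _))

/-- The least number of a leaf below the given address, if the children of the round nodes use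
disjoint intervals of numbers, from left to right. -/
def number : ZTree Γ → List ℕ → ℕ
  | _, [] => 0
  | node _ b k ch, i :: p =>
    (if b = true then offset (fun j => (ch j).memory) i else 0) +
      if h : i < k then number (ch ⟨i, h⟩) p else 0

theorem number_nil (T : ZTree Γ) : T.number [] = 0 := by simp [number]

theorem number_cons {lab : Set Γ} {b : Bool} {k : ℕ} {ch : Fin k → ZTree Γ} (i : Fin k)
    (p : List ℕ) : (node lab b k ch).number (i :: p) =
      (if b = true then offset (fun j => (ch j).memory) i else 0) + (ch i).number p := by
  simp [number]

theorem number_append {p : List ℕ} {t : ZTree Γ} (h : T.sub p = some t) (q : List ℕ) :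
    T.number (p ++ q) = T.number p + t.number q := by
  induction p generalizing T with
  | nil =>
    obtain rfl := Option.some.inj ((sub_nil _).symm.trans h)
    simp [number_nil]
  | cons i p ih =>
    obtain ⟨lab, b, k, ch⟩ := T
    obtain ⟨hi, h⟩ := exists_of_sub_cons h
    have h1 := number_cons (lab := lab) (b := b) (ch := ch) ⟨i, hi⟩ (p ++ q)
    have h2 := number_cons (lab := lab) (b := b) (ch := ch) ⟨i, hi⟩ p
    simp only [List.cons_append] at *
    rw [h1, h2, ih h, add_assoc]

/-- The numbers used below an address stay in an interval of the length of the subtree's memory: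
children of round nodes receive consecutive intervals, those of square nodes a common starting
point. -/
theorem number_add_memory_le {p : List ℕ} {t : ZTree Γ} (h : T.sub p = some t) :
    T.number p + t.memory ≤ T.memory := by
  induction p generalizing T with
  | nil =>
    obtain rfl := Option.some.inj ((sub_nil _).symm.trans h)
    simp [number_nil]
  | cons i p ih =>
    obtain ⟨lab, b, k, ch⟩ := T
    obtain ⟨hi, h⟩ := exists_of_sub_cons h
    have h1 := number_cons (lab := lab) (b := b) (ch := ch) ⟨i, hi⟩ p
    have h2 := ih h
    simp only at h1
    rw [h1]
    simp only [memory, (show k ≠ 0 by omega), if_false]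
    split_ifs
    · rw [← offset_eq_sum]
      have h3 := offset_succ (fun j => (ch j).memory) ⟨i, hi⟩
      have h4 := offset_mono (fun j => (ch j).memory) (show i + 1 ≤ k by omega)
      simp only at h3
      omega
    · have := Finset.le_sup (f := fun i => (ch i).memory) (Finset.mem_univ ⟨i, hi⟩)
      omega

theorem number_lt {p : List ℕ} (h : (T.sub p).isSome = true) : T.number p < T.memory := by
  obtain ⟨t, ht⟩ := Option.isSome_iff_exists.1 h
  have := number_add_memory_le ht
  have := t.memory_pos
  omega

/-- At a round node the children's intervals cover everything; at a square node a child of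
sufficiently large memory is chosen. In the lower bound this makes leaves at least as numerous as
states, and in the algorithm it allows whole intervals of source states. -/
theorem exists_number_eq (T : ZTree Γ) {x : ℕ} (hx : x < T.memory) :
    ∃ p t, T.sub p = some t ∧ t.rootArity = 0 ∧ T.number p = x := by
  induction T generalizing x with
  | node lab b k ch ih =>
    rcases Nat.eq_zero_or_pos k with rfl | hk
    · refine ⟨[], _, sub_nil _, rfl, ?_⟩
      simp only [memory, if_true] at hx
      rw [number_nil]
      omega
    · simp only [memory, hk.ne', if_false] at hx
      by_cases hb : b = true
      · rw [if_pos hb] at hx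
        obtain ⟨i, a, ha, rfl⟩ := exists_offset_add hx
        obtain ⟨p, t, h1, h2, rfl⟩ := ih i ha
        exact ⟨i :: p, t, by rw [sub_cons i.2, h1], h2, by rw [number_cons, if_pos hb]⟩
      · rw [if_neg hb] at hx
        obtain ⟨i, -, hi⟩ := Finset.lt_sup_iff.1 hx
        obtain ⟨p, t, h1, h2, rfl⟩ := ih i hi
        exact ⟨i :: p, t, by rw [sub_cons i.2, h1], h2, by rw [number_cons, if_neg hb, zero_add]⟩

/-- The number of a leaf. -/
def leafNumber (l : T.Leaf) : Fin T.memory := ⟨T.number l.1.1, number_lt l.1.2⟩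

theorem leafNumber_surjective : Function.Surjective (leafNumber : T.Leaf → Fin T.memory) := by
  rintro ⟨x, hx⟩
  obtain ⟨p, t, h1, h2, h3⟩ := T.exists_number_eq hx
  exact ⟨⟨⟨p, by simp [h1]⟩, (congrArg rootArity (Node.subtree_eq_of_sub h1)).trans h2⟩,
    Fin.ext h3⟩

theorem number_snoc_of_isRound {n : T.Node} (hn : n.IsRound) {i : ℕ} {lab : Set Γ} {b : Bool}
    {k : ℕ} {ch : Fin k → ZTree Γ} (ht : n.subtree = node lab b k ch) (hi : i < k) (p : List ℕ) :
    T.number (n.1 ++ i :: p) = T.number n.1 + (offset (fun j => (ch j).memory) i +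
      (ch ⟨i, hi⟩).number p) := by
  rw [number_append n.sub_eq, ht]
  have h1 := number_cons (lab := lab) (b := b) (ch := ch) ⟨i, hi⟩ p
  have hb : b = true := by rwa [Node.IsRound, ht] at hn
  rw [if_pos hb] at h1
  exact congrArg _ h1

theorem isStarLabelling_leafNumber : IsStarLabelling (leafNumber : T.Leaf → Fin T.memory) := by
  intro n hn i j hij l₁ l₂ ⟨p, hp⟩ ⟨q, hq⟩ heq
  have heq : T.number l₁.1.1 = T.number l₂.1.1 := congrArg Fin.val heq
  have h1 := l₁.1.2
  have h2 := l₂.1.2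
  rw [← hp, List.append_assoc, sub_append, n.sub_eq] at h1
  rw [← hq, List.append_assoc, sub_append, n.sub_eq] at h2
  rw [← hp, ← hq, List.append_assoc, List.append_assoc] at heq
  rcases ht : n.subtree with ⟨lab, b, k, ch⟩
  rw [ht] at h1 h2
  obtain ⟨t₁, ht₁⟩ := Option.isSome_iff_exists.1 h1
  obtain ⟨t₂, ht₂⟩ := Option.isSome_iff_exists.1 h2
  obtain ⟨hi, h1⟩ := exists_of_sub_cons (lab := lab) (b := b) (p := p) ht₁
  obtain ⟨hj, h2⟩ := exists_of_sub_cons (lab := lab) (b := b) (p := q) ht₂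
  rw [List.singleton_append, List.singleton_append, number_snoc_of_isRound hn ht hi,
    number_snoc_of_isRound hn ht hj, Nat.add_left_cancel_iff] at heq
  exact hij (Fin.ext_iff.1 (offset_add_inj (f := fun j => (ch j).memory) (i := ⟨i, hi⟩)
    (j := ⟨j, hj⟩) (number_lt (Option.isSome_iff_exists.2 ⟨_, h1⟩))
    (number_lt (Option.isSome_iff_exists.2 ⟨_, h2⟩)) heq).1)

theorem exists_first_leaf (T : ZTree Γ) : ∃ p t, T.sub p = some t ∧ t.rootArity = 0 ∧
    T.number p = 0 ∧ ∀ q t', T.sub q = some t' → t'.rootArity = 0 → p ≤ q := by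
  induction T with
  | node lab b k ch ih =>
    rcases Nat.eq_zero_or_pos k with rfl | hk
    · exact ⟨[], _, sub_nil _, rfl, number_nil _, fun q _ _ _ => List.nil_le_of_linearOrder q⟩
    · obtain ⟨p, t, h1, h2, h3, h4⟩ := ih ⟨0, hk⟩
      refine ⟨0 :: p, t, by rw [sub_cons hk, h1], h2, ?_, fun q t' hq ht' => ?_⟩
      · have := number_cons (lab := lab) (b := b) (ch := ch) ⟨0, hk⟩ p
        simp only at this
        rw [this, h3, offset_zero, ite_self]
      · cases q with
        | nil =>
          obtain rfl := Option.some.inj ((sub_nil _).symm.trans hq)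
          exact absurd ht' hk.ne'
        | cons i q =>
          obtain ⟨hi, hq⟩ := exists_of_sub_cons hq
          rcases Nat.eq_zero_or_pos i with rfl | hi'
          · exact List.cons_le_cons 0 (h4 q t' hq ht')
          · exact le_of_lt (List.Lex.rel hi')

/-- The leftmost leaf is reached through children number `0`, whose offset is `0` at every level. -/
theorem number_of_isLeftmost {n : T.Node} {l : T.Leaf}
    (h : IsLeftmost {l : T.Leaf | n.IsAncestor l.1} l) : T.number l.1.1 = T.number n.1 := by
  obtain ⟨p, t, h1, h2, h3, h4⟩ := n.subtree.exists_first_leaf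
  have hsub : T.sub (n.1 ++ p) = some t := by rw [sub_append, n.sub_eq, Option.bind_some, h1]
  let l₀ : T.Leaf := ⟨⟨n.1 ++ p, by rw [hsub]; rfl⟩,
    (congrArg rootArity (Node.subtree_eq_of_sub hsub)).trans h2⟩
  have hl₀ : IsLeftmost {l : T.Leaf | n.IsAncestor l.1} l₀ := by
    refine ⟨List.prefix_append _ _, fun l' ⟨q, hq⟩ => ?_⟩
    rw [← hq]
    refine List.append_le_append_of_le n.1 (h4 q l'.1.subtree ?_ l'.2)
    have := l'.1.sub_eq
    rw [← hq, sub_append, n.sub_eq] at this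
    exact this
  rw [h.unique hl₀]
  change T.number (n.1 ++ p) = _
  rw [number_append n.sub_eq, h3, add_zero]

theorem isNormalized_leafNumber : IsNormalized (leafNumber : T.Leaf → Fin T.memory) := by
  intro l hl
  let root : T.Node := ⟨[], by rw [sub_nil]; rfl⟩
  have h : IsLeftmost {l : T.Leaf | root.IsAncestor l.1} l :=
    ⟨List.nil_prefix, fun l' _ => hl.2 l' trivial⟩
  exact (number_of_isLeftmost h).trans (number_nil T)

end ZTree

theorem List.exists_branching {p q : List ℕ} (h₁ : ¬ p <+: q) (h₂ : ¬ q <+: p) :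
    ∃ r i j, i ≠ j ∧ r ++ [i] <+: p ∧ r ++ [j] <+: q := by
  induction p generalizing q with
  | nil => exact absurd List.nil_prefix h₁
  | cons a p ih =>
    cases q with
    | nil => exact absurd List.nil_prefix h₂
    | cons b q =>
      by_cases hab : a = b
      · subst hab
        obtain ⟨r, i, j, hij, h3, h4⟩ := ih (fun h => h₁ ((List.prefix_cons_inj a).2 h))
          (fun h => h₂ ((List.prefix_cons_inj a).2 h))
        exact ⟨a :: r, i, j, hij, (List.prefix_cons_inj a).2 h3, (List.prefix_cons_inj a).2 h4⟩
      · exact ⟨[], a, b, hab, by simp, by simp⟩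

namespace ZTree

universe u

variable {Γ : Type u} {T : ZTree Γ} {F : Set (Set Γ)}

/-! ### Pruned Zielonka trees -/

/-- The nodes look like those of a Zielonka tree, but square nodes have lost all but at most one of
their children. -/
def IsPruned (F : Set (Set Γ)) : ZTree Γ → Prop
  | node lab b k ch =>
    lab.Nonempty ∧ (b = true ↔ lab ∈ F) ∧ (∀ i, (ch i).rootLabel ⊆ lab) ∧
    (∀ i, (ch i).rootRound = !b) ∧
    (b = true → ∀ Z : Set Γ, Z.Nonempty → Z ⊆ lab → (∀ i, ¬ Z ⊆ (ch i).rootLabel) → Z ∈ F) ∧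
    (b = true → ∀ i j, i ≠ j → ¬ (ch i).rootLabel ⊆ (ch j).rootLabel) ∧
    (b = false → k ≤ 1) ∧ ∀ i, IsPruned F (ch i)

theorem IsPruned.sub {t : ZTree Γ} {p : List ℕ} (hT : T.IsPruned F) (h : T.sub p = some t) :
    t.IsPruned F := by
  induction p generalizing T with
  | nil =>
    obtain rfl := Option.some.inj ((sub_nil _).symm.trans h)
    exact hT
  | cons i p ih =>
    obtain ⟨lab, b, k, ch⟩ := T
    obtain ⟨hi, h⟩ := exists_of_sub_cons h
    exact ih (hT.2.2.2.2.2.2.2 _) h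

/-- A node, unfolded. -/
theorem Node.exists_eq_node (n : T.Node) : ∃ lab b k, ∃ ch : Fin k → ZTree Γ,
    n.subtree = node lab b k ch ∧ n.label = lab ∧ (n.IsRound ↔ b = true) ∧ n.arity = k ∧
      ∀ i (h : i < n.arity) (h' : i < k), (n.child i h).subtree = ch ⟨i, h'⟩ := by
  rcases ht : n.subtree with ⟨lab, b, k, ch⟩
  refine ⟨lab, b, k, ch, rfl, by rw [Node.label, ht, rootLabel], by rw [Node.IsRound, ht, rootRound],
    by rw [Node.arity, ht, rootArity], fun i h h' => ?_⟩
  have := n.sub_child h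
  rw [ht, sub_cons h'] at this
  exact (Option.some.inj ((sub_nil _).symm.trans this)).symm

theorem IsPruned.label_nonempty (hT : T.IsPruned F) (n : T.Node) : n.label.Nonempty := by
  obtain ⟨lab, b, k, ch, ht, rfl, -⟩ := n.exists_eq_node
  exact (ht ▸ hT.sub n.sub_eq : IsPruned F (node _ b k ch)).1

theorem IsPruned.isRound_iff (hT : T.IsPruned F) (n : T.Node) : n.IsRound ↔ n.label ∈ F := by
  obtain ⟨lab, b, k, ch, ht, rfl, hb, -⟩ := n.exists_eq_node
  exact hb.trans (ht ▸ hT.sub n.sub_eq : IsPruned F (node _ b k ch)).2.1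

theorem IsPruned.isDecreasing (hT : T.IsPruned F) : T.IsDecreasing := by
  intro n i h
  obtain ⟨lab, b, k, ch, ht, rfl, hb, rfl, hc⟩ := n.exists_eq_node
  have := (ht ▸ hT.sub n.sub_eq : IsPruned F (node _ b _ ch)).2.2.1 ⟨i, h⟩
  rwa [← hc i h h] at this

theorem IsPruned.isRound_child (hT : T.IsPruned F) (n : T.Node) {i : ℕ} (h : i < n.arity) :
    (n.child i h).IsRound ↔ ¬ n.IsRound := by
  obtain ⟨lab, b, k, ch, ht, rfl, hb, rfl, hc⟩ := n.exists_eq_node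
  have := (ht ▸ hT.sub n.sub_eq : IsPruned F (node _ b _ ch)).2.2.2.1 ⟨i, h⟩
  rw [← hc i h h] at this
  rw [hb, Node.IsRound, this]
  simp

theorem IsPruned.mem_of_isRound (hT : T.IsPruned F) {n : T.Node} (hn : n.IsRound) {Z : Set Γ}
    (hZ : Z.Nonempty) (hZn : Z ⊆ n.label) (h : ∀ i (h : i < n.arity), ¬ Z ⊆ (n.child i h).label) :
    Z ∈ F := by
  obtain ⟨lab, b, k, ch, ht, rfl, hb, rfl, hc⟩ := n.exists_eq_node
  refine (ht ▸ hT.sub n.sub_eq : IsPruned F (node _ b _ ch)).2.2.2.2.1 (hb.1 hn) Z hZ hZn fun i => ?_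
  rw [← hc i i.2 i.2]
  exact h i i.2

theorem IsPruned.not_subset (hT : T.IsPruned F) {n : T.Node} (hn : n.IsRound) {i j : ℕ}
    (hi : i < n.arity) (hj : j < n.arity) (hij : i ≠ j) :
    ¬ (n.child i hi).label ⊆ (n.child j hj).label := by
  obtain ⟨lab, b, k, ch, ht, rfl, hb, rfl, hc⟩ := n.exists_eq_node
  have := (ht ▸ hT.sub n.sub_eq : IsPruned F (node _ b _ ch)).2.2.2.2.2.1 (hb.1 hn) ⟨i, hi⟩ ⟨j, hj⟩
    (fun h => hij (Fin.ext_iff.1 h))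
  rwa [← hc i hi hi, ← hc j hj hj] at this

theorem IsPruned.arity_le (hT : T.IsPruned F) {n : T.Node} (hn : ¬ n.IsRound) : n.arity ≤ 1 := by
  obtain ⟨lab, b, k, ch, ht, rfl, hb, rfl, hc⟩ := n.exists_eq_node
  exact (ht ▸ hT.sub n.sub_eq : IsPruned F (node _ b _ ch)).2.2.2.2.2.2.1 (by simpa [hb] using hn)

theorem Alternates.rootRound_iff (hT : T.Alternates F) : T.rootRound = true ↔ T.rootLabel ∈ F := by
  obtain ⟨lab, b, k, ch⟩ := T
  exact hT.1

/-- A square node keeps one child of maximal memory, which leaves the maximum unchanged. Round nodes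
keep all their children with their labels, and hence also the maximality and incomparability of
these labels. -/
theorem Alternates.exists_isPruned [Finite Γ] (hT : T.Alternates F) (hne : T.rootLabel.Nonempty) :
    ∃ T' : ZTree Γ, T'.IsPruned F ∧ T'.rootLabel = T.rootLabel ∧ T'.rootRound = T.rootRound ∧
      T'.memory = T.memory := by
  induction T with
  | node lab b k ch ih =>
    have hmax : ∀ i, IsMaxAlternation F lab (ch i).rootLabel := fun i => (hT.2.2.1 _).1 ⟨i, rfl⟩
    choose t ht1 ht2 ht3 ht4 using fun i => ih i (hT.2.2.2 i) (hmax i).1.1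
    have hround : ∀ i, (ch i).rootRound = !b := fun i => by
      have h1 := (hT.2.2.2 i).rootRound_iff
      rw [(hmax i).1.2.2, ← hT.1] at h1
      cases b <;> simpa using h1
    rcases Nat.eq_zero_or_pos k with rfl | hk
    · refine ⟨node lab b 0 ch, ⟨hne, hT.1, fun i => i.elim0, fun i => i.elim0, fun hb Z hZ hZX _ => ?_,
        fun _ i => i.elim0, fun _ => zero_le_one, fun i => i.elim0⟩, rfl, rfl, rfl⟩
      by_contra hZF
      obtain ⟨Y, hY, -⟩ := exists_isMaxAlternation hZ hZX (F := F) (by have := hT.1; tauto)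
      obtain ⟨i, -⟩ := (hT.2.2.1 Y).2 hY
      exact i.elim0
    · cases b with
      | true =>
        refine ⟨node lab true k t, ⟨hne, hT.1, fun i => ?_, fun i => ?_, fun hb Z hZ hZX hno => ?_,
          fun _ i j hij hsub => ?_, fun h => by simp at h, ht1⟩, rfl, rfl, ?_⟩
        · rw [ht2]
          exact (hmax i).1.2.1
        · rw [ht3, hround]
        · by_contra hZF
          obtain ⟨Y, hY, hZY⟩ := exists_isMaxAlternation hZ hZX (F := F) (by have := hT.1; tauto)
          obtain ⟨i, rfl⟩ := (hT.2.2.1 Y).2 hY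
          exact hno i (by rwa [ht2])
        · rw [ht2, ht2] at hsub
          exact hij (hT.2.1 ((hmax i).eq_of_subset (hmax j).1 hsub))
        · simp [memory, ht4]
      | false =>
        obtain ⟨i, -, hi⟩ := Finset.exists_max_image Finset.univ (fun i => (ch i).memory)
          ⟨⟨0, hk⟩, Finset.mem_univ _⟩
        refine ⟨node lab false 1 fun _ => t i, ⟨hne, hT.1, fun _ => ?_, fun _ => ?_,
          fun h => by simp at h, fun h => by simp at h, fun _ => le_rfl, fun _ => ht1 i⟩, rfl, rfl, ?_⟩
        · rw [ht2]
          exact (hmax i).1.2.1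
        · rw [ht3, hround]
        · simp only [memory, hk.ne', one_ne_zero, if_false, ht4, Bool.false_eq_true]
          rw [Finset.sup_const ⟨0, Finset.mem_univ _⟩]
          exact (Finset.le_sup (f := fun i => (ch i).memory) (Finset.mem_univ i)).antisymm
            (Finset.sup_le fun j hj => hi j hj)

/-! ### A game that requires much memory -/

/-- The universal player may answer the leaf `l` by the set of letters `S`. -/
def IsAnswer (l : T.Leaf) (S : Set Γ) : Prop :=
  S.Nonempty ∧ ∃ n : T.Node, n.IsRound ∧ IsLastAncestorOfSet n l S

/-- The label of the leaf itself if it is round, and that of its parent otherwise; the parent exists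
because the root is round. This makes every position of the game have a successor. -/
theorem IsPruned.exists_isAnswer (hT : T.IsPruned F) (hr : T.rootRound = true) (l : T.Leaf) :
    ∃ n : T.Node, IsAnswer l n.label := by
  by_cases hl : l.1.IsRound
  · exact ⟨l.1, hT.label_nonempty _, l.1, hl, List.prefix_rfl, le_rfl, fun i h => by
      rw [l.2] at h; omega⟩
  · rcases List.eq_nil_or_concat l.1.1 with h | ⟨p, i, h⟩
    · refine absurd ?_ hl
      have := l.1.sub_eq
      rw [h, sub_nil] at this
      rwa [Node.IsRound, ← Option.some.inj this]
    · have hsome := l.1.2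
      rw [List.concat_eq_append] at h
      rw [h] at hsome
      let n : T.Node := ⟨p, isSome_sub_of_prefix (List.prefix_append _ _) hsome⟩
      have hi : i < n.arity := (n.isSome_sub_snoc i).1 hsome
      have hc : n.child i hi = l.1 := Node.ext h.symm
      have hbelow : l.BelowChild n i := by rw [Leaf.BelowChild, h]
      have hn : n.IsRound := by
        have := hT.isRound_child n hi
        rw [hc] at this
        tauto
      refine ⟨n, hT.label_nonempty _, n, hn, hbelow.isAncestor, le_rfl, fun j hj hlj hsub => ?_⟩
      obtain rfl := hbelow.unique hlj
      have := hsub.antisymm (hT.isDecreasing n i hj)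
      rw [hc] at this
      rw [hT.isRound_iff] at hn hl
      exact hl (this ▸ hn)

/-- For any other leaf, the universal player has an answer that is the label of a square ancestor of
the given leaf. -/
theorem IsPruned.exists_answer_of_ne (hT : T.IsPruned F) {l l₀ : T.Leaf} (h : l ≠ l₀) :
    ∃ d : T.Node, d.IsAncestor l₀.1 ∧ ¬ d.IsRound ∧ IsAnswer l d.label := by
  obtain ⟨r, i, j, hij, h1, h2⟩ := List.exists_branching
    (fun h' => h (Subtype.ext (Leaf.eq_of_isAncestor (l := l) (n := l₀.1) h').symm))
    (fun h' => h (Subtype.ext (Leaf.eq_of_isAncestor (l := l₀) (n := l.1) h')))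
  let n : T.Node := ⟨r, isSome_sub_of_prefix ((List.prefix_append _ _).trans h1) l.1.2⟩
  have h1 : l.BelowChild n i := h1
  have h2 : l₀.BelowChild n j := h2
  have hi := Leaf.lt_arity h1
  have hj := Leaf.lt_arity h2
  -- The branches to `l` and `l₀` part at `n`, and a pruned square node has at most one child. The
  -- answer is the label of the child of `n` towards `l₀`: it is square, and its label is not
  -- contained in that of the sibling towards `l`.
  have hn : n.IsRound := by
    by_contra hn
    have := hT.arity_le hn
    omega
  refine ⟨n.child j hj, h2, fun h => (hT.isRound_child n hj).1 h hn, hT.label_nonempty _, n, hn,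
    h1.isAncestor, hT.isDecreasing n j hj, fun i' hi' hl => ?_⟩
  obtain rfl := h1.unique hl
  exact hT.not_subset hn hj hi hij.symm

variable {N : ℕ} (e : Γ ≃ Fin N)

/-- The set of the letters numbered by the elements of `S`. -/
def lettersOf (S : Finset (Fin N)) : Set Γ := {c | e c ∈ S}

theorem exists_lettersOf_eq (X : Set Γ) : ∃ S, lettersOf e S = X := by
  classical
  exact ⟨Finset.univ.filter fun i => e.symm i ∈ X, by ext c; simp [lettersOf]⟩

variable (T) in
/-- The existential player chooses a leaf, the universal player answers by a set of letters, and then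
all of these letters are produced. -/
inductive AnswerEdge : Finset (Fin N) ⊕ T.Leaf → Option Γ → Finset (Fin N) ⊕ T.Leaf → Prop
  | choose (l : T.Leaf) : AnswerEdge (.inl ∅) none (.inr l)
  | answer (l : T.Leaf) (S : Finset (Fin N)) (h : IsAnswer l (lettersOf e S)) :
      AnswerEdge (.inr l) none (.inl S)
  | emit (S : Finset (Fin N)) (a : Fin N) (ha : a ∈ S) :
      AnswerEdge (.inl S) (some (e.symm a)) (.inl (S.erase a))

theorem IsAnswer.ne_empty {l : T.Leaf} {S : Finset (Fin N)} (h : IsAnswer l (lettersOf e S)) :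
    S ≠ ∅ := by
  rintro rfl
  obtain ⟨c, hc⟩ := h.1
  exact absurd hc (Finset.notMem_empty _)

/-- The game given by `AnswerEdge`. -/
def answerGame (hT : T.IsPruned F) (hr : T.rootRound = true) : Game Γ where
  V := Finset (Fin N) ⊕ T.Leaf
  finite_V := inferInstance
  exist := {.inl ∅}
  E := {t | AnswerEdge T e t.1 t.2.1 t.2.2}
  x₀ := .inl ∅
  total x := by
    rcases x with S | l
    · rcases S.eq_empty_or_nonempty with rfl | ⟨a, ha⟩
      · obtain ⟨l, -⟩ := T.exists_leftmost
        exact ⟨(.inl ∅, none, .inr l), .choose l, rfl⟩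
      · exact ⟨(.inl S, some (e.symm a), .inl (S.erase a)), .emit S a ha, rfl⟩
    · obtain ⟨n, hn⟩ := hT.exists_isAnswer hr l
      obtain ⟨S, hS⟩ := exists_lettersOf_eq e n.label
      exact ⟨(.inr l, none, .inl S), .answer l S (hS ▸ hn), rfl⟩
  no_eps_cycle x hx := by
    -- Uncoloured edges go from the empty set to a leaf and from a leaf to a non-empty set, so `f`
    -- decreases along them.
    let f : Finset (Fin N) ⊕ T.Leaf → ℕ := Sum.elim (fun S => if S = ∅ then 2 else 0) fun _ => 1
    have hstep : ∀ y z, AnswerEdge T e y none z → f z < f y := by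
      intro y z h
      generalize hc : (none : Option Γ) = c at h
      cases h with
      | choose l => simp [f]
      | answer l S h => simp [f, h.ne_empty]
      | emit => simp at hc
    have : ∀ y z, Relation.TransGen (fun y z => AnswerEdge T e y none z) y z → f z < f y := by
      intro y z h
      induction h with
      | single h => exact hstep _ _ h
      | tail _ h ih => exact (hstep _ _ h).trans ih
    exact lt_irrefl _ (this x x hx)

end ZTree

/-- Every memory for the existential player can be played against a positional strategy of the
universal player. -/
theorem Game.Memory.exists_play {Γ : Type*} {G : Game Γ} (μ : G.Memory) (τ : G.V → G.Edge)
    (hτ : ∀ x, τ x ∈ G.E ∧ (τ x).1 = x) :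
    ∃ π, G.IsPlay π ∧ G.Consistent μ.strategy π ∧ ∀ t, (π t).1 ∉ G.exist → π t = τ (π t).1 := by
  classical
  let edge : G.V × μ.M → G.Edge := fun s => if s.1 ∈ G.exist then μ.next s.2 s.1 else τ s.1
  have hedge : ∀ s, edge s ∈ G.E ∧ (edge s).1 = s.1 := fun s => by
    simp only [edge]
    split_ifs with h
    · exact μ.next_mem _ _ h
    · exact hτ _
  let st : ℕ → G.V × μ.M := fun t =>
    Nat.rec (G.x₀, μ.m₀) (fun _ s => ((edge s).2.2, μ.update s.2 (edge s))) t
  have hst : ∀ t, st (t + 1) = ((edge (st t)).2.2, μ.update (st t).2 (edge (st t))) := fun _ => rfl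
  let π : ℕ → G.Edge := fun t => edge (st t)
  have hlast : ∀ t, G.last (G.pre π t) = (st t).1 := fun t => by
    cases t with
    | zero => rfl
    | succ t => rw [last_pre_succ, hst]
  have hmem : ∀ t, (G.pre π t).foldl μ.update μ.m₀ = (st t).2 := fun t => by
    induction t with
    | zero => rfl
    | succ t ih => rw [pre_succ, List.foldl_append, ih, hst]; rfl
  refine ⟨π, isPlay_iff.2 fun t => ⟨(hedge _).1, by rw [hlast]; exact (hedge _).2⟩, fun t ht => ?_,
    fun t ht => ?_⟩
  · rw [Memory.strategy, hmem, hlast]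
    rw [hlast] at ht
    exact if_pos ht
  · have h : (π t).1 = (st t).1 := (hedge _).2
    rw [h] at ht ⊢
    exact if_neg ht

/-! ### Strategies of both players in the answer game -/

namespace ZTree

universe u

variable {Γ : Type u} {T : ZTree Γ} {F : Set (Set Γ)} {N : ℕ} {e : Γ ≃ Fin N}
  {hT : T.IsPruned F} {hr : T.rootRound = true}

/-- The set of letters chosen along an edge. -/
def answerOf : (Finset (Fin N) ⊕ T.Leaf) × Option Γ × (Finset (Fin N) ⊕ T.Leaf) → Finset (Fin N)
  | (.inr _, _, .inl S) => S
  | _ => ∅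

section Play

variable {π : ℕ → (answerGame e hT hr).Edge}

theorem answerGame_cases (hπ : (answerGame e hT hr).IsPlay π) (t : ℕ) :
    (∃ l, π t = (.inl ∅, none, .inr l) ∧ (π (t + 1)).1 = .inr l) ∨
    (∃ l S, IsAnswer l (lettersOf e S) ∧ π t = (.inr l, none, .inl S) ∧ (π (t + 1)).1 = .inl S) ∨
    ∃ S, ∃ a ∈ S, π t = (.inl S, some (e.symm a), .inl (S.erase a)) ∧
      (π (t + 1)).1 = .inl (S.erase a) := by
  have h1 := hπ.target_eq t
  have h2 : AnswerEdge T e (π t).1 (π t).2.1 (π t).2.2 := (Game.isPlay_iff.1 hπ t).1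
  rw [← h1]
  generalize π t = p at h2
  obtain ⟨x, c, y⟩ := p
  cases h2 with
  | choose l => exact Or.inl ⟨l, rfl, rfl⟩
  | answer l S h => exact Or.inr (Or.inl ⟨l, S, h, rfl, rfl⟩)
  | emit S a ha => exact Or.inr (Or.inr ⟨S, a, ha, rfl, rfl⟩)

theorem answerGame_start (hπ : (answerGame e hT hr).IsPlay π) : (π 0).1 = .inl ∅ :=
  (Game.isPlay_iff.1 hπ 0).2

theorem exists_choice (hπ : (answerGame e hT hr).IsPlay π) (t : ℕ) : ∃ t', t ≤ t' ∧ (π t').1 = .inl ∅ := by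
  have key : ∀ n t (S : Finset (Fin N)), S.card = n → (π t).1 = .inl S →
      ∃ t', t ≤ t' ∧ (π t').1 = .inl ∅ := by
    intro n
    induction n with
    | zero =>
      intro t S hS ht
      exact ⟨t, le_rfl, by rw [ht, Finset.card_eq_zero.1 hS]⟩
    | succ n ih =>
      intro t S hS ht
      rcases answerGame_cases hπ t with ⟨l, h, -⟩ | ⟨l, S', -, h, -⟩ | ⟨S', a, ha, h, h'⟩
      · exact ⟨t, le_rfl, by rw [h]⟩
      · rw [h] at ht
        simp at ht
      · rw [h] at ht
        obtain rfl := Sum.inl.inj ht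
        obtain ⟨t', h1, h2⟩ := ih (t + 1) _ (by rw [Finset.card_erase_of_mem ha, hS]; rfl) h'
        exact ⟨t', by omega, h2⟩
  rcases answerGame_cases hπ t with ⟨l, h, -⟩ | ⟨l, S, -, h, h'⟩ | ⟨S, a, ha, h, -⟩
  · exact ⟨t, le_rfl, by rw [h]⟩
  · obtain ⟨t', h1, h2⟩ := key _ (t + 1) S rfl h'
    exact ⟨t', by omega, h2⟩
  · exact key _ t S rfl (by rw [h])

theorem frequently_answer (hπ : (answerGame e hT hr).IsPlay π) :
    ∃ᶠ t in atTop, ∃ l : T.Leaf, (π t).1 = .inr l := by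
  refine frequently_atTop.2 fun t => ?_
  obtain ⟨t', h1, h2⟩ := exists_choice hπ t
  rcases answerGame_cases hπ t' with ⟨l, -, h⟩ | ⟨l, S, -, h, -⟩ | ⟨S, a, ha, h, -⟩
  · exact ⟨t' + 1, by omega, l, h⟩
  · rw [h] at h2
    simp at h2
  · rw [h] at h2
    obtain rfl := Sum.inl.inj h2
    exact absurd ha (Finset.notMem_empty _)

theorem exists_emission (hπ : (answerGame e hT hr).IsPlay π) {c : Γ} :
    ∀ n t (S : Finset (Fin N)), S.card = n → (π t).1 = .inl S → e c ∈ S →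
      ∃ t', t ≤ t' ∧ (π t').2.1 = some c := by
  intro n
  induction n with
  | zero =>
    intro t S hS ht hc
    rw [Finset.card_eq_zero.1 hS] at hc
    exact absurd hc (Finset.notMem_empty _)
  | succ n ih =>
    intro t S hS ht hc
    rcases answerGame_cases hπ t with ⟨l, h, -⟩ | ⟨l, S', -, h, -⟩ | ⟨S', a, ha, h, h'⟩
    · rw [h] at ht
      obtain rfl := Sum.inl.inj ht
      exact absurd hc (Finset.notMem_empty _)
    · rw [h] at ht
      simp at ht
    · rw [h] at ht
      obtain rfl := Sum.inl.inj ht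
      by_cases hac : e c = a
      · exact ⟨t, le_rfl, by rw [h, ← hac, Equiv.symm_apply_apply]⟩
      · obtain ⟨t', h1, h2⟩ := ih (t + 1) _ (by rw [Finset.card_erase_of_mem ha, hS]; rfl) h'
          (Finset.mem_erase.2 ⟨hac, hc⟩)
        exact ⟨t', by omega, h2⟩

/-- The colours of a play are the letters of the answers. -/
theorem infColours_answerGame (hπ : (answerGame e hT hr).IsPlay π) :
    infColours (fun p : (answerGame e hT hr).Edge => p.2.1) π =
      {c | ∃ᶠ t in atTop, c ∈ lettersOf e (answerOf (π t))} := by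
  ext c
  constructor
  · intro hc
    by_contra hcon
    have hcon : ¬ ∃ᶠ t in atTop, c ∈ lettersOf e (answerOf (π t)) := hcon
    rw [not_frequently] at hcon
    obtain ⟨M, hM⟩ := eventually_atTop.1 hcon
    obtain ⟨t₀, ht₀, hstart⟩ := exists_choice hπ M
    -- A letter that no answer contains any more, and that is not pending at `t₀`, is never pending
    -- again.
    have hinv : ∀ t, t₀ ≤ t → ∀ S, (π t).1 = .inl S → e c ∉ S := by
      intro t ht
      induction t, ht using Nat.le_induction with
      | base =>
        intro S hS
        rw [hstart] at hS
        obtain rfl := Sum.inl.inj hS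
        exact Finset.notMem_empty _
      | succ t ht ih =>
        intro S hS
        rcases answerGame_cases hπ t with ⟨l, -, h'⟩ | ⟨l, S', -, h, h'⟩ | ⟨S', a, -, h, h'⟩
        · rw [h'] at hS
          simp at hS
        · rw [h'] at hS
          obtain rfl := Sum.inl.inj hS
          have := hM t (by omega)
          rw [h] at this
          exact this
        · rw [h'] at hS
          obtain rfl := Sum.inl.inj hS
          exact fun h'' => ih S' (by rw [h]) (Finset.mem_of_mem_erase h'')
    obtain ⟨t, ht, hct⟩ := frequently_atTop.1 hc t₀
    have hct : (π t).2.1 = some c := hct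
    rcases answerGame_cases hπ t with ⟨l, h, -⟩ | ⟨l, S', -, h, -⟩ | ⟨S', a, ha, h, -⟩
    · rw [h] at hct
      simp at hct
    · rw [h] at hct
      simp at hct
    · rw [h] at hct
      obtain rfl := Option.some.inj hct
      refine hinv t ht S' (by rw [h]) ?_
      rwa [Equiv.apply_symm_apply]
  · intro hc
    refine frequently_atTop.2 fun M => ?_
    obtain ⟨t, ht, hct⟩ := frequently_atTop.1 hc M
    have hct : e c ∈ answerOf (π t) := hct
    rcases answerGame_cases hπ t with ⟨l, h, -⟩ | ⟨l, S', -, h, h'⟩ | ⟨S', a, ha, h, -⟩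
    · rw [h] at hct
      exact absurd hct (Finset.notMem_empty _)
    · rw [h] at hct
      obtain ⟨t', h1, h2⟩ := exists_emission hπ _ (t + 1) S' rfl h' hct
      exact ⟨t', by omega, h2⟩
    · rw [h] at hct
      exact absurd hct (Finset.notMem_empty _)

end Play

/-- The existential player wins by jumping to the next child of the node at which the last answer
was given. -/
theorem wonByExist_answerGame [Finite Γ] : (answerGame e hT hr).WonByExist (mullerLanguage F) := by
  classical
  have hnx : ∀ (l : T.Leaf) (S : Finset (Fin N)), ∃ (n : T.Node) (l' : T.Leaf),
      IsAnswer l (lettersOf e S) → n.IsRound ∧ IsLastAncestorOfSet n l (lettersOf e S) ∧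
        l' ∈ jump n l := by
    intro l S
    by_cases h : IsAnswer l (lettersOf e S)
    · obtain ⟨-, n, h1, h2⟩ := h
      obtain ⟨l', hl'⟩ := jump_nonempty h2.1
      exact ⟨n, l', fun _ => ⟨h1, h2, hl'⟩⟩
    · exact ⟨l.1, l, fun h' => absurd h' h⟩
  choose nd nx hnx using hnx
  obtain ⟨l₀, -⟩ := T.exists_leftmost
  let up : T.Leaf → (answerGame e hT hr).Edge → T.Leaf := fun m p =>
    match p with
    | (.inr l, _, .inl S) => nx l S
    | _ => m
  let μ : (answerGame e hT hr).Memory :=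
    { M := T.Leaf
      finite_M := inferInstance
      m₀ := l₀
      update := up
      next := fun m _ => (.inl ∅, none, .inr m)
      next_mem := fun m x hx => ⟨AnswerEdge.choose m, Eq.symm hx⟩ }
  refine ⟨μ.strategy, fun π _ hx => μ.next_mem _ _ hx, fun π hπ hcons => ?_⟩
  rw [hπ.isWinningPlay_iff, infColours_answerGame hπ]
  let m : ℕ → T.Leaf := fun t => ((answerGame e hT hr).pre π t).foldl μ.update μ.m₀
  have hm : ∀ t, m (t + 1) = up (m t) (π t) := fun t => by
    simp only [m, Game.pre_succ, List.foldl_append, List.foldl_cons, List.foldl_nil]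
    rfl
  have hchoice : ∀ t, (π t).1 = .inl ∅ → π t = (.inl ∅, none, .inr (m t)) := fun t ht =>
    hcons t (by rw [← (Game.isPlay_iff.1 hπ t).2, ht]; rfl)
  have hmleaf : ∀ t l, (π t).1 = .inr l → m t = l := by
    intro t l ht
    cases t with
    | zero =>
      rw [answerGame_start hπ] at ht
      simp at ht
    | succ t =>
      rw [hm]
      rcases answerGame_cases hπ t with ⟨l', h, h'⟩ | ⟨l', S', -, h, h'⟩ | ⟨S', a, ha, h, h'⟩
      · have h2 := hchoice t (by rw [h])
        rw [h'] at ht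
        obtain rfl := Sum.inr.inj ht
        rw [h] at h2 ⊢
        exact (Sum.inr.inj (Prod.mk.inj (Prod.mk.inj h2).2).2).symm
      · rw [h'] at ht
        simp at ht
      · rw [h'] at ht
        simp at ht
  have hν : ∀ t, ∃ ν : T.Node, IsLastAncestorOfSet ν (m t) (lettersOf e (answerOf (π t))) ∧
      m (t + 1) ∈ jump ν (m t) ∧
      ((∃ l, (π t).1 = .inr l) → ν.IsRound ∧ (lettersOf e (answerOf (π t))).Nonempty) ∧
      (¬ (∃ l, (π t).1 = .inr l) → ν = (m t).1) := by
    intro t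
    -- Times without an answer count as trivial jumps at the current leaf with the empty set of
    -- letters, which makes the results on infinite sequences of jumps applicable to all times.
    have hstay : m (t + 1) = m t → answerOf (π t) = ∅ → (¬ ∃ l, (π t).1 = .inr l) →
        ∃ ν : T.Node, IsLastAncestorOfSet ν (m t) (lettersOf e (answerOf (π t))) ∧
        m (t + 1) ∈ jump ν (m t) ∧
        ((∃ l, (π t).1 = .inr l) → ν.IsRound ∧ (lettersOf e (answerOf (π t))).Nonempty) ∧
        (¬ (∃ l, (π t).1 = .inr l) → ν = (m t).1) := fun h1 h2 h3 => by
      refine ⟨(m t).1, ⟨List.prefix_rfl, ?_, fun i h => ?_⟩, Or.inl ⟨rfl, h1⟩, fun h => absurd h h3,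
        fun _ => rfl⟩
      · rw [h2]
        exact fun c hc => absurd hc (Finset.notMem_empty _)
      · rw [(m t).2] at h
        omega
    rcases answerGame_cases hπ t with ⟨l', h, h'⟩ | ⟨l', S', hS, h, h'⟩ | ⟨S', a, ha, h, h'⟩
    · exact hstay (by rw [hm, h]) (by rw [h]; rfl) (by rw [h]; simp)
    · have hml := hmleaf t l' (by rw [h])
      obtain ⟨h1, h2, h3⟩ := hnx l' S' hS
      rw [hm, hml, h]
      exact ⟨nd l' S', h2, h3, fun _ => ⟨h1, hS.1⟩, fun hc => absurd ⟨l', rfl⟩ hc⟩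
    · exact hstay (by rw [hm, h]) (by rw [h]; rfl) (by rw [h]; simp)
  choose ν hν1 hν2 hν3 hν4 using hν
  obtain ⟨n, hn1, hn2⟩ := exists_top_node (fun t => (hν1 t).1) hν2
  have hlim := frequently_mem_limit hT.isDecreasing hν1 hν2 hn2 hn1 fun t i j hi hj => hi.unique hj
  -- The node of an actual answer is round, whereas the trivial jumps use leaves. If `n` is a leaf,
  -- an answer given below it is given at it; if not, every jump at `n` is an actual answer.
  have hround : n.IsRound := by
    rcases Nat.eq_zero_or_pos n.arity with h0 | h0
    · obtain ⟨t, h1, h2⟩ := ((frequently_answer hπ).and_eventually hn2).exists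
      have := Leaf.eq_of_isAncestor (l := ⟨n, h0⟩) h2
      rw [← show ν t = n from this]
      exact (hν3 t h1).1
    · obtain ⟨t, h1, h2⟩ := (frequently_leave_child (fun t => (hν1 t).1) hν2 hn2 hn1
        (fun t i j hi hj => hi.unique hj) h0).exists
      by_cases hreal : ∃ l, (π t).1 = .inr l
      · rw [← h1]
        exact (hν3 t hreal).1
      · have := (m t).2
        rw [← hν4 t hreal, h1] at this
        omega
  refine hT.mem_of_isRound hround ?_ hlim.1 hlim.2
  obtain ⟨c, hc⟩ := frequently_exists_finite (p := fun c t => c ∈ lettersOf e (answerOf (π t)))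
    ((frequently_answer hπ).mono fun t ht => (hν3 t ht).2)
  exact ⟨c, hc⟩

/-- The existential player cannot win with fewer states than there are leaves. -/
theorem exists_leaf_of_memory [Finite Γ] (μ : (answerGame e hT hr).Memory)
    (hμ : (answerGame e hT hr).IsWinningStrategy (mullerLanguage F) μ.strategy) :
    ∃ φ : μ.M → T.Leaf, Function.Surjective φ := by
  classical
  have hφ : ∀ m, ∃ l, μ.next m (.inl ∅) = (.inl ∅, none, .inr l) := by
    intro m
    obtain ⟨h1, h2⟩ := μ.next_mem m (.inl ∅) rfl
    have h1 : AnswerEdge T e (μ.next m (.inl ∅)).1 (μ.next m (.inl ∅)).2.1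
      (μ.next m (.inl ∅)).2.2 := h1
    generalize μ.next m (.inl ∅) = p at h1 h2
    obtain ⟨x, c, y⟩ := p
    cases h1 with
    | choose l => exact ⟨l, rfl⟩
    | answer l S h => simp at h2
    | emit S a ha =>
      obtain rfl := Sum.inl.inj h2
      exact absurd ha (Finset.notMem_empty _)
  choose φ hφ using hφ
  refine ⟨φ, fun l₀ => ?_⟩
  by_contra! hl₀
  -- The positional strategy against a memory that never chooses `l₀`: answer any other leaf by the
  -- label of a square ancestor of `l₀`.
  have hd : ∀ l : T.Leaf, ∃ (d : T.Node) (S : Finset (Fin N)), l ≠ l₀ → d.IsAncestor l₀.1 ∧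
      ¬ d.IsRound ∧ lettersOf e S = d.label ∧ IsAnswer l (lettersOf e S) := by
    intro l
    by_cases h : l = l₀
    · exact ⟨l.1, ∅, fun h' => absurd h h'⟩
    · obtain ⟨d, h1, h2, h3⟩ := hT.exists_answer_of_ne h
      obtain ⟨S, hS⟩ := exists_lettersOf_eq e d.label
      exact ⟨d, S, fun _ => ⟨h1, h2, hS, hS ▸ h3⟩⟩
  choose d S hd using hd
  have hτ : ∀ x : (answerGame e hT hr).V, ∃ p ∈ (answerGame e hT hr).E, p.1 = x ∧
      ∀ l, l ≠ l₀ → x = .inr l → p = (.inr l, none, .inl (S l)) := by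
    intro x
    by_cases hx : ∃ l, l ≠ l₀ ∧ x = .inr l
    · obtain ⟨l, hl, rfl⟩ := hx
      refine ⟨(.inr l, none, .inl (S l)), AnswerEdge.answer l _ (hd l hl).2.2.2, rfl, ?_⟩
      intro l' _ h
      obtain rfl := Sum.inr.inj h
      rfl
    · obtain ⟨p, hp, rfl⟩ := (answerGame e hT hr).total x
      exact ⟨p, hp, rfl, fun l h1 h2 => absurd ⟨l, h1, h2⟩ hx⟩
  choose τ hτ1 hτ2 hτ3 using hτ
  obtain ⟨π, hπ, hcons, hun⟩ := μ.exists_play τ fun x => ⟨hτ1 x, hτ2 x⟩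
  have hwin := hπ.isWinningPlay_iff.1 (hμ.2 π hπ hcons)
  rw [infColours_answerGame hπ] at hwin
  have hleaf : ∀ t l, (π t).1 = .inr l → l ≠ l₀ := by
    intro t l ht
    cases t with
    | zero =>
      rw [answerGame_start hπ] at ht
      simp at ht
    | succ t =>
      rcases answerGame_cases hπ t with ⟨l', h, h'⟩ | ⟨l', S', -, h, h'⟩ | ⟨S', a, ha, h, h'⟩
      · have h1 : (answerGame e hT hr).last ((answerGame e hT hr).pre π t) = .inl ∅ := by
          rw [← (Game.isPlay_iff.1 hπ t).2, h]
        have h2 := hcons t (by rw [h1]; rfl)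
        rw [Game.Memory.strategy, h1, hφ, h] at h2
        rw [h'] at ht
        obtain rfl := Sum.inr.inj ht
        rw [Sum.inr.inj (Prod.mk.inj (Prod.mk.inj h2).2).2]
        exact hl₀ _
      · rw [h'] at ht
        simp at ht
      · rw [h'] at ht
        simp at ht
  have hans : ∀ t l, (π t).1 = .inr l → π t = (.inr l, none, .inl (S l)) := fun t l ht => by
    rw [hun t (by rw [ht]; exact fun h => by cases h), ht]
    exact hτ3 _ l (hleaf t l ht) rfl
  have hne : {n : T.Node | ∃ᶠ t in atTop, ∃ l, (π t).1 = .inr l ∧ d l = n}.Nonempty :=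
    frequently_exists_finite ((frequently_answer hπ).mono fun t ⟨l, hl⟩ => ⟨d l, l, hl, rfl⟩)
  -- The answered nodes are ancestors of the one leaf `l₀`, so those recurring are all below the
  -- shortest one `n`, whose label contains theirs. The limit set is the label of the square node
  -- `n`.
  obtain ⟨n, hn, hmin⟩ := Set.exists_min_image _ (fun n : T.Node => n.1.length) (Set.toFinite _) hne
  have hanc : ∀ n' : T.Node, (∃ᶠ t in atTop, ∃ l, (π t).1 = .inr l ∧ d l = n') →
      n'.IsAncestor l₀.1 ∧ ¬ n'.IsRound := by
    intro n' hn'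
    obtain ⟨t, l, h1, rfl⟩ := hn'.exists
    have := hd l (hleaf t l h1)
    exact ⟨this.1, this.2.1⟩
  have heq : {c | ∃ᶠ t in atTop, c ∈ lettersOf e (answerOf (π t))} = n.label := by
    ext c
    constructor
    · intro hc
      have hfreq : ∃ᶠ t in atTop, ∃ n' : T.Node, (∃ l, (π t).1 = .inr l ∧ d l = n') ∧ c ∈ n'.label := by
        refine Frequently.mono hc fun t ht => ?_
        rcases answerGame_cases hπ t with ⟨l', h, -⟩ | ⟨l', S', -, h, -⟩ | ⟨S', a, ha, h, -⟩
        · rw [h] at ht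
          exact absurd ht (Finset.notMem_empty _)
        · have h1 : (π t).1 = .inr l' := by rw [h]
          rw [hans t l' h1] at ht
          refine ⟨d l', ⟨l', h1, rfl⟩, ?_⟩
          rw [← (hd l' (hleaf t l' h1)).2.2.1]
          exact ht
        · rw [h] at ht
          exact absurd ht (Finset.notMem_empty _)
      obtain ⟨n', hn'⟩ := frequently_exists_finite hfreq
      have hn'1 := hn'.mono fun t ht => ht.1
      obtain ⟨t, -, hc'⟩ := hn'.exists
      exact hT.isDecreasing.label_subset (List.prefix_of_prefix_length_le (hanc n hn).1
        (hanc n' hn'1).1 (hmin n' hn'1)) hc'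
    · intro hc
      refine Frequently.mono hn fun t ⟨l, h1, h2⟩ => ?_
      rw [hans t l h1]
      change c ∈ lettersOf e (S l)
      rwa [(hd l (hleaf t l h1)).2.2.1, h2]
  rw [heq, ← hT.isRound_iff] at hwin
  exact (hanc n hn).2 hwin

end ZTree

/-! ### The lower bound on the memory -/

namespace ZTree

universe u

variable {Γ : Type u} {F : Set (Set Γ)}

/-- The states map onto the leaves of the pruned tree, and these map onto `Fin` of its memory by
their numbers. -/
theorem Alternates.memory_le_of_rootRound [Finite Γ] {T : ZTree Γ} (hT : T.Alternates F)
    (hne : T.rootLabel.Nonempty) (hr : T.rootRound = true) {n : ℕ}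
    (hn : ∀ G : Game Γ, G.WonByExist (mullerLanguage F) →
      ∃ μ : G.Memory, Nat.card μ.M ≤ n ∧ G.IsWinningStrategy (mullerLanguage F) μ.strategy) :
    T.memory ≤ n := by
  obtain ⟨T', hT', -, hround, hmem⟩ := hT.exists_isPruned hne
  obtain ⟨μ, hμ, hwin⟩ := hn _ (wonByExist_answerGame (e := Finite.equivFin Γ) (hT := hT')
    (hr := hround.trans hr))
  obtain ⟨φ, hφ⟩ := exists_leaf_of_memory μ hwin
  have := μ.finite_M
  have h := Nat.card_le_card_of_surjective _ (leafNumber_surjective.comp hφ)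
  rw [Nat.card_fin, hmem] at h
  exact h.trans hμ

/-- Below a square root all children are round, and the root label plays no role in the assumption
on games; so the bound for each child gives that for the maximum. A single square node needs only `1
≤ n`. -/
theorem Alternates.memory_le [Finite Γ] {T : ZTree Γ} (hT : T.Alternates F)
    (hne : T.rootLabel.Nonempty) {n : ℕ} (hn1 : 1 ≤ n)
    (hn : ∀ G : Game Γ, G.WonByExist (mullerLanguage F) →
      ∃ μ : G.Memory, Nat.card μ.M ≤ n ∧ G.IsWinningStrategy (mullerLanguage F) μ.strategy) :
    T.memory ≤ n := by
  obtain ⟨lab, b, k, ch⟩ := T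
  cases b with
  | true => exact hT.memory_le_of_rootRound hne rfl hn
  | false =>
    rcases Nat.eq_zero_or_pos k with rfl | hk
    · simpa [memory] using hn1
    · simp only [memory, hk.ne', if_false, Bool.false_eq_true]
      refine Finset.sup_le fun i _ => ?_
      have hY := (hT.2.2.1 _).1 ⟨i, rfl⟩
      refine (hT.2.2.2 i).memory_le_of_rootRound hY.1.1 ?_ hn
      rw [(hT.2.2.2 i).rootRound_iff, hY.1.2.2, ← hT.1]
      simp

theorem IsZielonkaTree.memgen_eq [Finite Γ] [Nonempty Γ] (hF : ∅ ∉ F) {T : ZTree Γ}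
    (hT : T.IsZielonkaTree F) : memgen (mullerLanguage F) = T.memory := by
  have hmem : T.memory ∈ {n | 1 ≤ n ∧ ∀ G : Game Γ, G.WonByExist (mullerLanguage F) →
      ∃ μ : G.Memory, Nat.card μ.M ≤ n ∧ G.IsWinningStrategy (mullerLanguage F) μ.strategy} :=
    ⟨T.memory_pos, fun G hG => G.exists_memory_of_wonByExist hF hT hG⟩
  refine le_antisymm (Nat.sInf_le hmem) (le_csInf ⟨_, hmem⟩ fun n hn => ?_)
  exact hT.2.memory_le (hT.1 ▸ Set.univ_nonempty) hn.1 hn.2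

end ZTree

/-! ### Evaluation of programs -/

section Programs

variable {P : Program} {v x y : Data} {a b c : Expr} {B B₁ B₂ : ℕ}

theorem Data.one_le_size (d : Data) : 1 ≤ d.size := by
  cases d <;> simp [Data.size]

theorem Data.size_head_le (d : Data) : d.head.size ≤ d.size := by
  cases d <;> simp [Data.size, Data.head]; omega

theorem Data.size_tail_le (d : Data) : d.tail.size ≤ d.size := by
  cases d <;> simp [Data.size, Data.tail]; omega

/-- Data are paid for when built or copied. Running time therefore bounds the size of results, which
is what composition of polynomial bounds requires. -/
theorem Eval.size_le {d : Data} {t : ℕ} (h : Eval P v a d t) : d.size ≤ t := by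
  induction h with
  | arg | nil => simp [Data.size]
  | cons _ _ h₁ h₂ => simp only [Data.size]; omega
  | @head _ _ x _ _ h => have := x.size_head_le; omega
  | @tail _ _ x _ _ h => have := x.size_tail_le; omega
  | ite_true _ _ h₁ h₂ | ite_false _ _ h₁ h₂ => omega
  | call _ _ _ h₁ h₂ => omega

theorem Eval.append {d : Data} {t : ℕ} (h : Eval P v a d t) (R : Program) : Eval (P ++ R) v a d t := by
  induction h with
  | arg => exact .arg _
  | nil => exact .nil _
  | cons _ _ h₁ h₂ => exact .cons h₁ h₂
  | head _ h => exact .head h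
  | tail _ h => exact .tail h
  | ite_true _ _ h₁ h₂ => exact .ite_true h₁ h₂
  | ite_false _ _ h₁ h₂ => exact .ite_false h₁ h₂
  | call _ hf _ h₁ h₂ =>
    refine .call h₁ ?_ h₂
    rw [List.getElem?_append_left (List.getElem?_eq_some_iff.1 hf).1, hf]

/-- `a` evaluates to `d` in at most `B` steps. -/
def EvalWithin (P : Program) (v : Data) (a : Expr) (d : Data) (B : ℕ) : Prop :=
  ∃ t, Eval P v a d t ∧ t ≤ B

namespace EvalWithin

theorem mono (h : EvalWithin P v a x B₁) (hB : B₁ ≤ B₂) : EvalWithin P v a x B₂ := by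
  obtain ⟨t, h, ht⟩ := h
  exact ⟨t, h, ht.trans hB⟩

theorem arg : EvalWithin P v .arg v v.size := ⟨_, .arg _, le_rfl⟩

theorem nil : EvalWithin P v .nil .nil 1 := ⟨_, .nil _, le_rfl⟩

theorem cons (ha : EvalWithin P v a x B₁) (hb : EvalWithin P v b y B₂) :
    EvalWithin P v (.cons a b) (.cons x y) (B₁ + B₂ + 1) := by
  obtain ⟨s, ha, hs⟩ := ha
  obtain ⟨t, hb, ht⟩ := hb
  exact ⟨_, .cons ha hb, by omega⟩

theorem head (ha : EvalWithin P v a x B) : EvalWithin P v (.head a) x.head (B + 1) := by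
  obtain ⟨s, ha, hs⟩ := ha
  exact ⟨_, .head ha, by omega⟩

theorem tail (ha : EvalWithin P v a x B) : EvalWithin P v (.tail a) x.tail (B + 1) := by
  obtain ⟨s, ha, hs⟩ := ha
  exact ⟨_, .tail ha, by omega⟩

theorem ite_true (hc : EvalWithin P v c x B₁) (hx : x ≠ .nil) (ha : EvalWithin P v a y B₂) :
    EvalWithin P v (.ite c a b) y (B₁ + B₂ + 1) := by
  obtain ⟨s, hc, hs⟩ := hc
  obtain ⟨t, ha, ht⟩ := ha
  cases x with
  | nil => exact absurd rfl hx
  | cons x₁ x₂ => exact ⟨_, .ite_true hc ha, by omega⟩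

theorem ite_false (hc : EvalWithin P v c .nil B₁) (hb : EvalWithin P v b y B₂) :
    EvalWithin P v (.ite c a b) y (B₁ + B₂ + 1) := by
  obtain ⟨s, hc, hs⟩ := hc
  obtain ⟨t, hb, ht⟩ := hb
  exact ⟨_, .ite_false hc hb, by omega⟩

theorem call {f : ℕ} {body : Expr} (ha : EvalWithin P v a x B₁) (hf : P[f]? = some body)
    (hb : EvalWithin P x body y B₂) : EvalWithin P v (.call f a) y (B₁ + B₂ + 1) := by
  obtain ⟨s, ha, hs⟩ := ha
  obtain ⟨t, hb, ht⟩ := hb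
  exact ⟨_, .call ha hf hb, by omega⟩

theorem append (ha : EvalWithin P v a x B) (R : Program) : EvalWithin (P ++ R) v a x B := by
  obtain ⟨s, ha, hs⟩ := ha
  exact ⟨s, ha.append R, hs⟩

end EvalWithin

theorem Polynomial.eval_le_eval_nat (p : Polynomial ℕ) {m n : ℕ} (h : m ≤ n) :
    p.eval m ≤ p.eval n := by
  rw [Polynomial.eval_eq_sum, Polynomial.eval_eq_sum]
  exact Finset.sum_le_sum fun i _ => Nat.mul_le_mul_left _ (Nat.pow_le_pow_left h i)

end Programs

/-! ### Functions computable in polynomial time -/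

/-- Types whose elements are encoded as data. -/
class Code (α : Type) where
  enc : α → Data

namespace Code

variable {α β : Type} [Code α] [Code β]

/-- The size of the encoding. -/
def size (a : α) : ℕ := (enc a).size

instance : Code Unit := ⟨fun _ => .nil⟩
instance : Code Bool := ⟨fun b => if b then .cons .nil .nil else .nil⟩
instance : Code ℕ := ⟨Data.ofNat⟩
instance : Code (α × β) := ⟨fun p => .cons (enc p.1) (enc p.2)⟩
instance : Code (List α) := ⟨fun l => Data.ofList (l.map enc)⟩

theorem enc_pair (a : α) (b : β) : enc (a, b) = .cons (enc a) (enc b) := rfl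

theorem one_le_size (a : α) : 1 ≤ size a := (enc a).one_le_size
theorem size_pair (a : α) (b : β) : size (a, b) = size a + size b + 1 := rfl
theorem size_list_nil : size ([] : List α) = 1 := rfl
theorem size_list_cons (a : α) (l : List α) : size (a :: l) = size a + size l + 1 := rfl
theorem size_unit : size () = 1 := rfl

theorem size_nat (n : ℕ) : size n = 2 * n + 1 := by
  induction n with
  | zero => rfl
  | succ n ih =>
    change (enc n).size = _ at ih
    change (Data.cons .nil (enc n)).size = _
    simp only [Data.size, ih]
    omega

theorem size_bool_le (b : Bool) : size b ≤ 3 := by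
  cases b
  · exact Nat.le_add_left 1 2
  · exact le_rfl

theorem two_mul_length_lt_size (l : List α) : 2 * l.length + 1 ≤ size l := by
  induction l with
  | nil => exact le_rfl
  | cons a l ih =>
    rw [size_list_cons, List.length_cons]
    have := one_le_size a
    omega

theorem size_le_of_mem {a : α} {l : List α} (h : a ∈ l) : size a ≤ size l := by
  induction l with
  | nil => simp at h
  | cons b l ih =>
    rw [size_list_cons]
    rcases List.mem_cons.1 h with rfl | h
    · omega
    · have := ih h
      omega

theorem size_le_length_mul {l : List α} {B : ℕ} (h : ∀ a ∈ l, size a ≤ B) :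
    size l ≤ l.length * (B + 1) + 1 := by
  induction l with
  | nil => exact Nat.le_add_left _ _
  | cons a l ih =>
    have h1 := h a List.mem_cons_self
    have h2 := ih fun b hb => h b (List.mem_cons_of_mem _ hb)
    rw [size_list_cons, List.length_cons, add_mul]
    omega

end Code

open Code Polynomial

/-- The function number `k` of `P` computes `f` in time `p`. -/
def Realizes {α β : Type} [Code α] [Code β] (P : Program) (k : ℕ) (f : α → β) (p : ℕ[X]) : Prop :=
  ∃ body, P[k]? = some body ∧ ∀ a, EvalWithin P (enc a) body (enc (f a)) (p.eval (size a))

/-- `f` is computable in polynomial time. The program may be put behind any other program. -/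
def PolyTime {α β : Type} [Code α] [Code β] (f : α → β) : Prop :=
  ∃ p : ℕ[X], ∀ n, ∃ (R : Program) (k : ℕ), ∀ Q : Program, Q.length = n → Realizes (Q ++ R) k f p

section PolyTime

variable {α β γ δ σ : Type} [Code α] [Code β] [Code γ] [Code δ] [Code σ]

theorem Realizes.append {P : Program} {k : ℕ} {f : α → β} {p : ℕ[X]} (h : Realizes P k f p)
    (R : Program) : Realizes (P ++ R) k f p := by
  obtain ⟨body, h1, h2⟩ := h
  refine ⟨body, ?_, fun a => (h2 a).append R⟩
  rw [List.getElem?_append_left (List.getElem?_eq_some_iff.1 h1).1, h1]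

theorem Realizes.call {P : Program} {k : ℕ} {f : α → β} {p : ℕ[X]} (h : Realizes P k f p) {v : Data}
    {e : Expr} {a : α} {B N : ℕ} (he : EvalWithin P v e (enc a) B) (hN : size a ≤ N) :
    EvalWithin P v (.call k e) (enc (f a)) (B + p.eval N + 1) := by
  obtain ⟨body, h1, h2⟩ := h
  exact (EvalWithin.call he h1 (h2 a)).mono (by have := p.eval_le_eval_nat hN; omega)

namespace PolyTime

theorem exists_size_le {f : α → β} (hf : PolyTime f) :
    ∃ p : ℕ[X], ∀ a, size (f a) ≤ p.eval (size a) := by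
  obtain ⟨p, hp⟩ := hf
  obtain ⟨R, k, h⟩ := hp 0
  obtain ⟨body, -, h⟩ := h [] rfl
  refine ⟨p, fun a => ?_⟩
  obtain ⟨t, h1, h2⟩ := h a
  exact h1.size_le.trans h2

/-- A single function without calls. -/
theorem of_expr {f : α → β} (body : Expr) (p : ℕ[X])
    (h : ∀ P a, EvalWithin P (enc a) body (enc (f a)) (p.eval (size a))) : PolyTime f :=
  ⟨p, fun n => ⟨[body], n, fun Q hQ => ⟨body, by simp [← hQ], h _⟩⟩⟩

theorem of_enc_eq {f : α → β} (h : ∀ a, enc (f a) = enc a) : PolyTime f :=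
  of_expr .arg X fun P a => by
    rw [h, eval_X]
    exact .arg

theorem of_head {f : α → β} (h : ∀ a, enc (f a) = (enc a).head) : PolyTime f :=
  of_expr (.head .arg) (X + 1) fun P a => by
    rw [h, eval_add, eval_X, eval_one]
    exact .head .arg

theorem of_tail {f : α → β} (h : ∀ a, enc (f a) = (enc a).tail) : PolyTime f :=
  of_expr (.tail .arg) (X + 1) fun P a => by
    rw [h, eval_add, eval_X, eval_one]
    exact .tail .arg

protected theorem id : PolyTime fun a : α => a := of_enc_eq fun _ => rfl

theorem const (b : β) : PolyTime fun _ : α => b := by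
  have key : ∀ d : Data, ∃ e B, ∀ P v, EvalWithin P v e d B := fun d => by
    induction d with
    | nil => exact ⟨.nil, 1, fun P v => .nil⟩
    | cons x y hx hy =>
      obtain ⟨e₁, B₁, h₁⟩ := hx
      obtain ⟨e₂, B₂, h₂⟩ := hy
      exact ⟨.cons e₁ e₂, _, fun P v => .cons (h₁ P v) (h₂ P v)⟩
  obtain ⟨e, B, h⟩ := key (enc b)
  exact of_expr e (C B) fun P a => by
    rw [eval_C]
    exact h _ _

theorem comp {f : β → γ} {g : α → β} (hf : PolyTime f) (hg : PolyTime g) :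
    PolyTime fun a => f (g a) := by
  obtain ⟨q, hq⟩ := hg.exists_size_le
  obtain ⟨p₁, h₁⟩ := hg
  obtain ⟨p₂, h₂⟩ := hf
  -- The second function runs on an argument whose size is at most `q` of the original size.
  refine ⟨X + p₁ + 1 + p₂.comp q + 1, fun n => ?_⟩
  obtain ⟨R₁, k₁, h₁⟩ := h₁ n
  obtain ⟨R₂, k₂, h₂⟩ := h₂ (n + R₁.length)
  refine ⟨R₁ ++ R₂ ++ [.call k₂ (.call k₁ .arg)], n + R₁.length + R₂.length, fun Q hQ =>
    ⟨.call k₂ (.call k₁ .arg), by simp [← hQ, add_assoc], fun a => ?_⟩⟩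
  have r₁ := ((h₁ Q hQ).append R₂).append [.call k₂ (.call k₁ .arg)]
  have r₂ := (h₂ (Q ++ R₁) (by simp [hQ])).append [.call k₂ (.call k₁ .arg)]
  simp only [List.append_assoc] at r₁ r₂ ⊢
  refine (r₂.call (r₁.call .arg le_rfl) (hq a)).mono ?_
  simp only [eval_add, eval_X, eval_one, eval_comp]
  exact le_rfl

theorem pair {f : α → β} {g : α → γ} (hf : PolyTime f) (hg : PolyTime g) :
    PolyTime fun a => (f a, g a) := by
  obtain ⟨p₁, h₁⟩ := hf
  obtain ⟨p₂, h₂⟩ := hg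
  refine ⟨X + p₁ + 1 + (X + p₂ + 1) + 1, fun n => ?_⟩
  obtain ⟨R₁, k₁, h₁⟩ := h₁ n
  obtain ⟨R₂, k₂, h₂⟩ := h₂ (n + R₁.length)
  refine ⟨R₁ ++ R₂ ++ [.cons (.call k₁ .arg) (.call k₂ .arg)], n + R₁.length + R₂.length, fun Q hQ =>
    ⟨.cons (.call k₁ .arg) (.call k₂ .arg), by simp [← hQ, add_assoc], fun a => ?_⟩⟩
  have r₁ := ((h₁ Q hQ).append R₂).append [.cons (.call k₁ .arg) (.call k₂ .arg)]
  have r₂ := (h₂ (Q ++ R₁) (by simp [hQ])).append [.cons (.call k₁ .arg) (.call k₂ .arg)]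
  simp only [List.append_assoc] at r₁ r₂ ⊢
  refine ((r₁.call .arg le_rfl).cons (r₂.call .arg le_rfl)).mono ?_
  simp only [eval_add, eval_X, eval_one]
  exact le_rfl

theorem cond {c : α → Bool} {f g : α → β} (hc : PolyTime c) (hf : PolyTime f) (hg : PolyTime g) :
    PolyTime fun a => if c a = true then f a else g a := by
  obtain ⟨p₀, h₀⟩ := hc
  obtain ⟨p₁, h₁⟩ := hf
  obtain ⟨p₂, h₂⟩ := hg
  refine ⟨X + p₀ + 1 + (X + p₁ + p₂ + 1) + 1, fun n => ?_⟩
  obtain ⟨R₀, k₀, h₀⟩ := h₀ n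
  obtain ⟨R₁, k₁, h₁⟩ := h₁ (n + R₀.length)
  obtain ⟨R₂, k₂, h₂⟩ := h₂ (n + R₀.length + R₁.length)
  let body : Expr := .ite (.call k₀ .arg) (.call k₁ .arg) (.call k₂ .arg)
  refine ⟨R₀ ++ R₁ ++ R₂ ++ [body], n + R₀.length + R₁.length + R₂.length, fun Q hQ =>
    ⟨body, by simp [← hQ, add_assoc], fun a => ?_⟩⟩
  have r₀ := (((h₀ Q hQ).append R₁).append R₂).append [body]
  have r₁ := ((h₁ (Q ++ R₀) (by simp [hQ])).append R₂).append [body]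
  have r₂ := (h₂ (Q ++ R₀ ++ R₁) (by simp [hQ, add_assoc])).append [body]
  simp only [List.append_assoc] at r₀ r₁ r₂ ⊢
  have e₀ := r₀.call (a := a) .arg le_rfl
  have e₁ := r₁.call (a := a) .arg le_rfl
  have e₂ := r₂.call (a := a) .arg le_rfl
  simp only [eval_add, eval_X, eval_one]
  change EvalWithin _ _ (.ite _ _ _) _ _
  cases hca : c a with
  | true =>
    rw [if_pos rfl]
    rw [hca] at e₀
    refine (e₀.ite_true (by simp [enc]) e₁).mono ?_
    simp only [size]
    omega
  | false =>
    rw [if_neg (by simp)]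
    rw [hca] at e₀
    refine (EvalWithin.ite_false e₀ e₂).mono ?_
    simp only [size]
    omega

/-- Recursion along at most two substructures, with a parameter and with results of polynomial
size. -/
theorem recursion {base : σ → β} {step : (σ × γ) × β × β → β} {s₁ s₂ : γ → α} {f : σ × α → β}
    (w : α → ℕ) (q : ℕ[X]) (hbase : PolyTime base) (hstep : PolyTime step) (hs₁ : PolyTime s₁)
    (hs₂ : PolyTime s₂)
    (hrec : ∀ s a, (enc a = .nil ∧ f (s, a) = base s ∧ 1 ≤ w a) ∨
      ∃ c, enc a = enc c ∧ enc a ≠ .nil ∧ f (s, a) = step ((s, c), f (s, s₁ c), f (s, s₂ c)) ∧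
        w (s₁ c) + w (s₂ c) + 1 ≤ w a ∧ size (s₁ c) ≤ size a ∧ size (s₂ c) ≤ size a)
    (hw : ∀ a, w a ≤ size a) (hq : ∀ s a, size (f (s, a)) ≤ q.eval (size (s, a))) : PolyTime f := by
  obtain ⟨pb, hb⟩ := hbase
  obtain ⟨ps, hs⟩ := hstep
  obtain ⟨p₁, h₁⟩ := hs₁
  obtain ⟨p₂, h₂⟩ := hs₂
  -- A bound for the cost of one unfolding: copying and taking apart the argument, the calls of the
  -- auxiliary functions, and one step on two results of size at most `q`. The total is the number
  -- `w` of unfoldings times `K`.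
  let K : ℕ[X] := C 10 * X + C 30 + pb + p₁ + p₂ + ps.comp (X + C 2 * q + C 2)
  refine ⟨X * K, fun n => ?_⟩
  obtain ⟨Rb, kb, hb⟩ := hb n
  obtain ⟨Rs, ks, hs⟩ := hs (n + Rb.length)
  obtain ⟨R₁, k₁, h₁⟩ := h₁ (n + Rb.length + Rs.length)
  obtain ⟨R₂, k₂, h₂⟩ := h₂ (n + Rb.length + Rs.length + R₁.length)
  -- The index of the recursive function itself, placed behind its four auxiliary programs.
  let k := n + Rb.length + Rs.length + R₁.length + R₂.length
  let body : Expr := .ite (.tail .arg)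
    (.call ks (.cons .arg (.cons
      (.call k (.cons (.head .arg) (.call k₁ (.tail .arg))))
      (.call k (.cons (.head .arg) (.call k₂ (.tail .arg)))))))
    (.call kb (.head .arg))
  refine ⟨Rb ++ Rs ++ R₁ ++ R₂ ++ [body], k, fun Q hQ => ?_⟩
  have rb := ((((hb Q hQ).append Rs).append R₁).append R₂).append [body]
  have rs := (((hs (Q ++ Rb) (by simp [hQ])).append R₁).append R₂).append [body]
  have r₁ := ((h₁ (Q ++ Rb ++ Rs) (by simp [hQ, add_assoc])).append R₂).append [body]
  have r₂ := (h₂ (Q ++ Rb ++ Rs ++ R₁) (by simp [hQ, add_assoc])).append [body]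
  simp only [List.append_assoc] at rb rs r₁ r₂ ⊢
  set P : Program := Q ++ (Rb ++ (Rs ++ (R₁ ++ (R₂ ++ [body])))) with hP
  have hk : P[k]? = some body := by simp [hP, k, ← hQ, add_assoc]
  refine ⟨body, hk, fun ⟨s, a₀⟩ => ?_⟩
  set N := size (s, a₀) with hN
  have key : ∀ m a, w a ≤ m → size a ≤ size a₀ →
      EvalWithin P (enc (s, a)) body (enc (f (s, a))) (w a * K.eval N) := by
    intro m
    induction m with
    | zero =>
      intro a ha _
      rcases hrec s a with ⟨-, -, h⟩ | ⟨c, -, -, -, h, -⟩ <;> omega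
    | succ m ih =>
      intro a ha hsa
      have hNa : size (s, a) ≤ N := by simp only [hN, size_pair]; omega
      have harg : EvalWithin P (enc (s, a)) .arg (enc (s, a)) N := EvalWithin.arg.mono hNa
      have htail : EvalWithin P (enc (s, a)) (.tail .arg) (enc a) (N + 1) := harg.tail
      have hhead : EvalWithin P (enc (s, a)) (.head .arg) (enc s) (N + 1) := harg.head
      have hsN : size s ≤ N := by simp only [hN, size_pair]; omega
      have haN : size a ≤ N := by simp only [hN, size_pair]; omega
      have hKN : K.eval N = 10 * N + 30 + pb.eval N + p₁.eval N + p₂.eval N +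
          ps.eval (N + 2 * q.eval N + 2) := by
        simp only [K, eval_add, eval_mul, eval_C, eval_X, eval_comp]
      rcases hrec s a with ⟨h1, h2, h3⟩ | ⟨c, h1, h2, h3, h4, h5, h6⟩
      · rw [h2]
        rw [h1] at htail
        refine (EvalWithin.ite_false htail (rb.call hhead hsN)).mono ?_
        calc _ ≤ 1 * K.eval N := by rw [hKN]; omega
          _ ≤ w a * K.eval N := Nat.mul_le_mul_right _ h3
      · rw [h3]
        -- `c` is the argument `a` regarded as an element of another type with the same encoding,
        -- hence destructuring costs nothing.
        have htail' := htail
        rw [h1] at htail'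
        have hcN : size c ≤ N := by
          have : size c = size a := by rw [size, size, h1]
          omega
        have hf : ∀ x, size x ≤ size a → size (f (s, x)) ≤ q.eval N := fun x hx =>
          (hq s x).trans (q.eval_le_eval_nat (by simp only [hN, size_pair]; omega))
        have e₁ := EvalWithin.call (hhead.cons (r₁.call htail' hcN)) hk (ih (s₁ c) (by omega) (by omega))
        have e₂ := EvalWithin.call (hhead.cons (r₂.call htail' hcN)) hk (ih (s₂ c) (by omega) (by omega))
        have hsize : size ((s, c), f (s, s₁ c), f (s, s₂ c)) ≤ N + 2 * q.eval N + 2 := by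
          have g₁ := hf _ h5
          have g₂ := hf _ h6
          have : size (s, c) = size (s, a) := by rw [size_pair, size_pair, size, size, size, h1]
          rw [size_pair (s, c), size_pair (f (s, s₁ c)), this]
          omega
        have harg' : EvalWithin P (enc (s, a)) .arg (enc (s, c)) N := by
          have : enc (s, c) = enc (s, a) := by rw [enc_pair, enc_pair, h1]
          rw [this]
          exact harg
        refine (EvalWithin.ite_true htail h2 (rs.call (harg'.cons (e₁.cons e₂)) hsize)).mono ?_
        calc _ ≤ (w (s₁ c) + w (s₂ c) + 1) * K.eval N := by
              rw [add_mul, add_mul, one_mul]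
              generalize w (s₁ c) * K.eval N = y₁
              generalize w (s₂ c) * K.eval N = y₂
              rw [hKN]
              omega
          _ ≤ w a * K.eval N := Nat.mul_le_mul_right _ h4
  refine (key _ a₀ le_rfl le_rfl).mono ?_
  rw [eval_mul, eval_X]
  refine Nat.mul_le_mul_right _ ((hw a₀).trans ?_)
  rw [hN, size_pair]
  omega

end PolyTime

end PolyTime

/-! ### A library of polynomial-time operations on lists and numbers -/

section PolyTime

variable {α β γ δ σ : Type} [Code α] [Code β] [Code γ] [Code δ] [Code σ]

namespace PolyTime

theorem fst {f : σ → α × β} (hf : PolyTime f) : PolyTime fun s => (f s).1 :=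
  (of_head (f := Prod.fst) fun _ => rfl).comp hf

theorem snd {f : σ → α × β} (hf : PolyTime f) : PolyTime fun s => (f s).2 :=
  (of_tail (f := Prod.snd) fun _ => rfl).comp hf

theorem listCons {f : σ → α} {g : σ → List α} (hf : PolyTime f) (hg : PolyTime g) :
    PolyTime fun s => f s :: g s :=
  (of_enc_eq (f := fun p : α × List α => p.1 :: p.2) fun _ => rfl).comp (hf.pair hg)

theorem succ {f : σ → ℕ} (hf : PolyTime f) : PolyTime fun s => f s + 1 :=
  (of_enc_eq (f := fun p : Unit × ℕ => p.2 + 1) fun _ => rfl).comp ((const ()).pair hf)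

theorem pred {f : σ → ℕ} (hf : PolyTime f) : PolyTime fun s => f s - 1 :=
  (of_tail (f := fun n : ℕ => n - 1) fun n => by cases n <;> rfl).comp hf

theorem of_eq_nil {f : α → Bool} (h : ∀ a, f a = true ↔ enc a = .nil) : PolyTime f :=
  of_expr (.ite .arg .nil (.cons .nil .nil)) (X + 10) fun P a => by
    rw [eval_add, eval_X, eval_ofNat]
    by_cases hn : enc a = .nil
    · rw [(h a).2 hn]
      have : EvalWithin P (enc a) .arg .nil (size a) := hn ▸ EvalWithin.arg
      exact (EvalWithin.ite_false this (.cons .nil .nil)).mono (by omega)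
    · rw [Bool.eq_false_iff.2 fun h' => hn ((h a).1 h')]
      exact (EvalWithin.ite_true .arg hn .nil).mono (by simp only [size]; omega)

theorem isEmpty {f : σ → List α} (hf : PolyTime f) : PolyTime fun s => (f s).isEmpty :=
  (of_eq_nil (f := List.isEmpty) fun l => by
    cases l <;> simp [enc, Data.ofList]).comp hf

theorem isZero {f : σ → ℕ} (hf : PolyTime f) : PolyTime fun s => f s == 0 :=
  (of_eq_nil (f := fun n : ℕ => n == 0) fun n => by
    cases n <;> simp [enc, Data.ofNat]).comp hf

theorem not {f : σ → Bool} (hf : PolyTime f) : PolyTime fun s => !(f s) :=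
  (of_eq_nil (f := fun b => !b) fun b => by cases b <;> simp [enc]).comp hf

theorem and {f g : σ → Bool} (hf : PolyTime f) (hg : PolyTime g) : PolyTime fun s => f s && g s := by
  have := hf.cond hg (const false)
  convert this using 2 with s
  cases f s <;> simp

/-- Recursion on lists. -/
theorem listRec {base : σ → β} {step : (σ × α × List α) × β → β} {f : σ × List α → β} (q : ℕ[X])
    (hbase : PolyTime base) (hstep : PolyTime step) (h0 : ∀ s, f (s, []) = base s)
    (h1 : ∀ s a l, f (s, a :: l) = step ((s, a, l), f (s, l)))
    (hq : ∀ s l, size (f (s, l)) ≤ q.eval (size (s, l))) : PolyTime f := by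
  -- The first branch is a dummy call on the empty list; the weight `2 * l.length + 1` pays for it.
  refine recursion (γ := α × List α) (step := fun x => step (x.1, x.2.2)) (s₁ := fun _ => [])
    (s₂ := Prod.snd) (fun l => 2 * l.length + 1) q hbase
    (hstep.comp (PolyTime.id.fst.pair PolyTime.id.snd.snd)) (const _) PolyTime.id.snd (fun s l => ?_)
    two_mul_length_lt_size hq
  cases l with
  | nil => exact Or.inl ⟨rfl, h0 s, le_rfl⟩
  | cons a l =>
    refine Or.inr ⟨(a, l), rfl, by simp [enc, Data.ofList], h1 s a l, ?_, ?_, ?_⟩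
    · simp only [List.length_nil, List.length_cons]
      omega
    · exact one_le_size _
    · rw [size_list_cons]
      exact (Nat.le_add_left _ _).trans (Nat.le_succ _)

/-- Recursion on natural numbers. -/
theorem natRec {base : σ → β} {step : (σ × ℕ) × β → β} {f : σ × ℕ → β} (q : ℕ[X])
    (hbase : PolyTime base) (hstep : PolyTime step) (h0 : ∀ s, f (s, 0) = base s)
    (h1 : ∀ s n, f (s, n + 1) = step ((s, n), f (s, n)))
    (hq : ∀ s n, size (f (s, n)) ≤ q.eval (size (s, n))) : PolyTime f := by
  refine recursion (γ := Unit × ℕ) (step := fun x => step ((x.1.1, x.1.2.2), x.2.2))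
    (s₁ := fun _ => 0) (s₂ := Prod.snd) (fun n => 2 * n + 1) q hbase
    (hstep.comp ((PolyTime.id.fst.fst.pair PolyTime.id.fst.snd.snd).pair PolyTime.id.snd.snd))
    (const _) PolyTime.id.snd (fun s n => ?_) (fun n => (size_nat n).ge) hq
  cases n with
  | zero => exact Or.inl ⟨rfl, h0 s, le_rfl⟩
  | succ n =>
    refine Or.inr ⟨((), n), rfl, by simp [enc, Data.ofNat], h1 s n, ?_, ?_, ?_⟩
    · simp only
      omega
    · exact one_le_size _
    · rw [size_nat, size_nat]
      simp only
      omega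

/-! #### Natural numbers -/

theorem add {f g : σ → ℕ} (hf : PolyTime f) (hg : PolyTime g) : PolyTime fun s => f s + g s := by
  refine (natRec (σ := ℕ) (f := fun p : ℕ × ℕ => p.1 + p.2) (step := fun x => x.2 + 1) X PolyTime.id
    PolyTime.id.snd.succ (fun _ => rfl) (fun _ _ => rfl) fun m n => ?_).comp (hf.pair hg)
  simp only [size_pair, size_nat, eval_X]
  omega

theorem sub {f g : σ → ℕ} (hf : PolyTime f) (hg : PolyTime g) : PolyTime fun s => f s - g s := by
  refine (natRec (σ := ℕ) (f := fun p : ℕ × ℕ => p.1 - p.2) (step := fun x => x.2 - 1) X PolyTime.id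
    PolyTime.id.snd.pred (fun _ => rfl) (fun _ _ => rfl) fun m n => ?_).comp (hf.pair hg)
  simp only [size_pair, size_nat, eval_X]
  omega

theorem natLt {f g : σ → ℕ} (hf : PolyTime f) (hg : PolyTime g) :
    PolyTime fun s => decide (f s < g s) := by
  convert (hg.sub hf).isZero.not using 2 with s
  by_cases h : f s < g s
  · simp [h]
    omega
  · simp [h]
    omega

theorem natEq {f g : σ → ℕ} (hf : PolyTime f) (hg : PolyTime g) :
    PolyTime fun s => f s == g s := by
  convert (hf.natLt hg).not.and (hg.natLt hf).not using 2 with s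
  rw [Bool.eq_iff_iff]
  simp
  omega

theorem max {f g : σ → ℕ} (hf : PolyTime f) (hg : PolyTime g) : PolyTime fun s => max (f s) (g s) := by
  convert (hf.natLt hg).cond hg hf using 2 with s
  simp only [decide_eq_true_eq]
  split_ifs <;> omega

/-! #### Lists -/

theorem append {f g : σ → List α} (hf : PolyTime f) (hg : PolyTime g) :
    PolyTime fun s => f s ++ g s := by
  refine (listRec (σ := List α) (f := fun p : List α × List α => p.2 ++ p.1)
    (step := fun x => x.1.2.1 :: x.2) X PolyTime.id (PolyTime.id.fst.snd.fst.listCons PolyTime.id.snd)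
    (fun _ => rfl) (fun _ _ _ => rfl) fun m l => ?_).comp (hg.pair hf)
  rw [eval_X]
  induction l with
  | nil => simp only [List.nil_append, size_pair]; omega
  | cons a l ih =>
    simp only [List.cons_append, size_pair, size_list_cons] at ih ⊢
    omega

theorem map {f : σ → List α} {g : σ × α → β} (hf : PolyTime f) (hg : PolyTime g) :
    PolyTime fun s => (f s).map fun a => g (s, a) := by
  obtain ⟨q, hq⟩ := hg.exists_size_le
  refine (listRec (σ := σ) (f := fun p : σ × List α => p.2.map fun a => g (p.1, a))
    (step := fun x => g (x.1.1, x.1.2.1) :: x.2) (X * (q + 1) + 1) (const [])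
    ((hg.comp (PolyTime.id.fst.fst.pair PolyTime.id.fst.snd.fst)).listCons PolyTime.id.snd)
    (fun _ => rfl) (fun _ _ _ => rfl) fun s l => ?_).comp (PolyTime.id.pair hf)
  simp only [eval_add, eval_mul, eval_X, eval_one]
  refine (size_le_length_mul (B := q.eval (size (s, l))) fun b hb => ?_).trans ?_
  · obtain ⟨a, ha, rfl⟩ := List.mem_map.1 hb
    refine (hq _).trans (q.eval_le_eval_nat ?_)
    have := size_le_of_mem ha
    simp only [size_pair]
    omega
  · rw [List.length_map]
    have := two_mul_length_lt_size l
    refine Nat.succ_le_succ (Nat.mul_le_mul_right _ ?_)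
    simp only [size_pair]
    omega

theorem flatten {f : σ → List (List α)} (hf : PolyTime f) : PolyTime fun s => (f s).flatten := by
  refine (listRec (σ := Unit) (f := fun p : Unit × List (List α) => p.2.flatten)
    (step := fun x => x.1.2.1 ++ x.2) X (const []) (PolyTime.id.fst.snd.fst.append PolyTime.id.snd)
    (fun _ => rfl) (fun _ _ _ => rfl) fun m l => ?_).comp ((const ()).pair hf)
  rw [eval_X]
  induction l with
  | nil =>
    simp only [List.flatten_nil, size_pair, size_list_nil]
    omega
  | cons a l ih =>
    have : ∀ a b : List α, size (a ++ b) + 1 = size a + size b := fun a b => by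
      induction a with
      | nil => rw [List.nil_append, size_list_nil]; omega
      | cons c a ih => simp only [List.cons_append, size_list_cons]; omega
    have := this a l.flatten
    simp only [List.flatten_cons, size_pair, size_list_cons] at ih ⊢
    omega

theorem flatMap {f : σ → List α} {g : σ × α → List β} (hf : PolyTime f) (hg : PolyTime g) :
    PolyTime fun s => (f s).flatMap fun a => g (s, a) := by
  simp only [List.flatMap]
  exact (hf.map hg).flatten

theorem filter {f : σ → List α} {c : σ × α → Bool} (hf : PolyTime f) (hc : PolyTime c) :
    PolyTime fun s => (f s).filter fun a => c (s, a) := by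
  convert hf.flatMap (g := fun x => if c x = true then [x.2] else [])
    (hc.cond (PolyTime.id.snd.listCons (const [])) (const [])) using 2 with s
  induction f s with
  | nil => rfl
  | cons a l ih =>
    rw [List.flatMap_cons, ← ih]
    cases h : c (s, a) <;> simp [h]

theorem any {f : σ → List α} {c : σ × α → Bool} (hf : PolyTime f) (hc : PolyTime c) :
    PolyTime fun s => (f s).any fun a => c (s, a) := by
  convert (hf.filter hc).isEmpty.not using 2 with s
  rw [Bool.eq_iff_iff]
  simp

theorem range {f : σ → ℕ} (hf : PolyTime f) : PolyTime fun s => List.range (f s) := by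
  refine (natRec (σ := Unit) (f := fun p : Unit × ℕ => List.range p.2)
    (step := fun x => x.2 ++ [x.1.2]) (X * (X + 1) + 1) (const [])
    (PolyTime.id.snd.append (PolyTime.id.fst.snd.listCons (const [])))
    (fun _ => rfl) (fun _ _ => List.range_succ) fun u n => ?_).comp ((const ()).pair hf)
  simp only [eval_add, eval_mul, eval_X, eval_one]
  have hn : 2 * n + 1 ≤ size (u, n) := by simp only [size_pair, size_nat]; omega
  refine (size_le_length_mul (B := size (u, n)) fun b hb => ?_).trans ?_
  · rw [size_nat]
    have := List.mem_range.1 hb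
    omega
  · rw [List.length_range]
    exact Nat.succ_le_succ (Nat.mul_le_mul_right _ (by omega))

theorem sum {f : σ → List ℕ} (hf : PolyTime f) : PolyTime fun s => (f s).sum := by
  refine (listRec (σ := Unit) (f := fun p : Unit × List ℕ => p.2.sum)
    (step := fun x => x.1.2.1 + x.2) X (const 0) (PolyTime.id.fst.snd.fst.add PolyTime.id.snd)
    (fun _ => rfl) (fun _ _ _ => rfl) fun _ l => ?_).comp ((const ()).pair hf)
  rw [eval_X]
  induction l with
  | nil => simp [size_pair, size_list_nil, size_nat]
  | cons a l ih =>
    simp only [List.sum_cons, size_pair, size_list_cons, size_nat] at ih ⊢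
    omega

theorem foldrMax {f : σ → List ℕ} (hf : PolyTime f) :
    PolyTime fun s => (f s).foldr Max.max 0 := by
  refine (listRec (σ := Unit) (f := fun p : Unit × List ℕ => p.2.foldr Max.max 0)
    (step := fun x => Max.max x.1.2.1 x.2) X (const 0) (PolyTime.id.fst.snd.fst.max PolyTime.id.snd)
    (fun _ => rfl) (fun _ _ _ => rfl) fun _ l => ?_).comp ((const ()).pair hf)
  rw [eval_X]
  induction l with
  | nil => simp [size_pair, size_list_nil, size_nat]
  | cons a l ih =>
    simp only [List.foldr_cons, size_pair, size_list_cons, size_nat] at ih ⊢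
    omega

theorem zipIdx {f : σ → List α} (hf : PolyTime f) : PolyTime fun s => (f s).zipIdx := by
  refine (listRec (σ := Unit) (f := fun p : Unit × List α => p.2.zipIdx)
    (step := fun x => (x.1.2.1, 0) :: x.2.map fun y => (y.1, y.2 + 1))
    (X * (X + X + X + 1 + 1) + 1) (const [])
    ((PolyTime.id.fst.snd.fst.pair (const 0)).listCons (PolyTime.id.snd.map
      (PolyTime.id.snd.fst.pair PolyTime.id.snd.snd.succ)))
    (fun _ => rfl) (fun _ a l => ?_) fun u l => ?_).comp ((const ()).pair hf)
  · simp only [List.zipIdx_cons, zero_add, List.cons.injEq, true_and]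
    rw [List.zipIdx_succ]
  · simp only [eval_add, eval_mul, eval_X, eval_one]
    have hl := two_mul_length_lt_size l
    refine (size_le_length_mul (B := size l + size l + size l + 1) fun b hb => ?_).trans ?_
    · obtain ⟨a, i⟩ := b
      have h := List.mem_zipIdx hb
      have h1 : size a ≤ size l := size_le_of_mem (by rw [h.2.2]; exact List.getElem_mem _)
      have h2 := h.2.1
      simp only [size_pair, size_nat]
      omega
    · rw [List.length_zipIdx]
      have : size l ≤ size (u, l) := by simp only [size_pair]; omega
      exact Nat.succ_le_succ (Nat.mul_le_mul (by omega) (by omega))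

theorem take {f : σ → ℕ} {g : σ → List α} (hf : PolyTime f) (hg : PolyTime g) :
    PolyTime fun s => (g s).take (f s) := by
  have h := (hg.zipIdx.filter (c := fun x => decide (x.2.2 < f x.1))
    (PolyTime.id.snd.snd.natLt (hf.comp PolyTime.id.fst))).map
      (g := fun x => x.2.1) PolyTime.id.snd.fst
  have key : ∀ (l : List α) (i n : ℕ),
      ((l.zipIdx i).filter fun x => decide (x.2 < i + n)).map (fun x => x.1) = l.take n := by
    intro l
    induction l with
    | nil => simp
    | cons a l ih =>
      intro i n
      cases n with
      | zero =>
        rw [List.take_zero, List.map_eq_nil_iff, List.filter_eq_nil_iff]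
        intro x hx
        have := List.le_snd_of_mem_zipIdx hx
        simp
        omega
      | succ n =>
        have := ih (i + 1) n
        rw [show i + 1 + n = i + (n + 1) by omega] at this
        simp [List.zipIdx_cons, this]
  convert h using 2 with s
  have := key (g s) 0 (f s)
  rw [zero_add] at this
  exact this.symm

/-- Avoids a simultaneous recursion on two lists: `p` is a prefix of `q` iff each entry of `p`,
paired with its index, occurs among the indexed entries of `q`. -/
theorem isPrefix {f g : σ → List ℕ} (hf : PolyTime f) (hg : PolyTime g) :
    PolyTime fun s => (f s).isPrefixOf (g s) := by
  have h1 : PolyTime fun x : σ × ℕ × ℕ =>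
      !((g x.1).zipIdx.any fun y => x.2.1 == y.1 && x.2.2 == y.2) :=
    ((hg.comp PolyTime.id.fst).zipIdx.any
      (c := fun y : (σ × ℕ × ℕ) × ℕ × ℕ => y.1.2.1 == y.2.1 && y.1.2.2 == y.2.2)
      ((PolyTime.id.fst.snd.fst.natEq PolyTime.id.snd.fst).and
        (PolyTime.id.fst.snd.snd.natEq PolyTime.id.snd.snd))).not
  convert (hf.zipIdx.any h1).not using 2 with s
  rw [Bool.eq_iff_iff, List.isPrefixOf_iff_prefix]
  have hpre : ∀ p q : List ℕ, p <+: q ↔ ∀ (i : ℕ) (a : ℕ), p[i]? = some a → q[i]? = some a := by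
    intro p
    induction p with
    | nil => simp
    | cons a p ih =>
      intro q
      cases q with
      | nil =>
        simp only [List.prefix_nil, List.cons_ne_nil, false_iff, not_forall]
        exact ⟨0, a, by simp⟩
      | cons b q =>
        rw [List.cons_prefix_cons, ih]
        constructor
        · rintro ⟨rfl, h⟩ (_ | i) c hc
          · exact hc
          · exact h i c hc
        · intro h
          have := h 0 a rfl
          simp only [List.getElem?_cons_zero, Option.some.injEq] at this
          exact ⟨this.symm, fun i c hc => h (i + 1) c hc⟩
  rw [hpre]
  simp only [Bool.not_eq_eq_eq_not, Bool.not_true, List.any_eq_false, Bool.and_eq_true,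
    beq_iff_eq, Prod.forall, List.mk_mem_zipIdx_iff_getElem?]
  constructor
  · intro h a i hi h'
    exact h' a i (h i a hi) ⟨rfl, rfl⟩
  · intro h i a hi
    by_contra hc
    refine h a i hi fun b j hj hab => hc ?_
    rw [hab.1, hab.2]
    exact hj

theorem elem {f : σ → ℕ} {g : σ → List ℕ} (hf : PolyTime f) (hg : PolyTime g) :
    PolyTime fun s => (g s).any fun a => f s == a :=
  hg.any (c := fun x => f x.1 == x.2) ((hf.comp PolyTime.id.fst).natEq PolyTime.id.snd)

end PolyTime

end PolyTime

/-! ### Forests -/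

/-- Ordered forests: the shape of the first root, the characteristic word of its label, its subtrees,
and the remaining trees. -/
inductive Forest : Type
  | nil : Forest
  | cons (round : Bool) (label : List Bool) (children rest : Forest) : Forest

namespace Forest

/-- Chosen to agree with the list of the encodings of the trees. A node is a list of three entries,
whence the final `.nil` after the children. The structure is that of first child and next sibling,
with two recursive calls as in `PolyTime.recursion`. -/
def enc : Forest → Data
  | nil => .nil
  | cons b lab ch r => .cons (.cons (Code.enc b) (.cons (Code.enc lab) (.cons ch.enc .nil))) r.enc

instance : Code Forest := ⟨enc⟩

/-- A single tree. -/
abbrev Root : Type := Bool × List Bool × Forest × Unit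

/-- Twice the number of nodes, plus one. -/
def weight : Forest → ℕ
  | nil => 1
  | cons _ _ ch r => ch.weight + r.weight + 1

theorem size_cons (b : Bool) (lab : List Bool) (ch r : Forest) :
    size (cons b lab ch r) = size ((b, lab, ch, ()) : Root) + size r + 1 := rfl

theorem weight_le_size (F : Forest) : F.weight ≤ size F := by
  induction F with
  | nil => exact le_rfl
  | cons b lab ch r h1 h2 =>
    simp only [size_cons, size_pair, weight]
    omega

variable {β : Type}

/-- The values of the trees of a forest that are computed bottom-up by `g`. -/
def fold (g : Bool × List Bool × List β → β) : Forest → List β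
  | nil => []
  | cons b lab ch r => g (b, lab, fold g ch) :: fold g r

theorem length_fold_lt (g : Bool × List Bool × List β → β) (F : Forest) :
    (F.fold g).length < F.weight := by
  induction F with
  | nil => exact Nat.one_pos
  | cons b lab ch r _ h =>
    simp only [fold, weight, List.length_cons]
    omega

end Forest

namespace PolyTime

variable {σ α β : Type} [Code σ] [Code α] [Code β]

/-- The bound `q` has to be supplied separately, since iterating a polynomial-time step along a tree
may blow up the results. -/
theorem forestFold {g : Bool × List Bool × List β → β} (hg : PolyTime g) (q : ℕ[X])
    (hq : ∀ F : Forest, size (F.fold g) ≤ q.eval (size F)) : PolyTime fun F : Forest => F.fold g := by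
  refine (recursion (σ := Unit) (γ := Forest.Root × Forest) (base := fun _ => [])
    (step := fun x : (Unit × Forest.Root × Forest) × List β × List β =>
      g (x.1.2.1.1, x.1.2.1.2.1, x.2.1) :: x.2.2)
    (f := fun p : Unit × Forest => p.2.fold g)
    (s₁ := fun c => c.1.2.2.1) (s₂ := Prod.snd) Forest.weight q (const [])
    ((hg.comp (PolyTime.id.fst.snd.fst.fst.pair
      (PolyTime.id.fst.snd.fst.snd.fst.pair PolyTime.id.snd.fst))).listCons PolyTime.id.snd.snd)
    PolyTime.id.fst.snd.snd.fst PolyTime.id.snd (fun _ F => ?_) Forest.weight_le_size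
    (fun u F => (hq F).trans (q.eval_le_eval_nat ?_))).comp ((const ()).pair PolyTime.id)
  · cases F with
    | nil => exact Or.inl ⟨rfl, rfl, le_rfl⟩
    | cons b lab ch r =>
      refine Or.inr ⟨((b, lab, ch, ()), r), rfl, by simp [enc, Forest.enc], rfl, le_rfl, ?_, ?_⟩
      · simp only [Forest.size_cons, size_pair]
        omega
      · simp only [Forest.size_cons]
        omega
  · simp only [size_pair]
    omega

theorem length {f : σ → List α} (hf : PolyTime f) : PolyTime fun s => (f s).length := by
  convert (hf.map (const 1)).sum using 2 with s
  simp

end PolyTime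

namespace Forest

/-! ### The nodes of a tree -/

/-- The addresses and the shapes of the nodes of a tree. -/
def nodesStep (x : Bool × List Bool × List (List (List ℕ × Bool))) : List (List ℕ × Bool) :=
  ([], x.1) :: x.2.2.zipIdx.flatMap fun y => y.1.map fun z => (y.2 :: z.1, z.2)

theorem polyTime_nodesStep : PolyTime nodesStep :=
  ((PolyTime.const []).pair PolyTime.id.fst).listCons (PolyTime.id.snd.snd.zipIdx.flatMap
    (PolyTime.id.snd.fst.map
      (g := fun x : (_ × List (List ℕ × Bool) × ℕ) × List ℕ × Bool => (x.1.2.2 :: x.2.1, x.2.2))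
      ((PolyTime.id.fst.snd.snd.listCons PolyTime.id.snd.fst).pair PolyTime.id.snd.snd)))

theorem length_flatMap_zipIdx_le {α β : Type*} (l : List α) (f : α × ℕ → List β) (n : α → ℕ)
    (h : ∀ a ∈ l, ∀ i, (f (a, i)).length ≤ n a) : (l.zipIdx.flatMap f).length ≤ (l.map n).sum := by
  have key : ∀ k, ((l.zipIdx k).flatMap f).length ≤ (l.map n).sum := by
    induction l with
    | nil => simp
    | cons a l ih =>
      intro k
      have h1 := ih (fun b hb => h b (List.mem_cons_of_mem _ hb)) (k + 1)
      have h2 := h a List.mem_cons_self k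
      simp only [List.zipIdx_cons, List.flatMap_cons, List.length_append, List.map_cons,
        List.sum_cons]
      omega
  exact key 0

theorem mem_zipIdx_zero {α : Type*} {l : List α} {y : α × ℕ} (h : y ∈ l.zipIdx) :
    y.1 ∈ l ∧ y.2 < l.length := by
  obtain ⟨a, i⟩ := y
  have h := List.mem_zipIdx h
  exact ⟨by rw [h.2.2]; exact List.getElem_mem _, by simpa using h.2.1⟩

/-- The invariants behind the size bound: the total number of nodes, the length of the addresses and
their entries are all bounded by the size of the forest. -/
theorem fold_nodesStep_bound {S : ℕ} (F : Forest) (hF : size F ≤ S) :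
    ((F.fold nodesStep).map List.length).sum < F.weight ∧
      ∀ ns ∈ F.fold nodesStep, ∀ z ∈ ns, z.1.length < F.weight ∧ ∀ i ∈ z.1, i ≤ S := by
  induction F with
  | nil => simp [fold, weight]
  | cons b lab ch r h1 h2 =>
    simp only [size_cons, size_pair] at hF
    obtain ⟨h1, h1'⟩ := h1 (by omega)
    obtain ⟨h2, h2'⟩ := h2 (by omega)
    constructor
    · have := length_flatMap_zipIdx_le (fold nodesStep ch)
        (fun y => y.1.map fun z => (y.2 :: z.1, z.2)) List.length (fun a _ i => by simp)
      simp only [fold, nodesStep, List.map_cons, List.sum_cons, List.length_cons, weight]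
      omega
    · intro ns hns z hz
      simp only [fold, List.mem_cons] at hns
      simp only [weight]
      rcases hns with rfl | hns
      · simp only [nodesStep, List.mem_cons, List.mem_flatMap, List.mem_map] at hz
        rcases hz with rfl | ⟨y, hy, z, hz, rfl⟩
        · simp
        · obtain ⟨hy1, hy2⟩ := mem_zipIdx_zero hy
          have h3 := h1' _ hy1 z hz
          have h4 := length_fold_lt nodesStep ch
          have h5 := ch.weight_le_size
          simp only [List.length_cons, List.mem_cons]
          refine ⟨by omega, ?_⟩
          rintro i (rfl | hi)
          · omega
          · exact h3.2 i hi
      · have := h2' ns hns z hz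
        exact ⟨by omega, this.2⟩

theorem length_le_sum {α : Type*} {l : List (List α)} {a : List α} (h : a ∈ l) :
    a.length ≤ (l.map List.length).sum :=
  List.single_le_sum (by simp) _ (List.mem_map_of_mem h)

theorem polyTime_nodes : PolyTime fun F : Forest => F.fold nodesStep := by
  refine PolyTime.forestFold polyTime_nodesStep
    -- From the inside: unary numbers up to `S`, addresses paired with a truth value, lists of
    -- nodes, and the list over all trees.
    (X * (X * (X * (2 * X + 2) + 5 + 1) + 1 + 1) + 1) fun F => ?_
  simp only [eval_add, eval_mul, eval_X, eval_one, eval_ofNat]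
  set S := size F
  obtain ⟨h1, h2⟩ := fold_nodesStep_bound F le_rfl
  have hw : F.weight ≤ S := F.weight_le_size
  refine (size_le_length_mul (B := S * (S * (2 * S + 2) + 5 + 1) + 1) fun ns hns => ?_).trans
    (Nat.succ_le_succ (Nat.mul_le_mul_right _ ((F.length_fold_lt _).le.trans hw)))
  refine (size_le_length_mul (B := S * (2 * S + 2) + 5) fun z hz => ?_).trans
    (Nat.succ_le_succ (Nat.mul_le_mul_right _ ((length_le_sum hns).trans (h1.le.trans hw))))
  obtain ⟨h3, h4⟩ := h2 ns hns z hz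
  have h5 := size_le_length_mul (l := z.1) (B := 2 * S + 1) fun i hi => by
    rw [size_nat]
    have := h4 i hi
    omega
  have h6 : z.1.length * (2 * S + 1 + 1) ≤ S * (2 * S + 2) :=
    Nat.mul_le_mul_right _ (h3.le.trans hw)
  have h7 := size_bool_le z.2
  change size (z.1, z.2) ≤ _
  rw [size_pair]
  omega

/-! ### The transitions of the automaton -/

/-- The source, the input, the output and the target of a transition. -/
abbrev Trans : Type := ℕ × ℕ × List ℕ × ℕ × Unit

/-- The memory of a tree, the letters in the label of its root, and the transitions. -/
abbrev Info : Type := ℕ × List ℕ × List Trans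

/-- The letters in the set with the given characteristic word. -/
def letters (lab : List Bool) : List ℕ := (lab.zipIdx.filter fun x => x.1).map fun x => x.2

/-- The memory of a tree, where `l` lists those of the children of the root. -/
def memory (b : Bool) (l : List ℕ) : ℕ :=
  if l.isEmpty = true then 1 else if b = true then l.sum else l.foldr max 0

/-- The first state used by the child number `i`. -/
def start (b : Bool) (l : List ℕ) (i : ℕ) : ℕ := if b = true then (l.take i).sum else 0

/-- The first state used by the child that follows the child number `i`. -/
def next (b : Bool) (l : List ℕ) (i : ℕ) : ℕ :=
  if decide (i + 1 < l.length) = true then start b l (i + 1) else 0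

/-- The transitions that leave the child number `i`. -/
def leaving (L : List ℕ) (b : Bool) (l : List ℕ) (x : Info × ℕ) : List Trans :=
  (L.filter fun c => !(x.1.2.1.any fun a => c == a)).flatMap fun c =>
    (List.range x.1.1).map fun q => (start b l x.2 + q, c, [], next b l x.2, ())

/-- The transitions within the child number `i`. -/
def within (b : Bool) (l : List ℕ) (x : Info × ℕ) : List Trans :=
  x.1.2.2.map fun t => (start b l x.2 + t.1, t.2.1, x.2 :: t.2.2.1, start b l x.2 + t.2.2.2.1, ())

/-- The memory, the letters and the transitions of a tree. -/
def infoStep (x : Bool × List Bool × List Info) : Info :=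
  (memory x.1 (x.2.2.map fun y => y.1), letters x.2.1,
    if x.2.2.isEmpty = true then (letters x.2.1).map fun c => (0, c, [], 0, ())
    else x.2.2.zipIdx.flatMap fun y =>
      leaving (letters x.2.1) x.1 (x.2.2.map fun y => y.1) y ++
        within x.1 (x.2.2.map fun y => y.1) y)

section

variable {σ : Type} [Code σ]

theorem polyTime_letters {f : σ → List Bool} (hf : PolyTime f) : PolyTime fun s => letters (f s) :=
  (hf.zipIdx.filter (c := fun x : σ × Bool × ℕ => x.2.1) PolyTime.id.snd.fst).map
    (g := fun x : σ × Bool × ℕ => x.2.2)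
    PolyTime.id.snd.snd

theorem polyTime_memory {f : σ → Bool} {g : σ → List ℕ} (hf : PolyTime f) (hg : PolyTime g) :
    PolyTime fun s => memory (f s) (g s) :=
  hg.isEmpty.cond (PolyTime.const 1) (hf.cond hg.sum hg.foldrMax)

theorem polyTime_start {f : σ → Bool} {g : σ → List ℕ} {h : σ → ℕ} (hf : PolyTime f)
    (hg : PolyTime g) (hh : PolyTime h) : PolyTime fun s => start (f s) (g s) (h s) :=
  hf.cond (hh.take hg).sum (PolyTime.const 0)

theorem polyTime_next {f : σ → Bool} {g : σ → List ℕ} {h : σ → ℕ} (hf : PolyTime f)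
    (hg : PolyTime g) (hh : PolyTime h) : PolyTime fun s => next (f s) (g s) (h s) :=
  (hh.succ.natLt hg.length).cond (polyTime_start hf hg hh.succ) (PolyTime.const 0)

theorem polyTime_leaving {L : σ → List ℕ} {f : σ → Bool} {g : σ → List ℕ} {h : σ → Info × ℕ}
    (hL : PolyTime L) (hf : PolyTime f) (hg : PolyTime g) (hh : PolyTime h) :
    PolyTime fun s => leaving (L s) (f s) (g s) (h s) := by
  have h1 : PolyTime fun x : σ × ℕ => !((h x.1).1.2.1.any fun a => x.2 == a) :=
    (PolyTime.id.snd.elem (hh.fst.snd.fst.comp PolyTime.id.fst)).not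
  have i : PolyTime fun x : (σ × ℕ) × ℕ => x.1.1 := PolyTime.id.fst.fst
  exact (hL.filter h1).flatMap ((hh.fst.fst.comp PolyTime.id.fst).range.map
    (g := fun x => (start (f x.1.1) (g x.1.1) (h x.1.1).2 + x.2, x.1.2, ([] : List ℕ),
      next (f x.1.1) (g x.1.1) (h x.1.1).2, ()))
    (((polyTime_start (hf.comp i) (hg.comp i) (hh.snd.comp i)).add PolyTime.id.snd).pair
      (PolyTime.id.fst.snd.pair ((PolyTime.const []).pair
        ((polyTime_next (hf.comp i) (hg.comp i) (hh.snd.comp i)).pair (PolyTime.const ()))))))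

theorem polyTime_within {f : σ → Bool} {g : σ → List ℕ} {h : σ → Info × ℕ}
    (hf : PolyTime f) (hg : PolyTime g) (hh : PolyTime h) :
    PolyTime fun s => within (f s) (g s) (h s) := by
  have i : PolyTime fun x : σ × Trans => x.1 := PolyTime.id.fst
  have hs := polyTime_start (hf.comp i) (hg.comp i) (hh.snd.comp i)
  exact hh.fst.snd.snd.map
    (g := fun x => (start (f x.1) (g x.1) (h x.1).2 + x.2.1, x.2.2.1, (h x.1).2 :: x.2.2.2.1,
      start (f x.1) (g x.1) (h x.1).2 + x.2.2.2.2.1, ()))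
    ((hs.add PolyTime.id.snd.fst).pair (PolyTime.id.snd.snd.fst.pair
      (((hh.snd.comp i).listCons PolyTime.id.snd.snd.snd.fst).pair
        ((hs.add PolyTime.id.snd.snd.snd.snd.fst).pair (PolyTime.const ())))))

theorem polyTime_infoStep : PolyTime infoStep := by
  have hL : PolyTime fun x : Bool × List Bool × List Info => letters x.2.1 :=
    polyTime_letters PolyTime.id.snd.fst
  have hm : PolyTime fun x : Bool × List Bool × List Info => x.2.2.map fun y => y.1 :=
    PolyTime.id.snd.snd.map (g := fun x : _ × Info => x.2.1) PolyTime.id.snd.fst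
  have hb : PolyTime fun x : Bool × List Bool × List Info => x.1 := PolyTime.id.fst
  have i : PolyTime fun x : (Bool × List Bool × List Info) × Info × ℕ => x.1 := PolyTime.id.fst
  refine (polyTime_memory hb hm).pair (hL.pair (PolyTime.id.snd.snd.isEmpty.cond
    (hL.map (g := fun x => (0, x.2, [], 0, ())) ?_)
    (PolyTime.id.snd.snd.zipIdx.flatMap
      ((polyTime_leaving (hL.comp i) (hb.comp i) (hm.comp i) PolyTime.id.snd).append
        (polyTime_within (hb.comp i) (hm.comp i) PolyTime.id.snd)))))
  exact (PolyTime.const 0).pair (PolyTime.id.snd.pair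
    ((PolyTime.const []).pair ((PolyTime.const 0).pair (PolyTime.const ()))))

end

end Forest

/-! ### Size bounds for the bottom-up computation of the transitions -/

namespace Forest

theorem sum_take_le (l : List ℕ) (i : ℕ) : (l.take i).sum ≤ l.sum := by
  conv_rhs => rw [← List.take_append_drop i l, List.sum_append]
  exact Nat.le_add_right _ _

theorem start_le (b : Bool) (l : List ℕ) (i : ℕ) : start b l i ≤ l.sum := by
  rw [start]
  split_ifs
  · exact sum_take_le l i
  · exact Nat.zero_le _

theorem next_le (b : Bool) (l : List ℕ) (i : ℕ) : next b l i ≤ l.sum := by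
  rw [next]
  split_ifs
  · exact start_le b l _
  · exact Nat.zero_le _

theorem memory_le (b : Bool) (l : List ℕ) : memory b l ≤ l.sum + 1 := by
  rw [memory]
  split_ifs
  · exact Nat.le_add_left _ _
  · exact Nat.le_succ _
  · refine Nat.le_succ_of_le ?_
    induction l with
    | nil => exact le_rfl
    | cons a l ih =>
      simp only [List.foldr_cons, List.sum_cons]
      by_cases h : l.isEmpty = true
      · rw [List.isEmpty_iff.1 h]
        simp
      · have := ih h
        omega

theorem mem_letters {lab : List Bool} {c : ℕ} : c ∈ letters lab ↔ lab[c]? = some true := by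
  simp only [letters, List.mem_map, List.mem_filter]
  constructor
  · rintro ⟨⟨b, i⟩, ⟨h, hb⟩, rfl⟩
    obtain rfl : b = true := hb
    exact List.mk_mem_zipIdx_iff_getElem?.1 h
  · exact fun h => ⟨(true, c), ⟨List.mk_mem_zipIdx_iff_getElem?.2 h, rfl⟩, rfl⟩

theorem lt_length_of_mem_letters {lab : List Bool} {c : ℕ} (h : c ∈ letters lab) :
    c < lab.length :=
  (List.getElem?_eq_some_iff.1 (mem_letters.1 h)).1

theorem length_letters_le (lab : List Bool) : (letters lab).length ≤ lab.length := by
  rw [letters, List.length_map]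
  exact (List.length_filter_le _ _).trans (List.length_zipIdx).le

theorem length_leaving_le (L : List ℕ) (b : Bool) (l : List ℕ) (x : Info × ℕ) :
    (leaving L b l x).length ≤ L.length * x.1.1 := by
  simp only [leaving, List.length_flatMap, List.length_map, List.length_range, List.map_const',
    List.sum_replicate, smul_eq_mul]
  exact Nat.mul_le_mul_right _ (List.length_filter_le _ _)

/-- The new transitions at a node number at most letters times the sum of the children's memories,
so at most `S * S`, and the others are copies of those of its subtrees. A shift of the states is at
most the sum of the children's memories. Both effects accumulate only linearly in the number of
nodes. -/
theorem fold_infoStep_bound {S : ℕ} (F : Forest) (hF : size F ≤ S) :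
    ((F.fold infoStep).map fun x => x.1).sum < F.weight ∧
      ((F.fold infoStep).map fun x => x.2.2.length).sum ≤ S * S * F.weight ∧
      ∀ x ∈ F.fold infoStep, (x.2.1.length ≤ S ∧ ∀ c ∈ x.2.1, c ≤ S) ∧
        ∀ t ∈ x.2.2, t.1 ≤ S * F.weight ∧ t.2.1 ≤ S ∧
          (t.2.2.1.length < F.weight ∧ ∀ i ∈ t.2.2.1, i ≤ S) ∧ t.2.2.2.1 ≤ S * F.weight := by
  induction F with
  | nil => simp [fold, weight]
  | cons b lab ch r h1 h2 =>
    simp only [size_cons, size_pair] at hF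
    obtain ⟨h1, h1', h1''⟩ := h1 (by omega)
    obtain ⟨h2, h2', h2''⟩ := h2 (by omega)
    have hch := ch.weight_le_size
    have hlab := two_mul_length_lt_size lab
    have hL := length_letters_le lab
    have hkids := length_fold_lt infoStep ch
    have hst := start_le b ((fold infoStep ch).map fun x => x.1)
    have hnx := next_le b ((fold infoStep ch).map fun x => x.1)
    have hW : S * (ch.weight + r.weight + 1) = S * ch.weight + S * r.weight + S := by ring
    have hW2 : S * S * (ch.weight + r.weight + 1) =
      S * S * ch.weight + S * S * r.weight + S * S := by ring
    simp only [weight]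
    refine ⟨?_, ?_, fun x hx => ?_⟩
    · have := memory_le b ((fold infoStep ch).map fun x => x.1)
      simp only [fold, infoStep, List.map_cons, List.sum_cons]
      omega
    · have h3 : (infoStep (b, lab, fold infoStep ch)).2.2.length ≤
          S * S + ((fold infoStep ch).map fun x => x.2.2.length).sum := by
        simp only [infoStep]
        split_ifs
        · rw [List.length_map]
          have : S * 1 ≤ S * S := Nat.mul_le_mul_left _ (by omega)
          omega
        · have h4 := length_flatMap_zipIdx_le (fold infoStep ch)
            (fun y => leaving (letters lab) b ((fold infoStep ch).map fun y => y.1) y ++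
              within b ((fold infoStep ch).map fun y => y.1) y)
            (fun x => (letters lab).length * x.1 + x.2.2.length) (fun x _ i => by
              have := length_leaving_le (letters lab) b ((fold infoStep ch).map fun y => y.1) (x, i)
              change _ ≤ (letters lab).length * x.1 at this
              simp only [List.length_append, within, List.length_map]
              omega)
          have h6 : ((fold infoStep ch).map fun x => (letters lab).length * x.1 + x.2.2.length).sum =
              (letters lab).length * ((fold infoStep ch).map fun x => x.1).sum +
                ((fold infoStep ch).map fun x => x.2.2.length).sum := by
            rw [List.sum_map_add, List.sum_map_mul_left]
          have h5 : (letters lab).length * ((fold infoStep ch).map fun x => x.1).sum ≤ S * S :=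
            Nat.mul_le_mul (by omega) (by omega)
          omega
      simp only [fold, List.map_cons, List.sum_cons]
      omega
    · simp only [fold, List.mem_cons] at hx
      rcases hx with rfl | hx
      · refine ⟨⟨by simp only [infoStep]; omega, fun c hc => ?_⟩, fun t ht => ?_⟩
        · have : c < lab.length := lt_length_of_mem_letters hc
          omega
        · simp only [infoStep] at ht
          split_ifs at ht
          · obtain ⟨c, hc, rfl⟩ := List.mem_map.1 ht
            have := lt_length_of_mem_letters hc
            simp only [List.length_nil, List.not_mem_nil, false_implies, implies_true, and_true]
            omega
          · obtain ⟨y, hy, ht⟩ := List.mem_flatMap.1 ht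
            obtain ⟨hy1, hy2⟩ := mem_zipIdx_zero hy
            have hst := hst y.2
            have hnx := hnx y.2
            have hS1 : ch.weight ≤ S * ch.weight := Nat.le_mul_of_pos_left _ (by omega)
            rcases List.mem_append.1 ht with ht | ht
            · simp only [leaving, List.mem_flatMap, List.mem_filter, List.mem_map,
                List.mem_range] at ht
              obtain ⟨c, ⟨hc, -⟩, q, hq, rfl⟩ := ht
              have := lt_length_of_mem_letters hc
              have hm : y.1.1 ≤ ((fold infoStep ch).map fun x => x.1).sum :=
                List.single_le_sum (by simp) _ (List.mem_map_of_mem hy1)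
              simp only [List.length_nil, List.not_mem_nil, false_implies, implies_true, and_true]
              omega
            · obtain ⟨t', ht', rfl⟩ := List.mem_map.1 ht
              obtain ⟨h3, h4, ⟨h5, h6⟩, h7⟩ := (h1'' _ hy1).2 t' ht'
              simp only [List.length_cons, List.mem_cons]
              refine ⟨by omega, h4, ⟨by omega, ?_⟩, by omega⟩
              rintro i (rfl | hi)
              · omega
              · exact h6 i hi
      · refine ⟨(h2'' x hx).1, fun t ht => ?_⟩
        obtain ⟨h3, h4, ⟨h5, h6⟩, h7⟩ := (h2'' x hx).2 t ht
        exact ⟨by omega, h4, ⟨by omega, h6⟩, by omega⟩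

theorem size_list_nat_le {l : List ℕ} {S : ℕ} (h1 : l.length ≤ S) (h2 : ∀ i ∈ l, i ≤ S) :
    size l ≤ S * (2 * S + 2) + 1 :=
  (size_le_length_mul (B := 2 * S + 1) fun i hi => by
    rw [size_nat]
    have := h2 i hi
    omega).trans (Nat.succ_le_succ (Nat.mul_le_mul_right _ h1))

theorem polyTime_info : PolyTime fun F : Forest => F.fold infoStep := by
  refine PolyTime.forestFold polyTime_infoStep
    (X * (2 * X + (X * (2 * X + 2) + 1) +
      (X * X * X * (2 * (X * X) + 2 * X + (X * (2 * X + 2) + 1) + 2 * (X * X) + 8 + 1) + 1) + 3 + 1) +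
      1) fun F => ?_
  simp only [eval_add, eval_mul, eval_X, eval_one, eval_ofNat]
  set S := size F
  obtain ⟨h1, h2, h3⟩ := fold_infoStep_bound (S := S) F le_rfl
  have hw : F.weight ≤ S := F.weight_le_size
  have hSw : S * F.weight ≤ S * S := Nat.mul_le_mul_left _ hw
  have hSSw : S * S * F.weight ≤ S * S * S := Nat.mul_le_mul_left _ hw
  refine (size_le_length_mul fun x hx => ?_).trans
    (Nat.succ_le_succ (Nat.mul_le_mul_right _ ((F.length_fold_lt _).le.trans hw)))
  obtain ⟨h4, h5⟩ := h3 x hx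
  have hm : x.1 ≤ ((F.fold infoStep).map fun x => x.1).sum :=
    List.single_le_sum (by simp) _ (List.mem_map_of_mem hx)
  have hlen : x.2.2.length ≤ ((F.fold infoStep).map fun x => x.2.2.length).sum :=
    List.single_le_sum (by simp) _ (List.mem_map_of_mem (f := fun x : Info => x.2.2.length) hx)
  have hL := size_list_nat_le h4.1 h4.2
  have ht := size_le_length_mul (l := x.2.2)
    (B := 2 * (S * S) + 2 * S + (S * (2 * S + 2) + 1) + 2 * (S * S) + 8) fun t ht => by
      obtain ⟨h6, h7, h8, h9⟩ := h5 t ht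
      have h10 := size_list_nat_le (h8.1.le.trans hw) h8.2
      change size (t.1, t.2.1, t.2.2.1, t.2.2.2.1, ()) ≤ _
      simp only [size_pair, size_nat, size_unit]
      omega
  have ht' := Nat.mul_le_mul_right
    (2 * (S * S) + 2 * S + (S * (2 * S + 2) + 1) + 2 * (S * S) + 8 + 1)
    (hlen.trans (h2.trans hSSw))
  change size (x.1, x.2.1, x.2.2) ≤ _
  rw [size_pair, size_pair, size_nat]
  omega

/-! ### The automaton -/

/-- The states, the initial states, the transitions and the Rabin pairs of an automaton. -/
abbrev RabinData : Type :=
  List ℕ × List ℕ × List Trans × List (List (List ℕ) × List (List ℕ)) × Unit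

/-- The Rabin pairs of a tree with the given nodes. -/
def pairs (ns : List (List ℕ × Bool)) : List (List (List ℕ) × List (List ℕ)) :=
  (ns.filter fun n => n.2).map fun n =>
    ([n.1], (ns.filter fun m => !(n.1.isPrefixOf m.1)).map fun m => m.1)

/-- The Rabin automaton of a tree. -/
def rabinData (F : Forest) : RabinData :=
  (List.range ((F.fold infoStep).map fun x => x.1).sum, [0],
    (F.fold infoStep).flatMap fun x => x.2.2, pairs (F.fold nodesStep).flatten, ())

theorem polyTime_pairs : PolyTime pairs := by
  refine (PolyTime.id.filter (c := fun x : _ × List ℕ × Bool => x.2.2) PolyTime.id.snd.snd).map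
    (g := fun x : List (List ℕ × Bool) × List ℕ × Bool =>
      ([x.2.1], (x.1.filter fun m => !(x.2.1.isPrefixOf m.1)).map fun m => m.1))
    ((PolyTime.id.snd.fst.listCons (PolyTime.const [])).pair ?_)
  exact (PolyTime.id.fst.filter
      (c := fun y : (List (List ℕ × Bool) × List ℕ × Bool) × List ℕ × Bool =>
        !(y.1.2.1.isPrefixOf y.2.1))
      (PolyTime.id.fst.snd.fst.isPrefix PolyTime.id.snd.fst).not).map
    (g := fun y : _ × List ℕ × Bool => y.2.1) PolyTime.id.snd.fst

theorem polyTime_rabinData : PolyTime rabinData :=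
  (polyTime_info.map (g := fun x : _ × Info => x.2.1) PolyTime.id.snd.fst).sum.range.pair
    ((PolyTime.const [0]).pair
      ((polyTime_info.flatMap (g := fun x : _ × Info => x.2.2.2) PolyTime.id.snd.snd.snd).pair
        ((polyTime_pairs.comp polyTime_nodes.flatten).pair (PolyTime.const ()))))

/-- The forest that consists of a single tree. -/
def ofRoot (t : Root) : Forest := cons t.1 t.2.1 t.2.2.1 nil

theorem polyTime_ofRoot : PolyTime ofRoot :=
  (PolyTime.of_enc_eq (f := fun x : Root × Unit => ofRoot x.1) fun _ => rfl).comp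
    (PolyTime.id.pair (PolyTime.const ()))

end Forest

/-- A function that is computable in polynomial time is computed by a program. -/
theorem PolyTime.exists_program {α β : Type} [Code α] [Code β] {f : α → β} (hf : PolyTime f) :
    ∃ (P : Program) (p : ℕ[X]), ∀ a, ∃ t, P.Computes (enc a) (enc (f a)) t ∧ t ≤ p.eval (size a) := by
  obtain ⟨p, h⟩ := hf
  obtain ⟨R, k, h⟩ := h 1
  refine ⟨[.call k .arg] ++ R, X + p + 1, fun a => ?_⟩
  obtain ⟨t, h1, h2⟩ := (h [.call k .arg] rfl).call (a := a) .arg le_rfl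
  refine ⟨t, ⟨_, rfl, h1⟩, h2.trans ?_⟩
  simp only [eval_add, eval_X, eval_one]
  exact le_rfl

/-! ### Translation of Zielonka trees into forests -/

namespace ZTree

universe u

variable {Γ : Type u} {N : ℕ} (e : Γ ≃ Fin N) {β : Type}

open Classical in
/-- The characteristic word of a set. -/
noncomputable def word (X : Set Γ) : List Bool := List.ofFn fun j => decide (e.symm j ∈ X)

/-- The tree is put in front of a forest. -/
noncomputable def toForest : ZTree Γ → Forest → Forest
  | node lab b _ ch => fun r =>
    .cons b (word e lab) ((List.ofFn fun i => toForest (ch i)).foldr (fun f F => f F) .nil) r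

/-- The root of the tree, and the forest below it. -/
noncomputable def toRoot : ZTree Γ → Forest.Root
  | node lab b _ ch =>
    (b, word e lab, (List.ofFn fun i => toForest e (ch i)).foldr (fun f F => f F) .nil, ())

/-- The value of a tree computed bottom-up by `g`. -/
noncomputable def value (g : Bool × List Bool × List β → β) : ZTree Γ → β
  | node lab b _ ch => g (b, word e lab, List.ofFn fun i => value g (ch i))

theorem ofRoot_toRoot (T : ZTree Γ) : Forest.ofRoot (T.toRoot e) = T.toForest e .nil := by
  obtain ⟨lab, b, k, ch⟩ := T
  simp only [toRoot, toForest, Forest.ofRoot]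

theorem fold_toForest (g : Bool × List Bool × List β → β) (T : ZTree Γ) (r : Forest) :
    (T.toForest e r).fold g = T.value e g :: r.fold g := by
  induction T generalizing r with
  | node lab b k ch ih =>
    have key : ∀ {m : ℕ} (f : Fin m → Forest → Forest) (v : Fin m → β),
        (∀ i r, (f i r).fold g = v i :: r.fold g) →
        ((List.ofFn f).foldr (fun f F => f F) Forest.nil).fold g = List.ofFn v := by
      intro m
      induction m with
      | zero => intro f v _; simp [Forest.fold]
      | succ m ihm =>
        intro f v h
        rw [List.ofFn_succ, List.ofFn_succ, List.foldr_cons, h,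
          ihm (fun i => f i.succ) (fun i => v i.succ) fun i r => h _ r]
    simp only [toForest, value, Forest.fold]
    rw [key _ _ ih]

theorem enc_bool (p : Prop) [Decidable p] : enc (decide p) = Data.ofProp p := by
  by_cases h : p <;> simp [enc, Data.ofProp, h]

theorem enc_word (X : Set Γ) :
    enc (word e X) = Data.ofList (List.ofFn fun j : Fin N => Data.ofProp (e.symm j ∈ X)) := by
  classical
  simp only [word]
  change Data.ofList (List.map enc _) = _
  rw [List.map_ofFn]
  congr 2
  funext j
  exact enc_bool _

theorem enc_foldr {m : ℕ} (f : Fin m → Forest → Forest) (v : Fin m → Data)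
    (h : ∀ i r, enc (f i r) = .cons (v i) (enc r)) :
    enc ((List.ofFn f).foldr (fun f F => f F) Forest.nil) = Data.ofList (List.ofFn v) := by
  induction m with
  | zero => simp [enc, Forest.enc, Data.ofList]
  | succ m ihm =>
    rw [List.ofFn_succ, List.ofFn_succ, List.foldr_cons, h,
      ihm (fun i => f i.succ) (fun i => v i.succ) fun i r => h _ r]
    rfl

theorem enc_toForest (T : ZTree Γ) (r : Forest) :
    enc (T.toForest e r) = .cons (T.encode e) (enc r) := by
  induction T generalizing r with
  | node lab b k ch ih =>
    have h1 := enc_foldr (fun i => (ch i).toForest e) _ ih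
    have h2 := enc_bool (b = true)
    rw [Bool.decide_eq_true] at h2
    simp only [toForest, encode, ← h1, ← enc_word, ← h2, Data.ofList]
    rfl

/-- The programs on forests thus run directly on the prescribed encoding of the tree, without any
parsing. -/
theorem enc_toRoot (T : ZTree Γ) : enc (T.toRoot e) = T.encode e := by
  have h : enc (Forest.ofRoot (T.toRoot e)) = .cons (T.encode e) (enc Forest.nil) := by
    rw [ofRoot_toRoot, enc_toForest]
  exact (Data.cons.inj h).1

theorem zipIdx_ofFn {α : Type*} {m : ℕ} (f : Fin m → α) :
    (List.ofFn f).zipIdx = List.ofFn fun i => (f i, (i : ℕ)) := by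
  apply List.ext_getElem <;> simp

theorem mem_letters_word {X : Set Γ} {c : ℕ} :
    c ∈ Forest.letters (word e X) ↔ ∃ γ ∈ X, (e γ : ℕ) = c := by
  rw [Forest.mem_letters, List.getElem?_eq_some_iff]
  simp only [word, List.length_ofFn, List.getElem_ofFn, decide_eq_true_eq]
  constructor
  · rintro ⟨h, h'⟩
    exact ⟨_, h', by simp⟩
  · rintro ⟨γ, h, rfl⟩
    exact ⟨(e γ).2, by simpa using h⟩

/-! ### The nodes -/

theorem mem_value_nodesStep {T : ZTree Γ} {p : List ℕ} {r : Bool} :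
    (p, r) ∈ T.value e Forest.nodesStep ↔ ∃ t, T.sub p = some t ∧ t.rootRound = r := by
  induction T generalizing p with
  | node lab b k ch ih =>
    simp only [value, Forest.nodesStep, zipIdx_ofFn, List.mem_cons, List.mem_flatMap, List.mem_ofFn,
      List.mem_map]
    cases p with
    | nil => simp [sub_nil, rootRound, eq_comm]
    | cons i p =>
      constructor
      · rintro (h | ⟨_, ⟨j, rfl⟩, ⟨q, s⟩, hz, h⟩)
        · simp at h
        · simp only [Prod.mk.injEq, List.cons.injEq] at h
          obtain ⟨⟨rfl, rfl⟩, rfl⟩ := h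
          rw [sub_cons j.2]
          exact (ih j).1 hz
      · rintro ⟨t, h1, h2⟩
        obtain ⟨hi, h1⟩ := exists_of_sub_cons h1
        exact Or.inr ⟨_, ⟨⟨i, hi⟩, rfl⟩, (p, r), (ih _).2 ⟨t, h1, h2⟩, rfl⟩

theorem nodup_value_nodesStep (T : ZTree Γ) :
    ((T.value e Forest.nodesStep).map fun n => n.1).Nodup := by
  induction T with
  | node lab b k ch ih =>
    simp only [value, Forest.nodesStep, zipIdx_ofFn, List.map_cons, List.nodup_cons,
      List.map_flatMap, List.map_map]
    constructor
    · simp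
    · rw [List.nodup_flatMap]
      constructor
      · intro y hy
        obtain ⟨i, rfl⟩ := List.mem_ofFn.1 hy
        have := (ih i).map (f := fun p => (i : ℕ) :: p) (fun p q h => (List.cons.inj h).2)
        rwa [List.map_map] at this
      · rw [List.pairwise_ofFn]
        intro i j hij
        simp only [Function.onFun, List.disjoint_left, List.mem_map]
        rintro _ ⟨z, -, rfl⟩ ⟨z', -, h⟩
        have := (List.cons.inj h).1
        omega

/-! ### The transitions -/

theorem foldr_max_ofFn {m : ℕ} (f : Fin m → ℕ) :
    (List.ofFn f).foldr max 0 = Finset.univ.sup f := by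
  refine eq_of_forall_ge_iff fun a => ?_
  have : ∀ l : List ℕ, l.foldr max 0 ≤ a ↔ ∀ x ∈ l, x ≤ a := fun l => by
    induction l with
    | nil => simp
    | cons x l ih => simp [ih]
  rw [this]
  simp [List.mem_ofFn]

theorem sum_take_ofFn {m : ℕ} (f : Fin m → ℕ) {i : ℕ} (hi : i ≤ m) :
    ((List.ofFn f).take i).sum = offset f i := by
  induction i with
  | zero => simp [offset_zero]
  | succ i ih =>
    rw [List.sum_take_succ _ _ (by simpa using hi), ih (by omega), List.getElem_ofFn]
    exact (offset_succ f ⟨i, hi⟩).symm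

theorem memory_ofFn (lab : Set Γ) (b : Bool) {k : ℕ} (ch : Fin k → ZTree Γ) :
    Forest.memory b (List.ofFn fun i => (ch i).memory) = (node lab b k ch).memory := by
  rw [Forest.memory, memory]
  by_cases hk : k = 0
  · subst hk
    simp
  · rw [if_neg (by rw [List.isEmpty_iff, List.ofFn_eq_nil_iff]; exact hk), if_neg hk, List.sum_ofFn,
      foldr_max_ofFn]

theorem value_infoStep_fst (T : ZTree Γ) : (T.value e Forest.infoStep).1 = T.memory := by
  induction T with
  | node lab b k ch ih =>
    simp only [value, Forest.infoStep, List.map_ofFn]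
    rw [← memory_ofFn]
    congr 2
    funext i
    exact ih i

theorem value_infoStep_letters (T : ZTree Γ) :
    (T.value e Forest.infoStep).2.1 = Forest.letters (word e T.rootLabel) := by
  obtain ⟨lab, b, k, ch⟩ := T
  simp only [value, Forest.infoStep, rootLabel]

/-- From one of the states of the child number `i` of the root, read a letter that is not in its
label, and go to the first state of the next child; in a leaf, stay where you are. -/
inductive RootStep (T : ZTree Γ) (γ : Γ) (q q' : ℕ) : Prop
  | leaf (hk : T.rootArity = 0) (hγ : γ ∈ T.rootLabel) (hq : q = 0) (hq' : q' = 0) : RootStep T γ q q'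
  | child (i : ℕ) (t : ZTree Γ) (ht : T.sub [i] = some t) (hγ : γ ∈ T.rootLabel)
    (hγ' : γ ∉ t.rootLabel) (hq : T.number [i] ≤ q) (hq' : q < T.number [i] + t.memory)
    (h : q' = T.number [(i + 1) % T.rootArity]) : RootStep T γ q q'

theorem start_ofFn (lab : Set Γ) (b : Bool) {k : ℕ} (ch : Fin k → ZTree Γ) (i : Fin k) :
    Forest.start b (List.ofFn fun i => (ch i).memory) i = (node lab b k ch).number [(i : ℕ)] := by
  rw [number_cons, number_nil, add_zero, Forest.start, sum_take_ofFn _ i.2.le]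

theorem next_ofFn (lab : Set Γ) (b : Bool) {k : ℕ} (ch : Fin k → ZTree Γ) (i : Fin k) :
    Forest.next b (List.ofFn fun i => (ch i).memory) i =
      (node lab b k ch).number [((i : ℕ) + 1) % k] := by
  have hi := i.2
  rw [Forest.next, List.length_ofFn]
  by_cases h : (i : ℕ) + 1 < k
  · rw [if_pos (by simpa using h), Nat.mod_eq_of_lt h]
    exact start_ofFn lab b ch ⟨i + 1, h⟩
  · rw [if_neg (by simpa using h), show (i : ℕ) + 1 = k by omega, Nat.mod_self]
    have := start_ofFn lab b ch ⟨0, by omega⟩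
    rw [← this]
    simp [Forest.start]

/-- A transition is created at the node that it outputs, in the states local to that subtree. On its
way to the root it is shifted by the first states of the children passed, which add up to the number
of the address. -/
theorem mem_value_infoStep {T : ZTree Γ} {q q' c : ℕ} {p : List ℕ} :
    (q, c, p, q', ()) ∈ (T.value e Forest.infoStep).2.2 ↔
      ∃ γ t x x', (e γ : ℕ) = c ∧ T.sub p = some t ∧ RootStep t γ x x' ∧
        q = T.number p + x ∧ q' = T.number p + x' := by
  induction T generalizing q q' p with
  | node lab b k ch ih =>
    have hmem : (List.map (fun y => y.1) (List.ofFn fun i => value e Forest.infoStep (ch i))) =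
        List.ofFn fun i => (ch i).memory := by
      rw [List.map_ofFn]
      congr 1
      funext i
      exact value_infoStep_fst e _
    simp only [value, Forest.infoStep, hmem]
    by_cases hk : k = 0
    · rw [if_pos (by rw [List.isEmpty_iff, List.ofFn_eq_nil_iff]; exact hk)]
      simp only [List.mem_map, mem_letters_word, Prod.mk.injEq]
      constructor
      · rintro ⟨_, ⟨γ, hγ, rfl⟩, rfl, rfl, rfl, rfl, -⟩
        exact ⟨γ, _, 0, 0, rfl, sub_nil _, .leaf hk hγ rfl rfl, by simp [number_nil],
          by simp [number_nil]⟩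
      · rintro ⟨γ, t, x, x', rfl, ht, h, rfl, rfl⟩
        cases p with
        | cons i p =>
          obtain ⟨hi, -⟩ := exists_of_sub_cons ht
          omega
        | nil =>
          obtain rfl := Option.some.inj ((sub_nil _).symm.trans ht)
          rcases h with ⟨-, hγ, rfl, rfl⟩ | ⟨i, t, ht, -⟩
          · exact ⟨_, ⟨γ, hγ, rfl⟩, by simp [number_nil]⟩
          · obtain ⟨hi, -⟩ := exists_of_sub_cons ht
            omega
    · rw [if_neg (by rw [List.isEmpty_iff, List.ofFn_eq_nil_iff]; exact hk)]
      simp only [zipIdx_ofFn, List.mem_flatMap, List.mem_ofFn, List.mem_append]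
      constructor
      · rintro ⟨_, ⟨i, rfl⟩, h | h⟩
        · simp only [Forest.leaving, List.mem_flatMap, List.mem_filter, List.mem_map,
            List.mem_range, mem_letters_word, value_infoStep_letters, value_infoStep_fst,
            start_ofFn lab, next_ofFn lab, Prod.mk.injEq] at h
          obtain ⟨c, ⟨⟨γ, hγ, hc⟩, h1⟩, x, hx, rfl, rfl, rfl, rfl, -⟩ := h
          refine ⟨γ, _, _, _, hc, sub_nil _, .child i (ch i) (by rw [sub_cons i.2, sub_nil]) hγ
            (fun hγ' => ?_) (Nat.le_add_right _ _) (Nat.add_lt_add_left hx _) rfl,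
            by simp [number_nil], by simp [number_nil, rootArity]⟩
          have : c ∈ Forest.letters (word e (ch i).rootLabel) :=
            (mem_letters_word e).2 ⟨γ, hγ', hc⟩
          simp only [Bool.not_eq_eq_eq_not, Bool.not_true, List.any_eq_false, beq_iff_eq] at h1
          exact h1 _ this rfl
        · simp only [Forest.within, List.mem_map, start_ofFn lab] at h
          obtain ⟨⟨y, d, a, y', u⟩, ht, h⟩ := h
          simp only [Prod.mk.injEq] at h
          obtain ⟨rfl, rfl, rfl, rfl, -⟩ := h
          obtain ⟨γ, t, x, x', h1, h2, h3, rfl, rfl⟩ := (ih i).1 ht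
          have h4 := number_append (T := node lab b k ch) (p := [(i : ℕ)]) (t := ch i)
            (by rw [sub_cons i.2, sub_nil]) a
          rw [List.singleton_append] at h4
          exact ⟨γ, t, x, x', h1, by rw [sub_cons i.2, h2], h3, by rw [h4]; omega,
            by rw [h4]; omega⟩
      · rintro ⟨γ, t, x, x', rfl, ht, h, rfl, rfl⟩
        cases p with
        | nil =>
          obtain rfl := Option.some.inj ((sub_nil _).symm.trans ht)
          rcases h with ⟨hk', -⟩ | ⟨i, t, ht, hγ, hγ', h1, h2, rfl⟩
          · exact absurd hk' hk
          · obtain ⟨hi, ht⟩ := exists_of_sub_cons ht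
            obtain rfl := Option.some.inj ((sub_nil _).symm.trans ht)
            refine ⟨_, ⟨⟨i, hi⟩, rfl⟩, Or.inl ?_⟩
            simp only [Forest.leaving, List.mem_flatMap, List.mem_filter, List.mem_map,
              List.mem_range, mem_letters_word, value_infoStep_letters, value_infoStep_fst,
              Prod.mk.injEq]
            have h3 := start_ofFn lab b ch ⟨i, hi⟩
            have h4 := next_ofFn lab b ch ⟨i, hi⟩
            simp only at h3 h4
            refine ⟨e γ, ⟨⟨γ, hγ, rfl⟩, ?_⟩, x - (node lab b k ch).number [i], by omega, ?_, rfl,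
              trivial, ?_, trivial⟩
            · simp only [Bool.not_eq_eq_eq_not, Bool.not_true, List.any_eq_false, beq_iff_eq]
              intro d hd hed
              obtain ⟨γ', h5, rfl⟩ := (mem_letters_word e).1 hd
              rw [e.injective (Fin.ext hed)] at hγ'
              exact hγ' h5
            · rw [h3, number_nil]
              omega
            · rw [h4, number_nil, zero_add]
              rfl
        | cons i p =>
          obtain ⟨hi, ht⟩ := exists_of_sub_cons ht
          refine ⟨_, ⟨⟨i, hi⟩, rfl⟩, Or.inr ?_⟩
          have h3 := start_ofFn lab b ch ⟨i, hi⟩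
          have h4 := number_append (T := node lab b k ch) (p := [i]) (t := ch ⟨i, hi⟩)
            (by rw [sub_cons hi, sub_nil]) p
          rw [List.singleton_append] at h4
          simp only [Forest.within, List.mem_map]
          simp only at h3
          refine ⟨_, (ih ⟨i, hi⟩).2 ⟨γ, t, x, x', rfl, ht, h, rfl, rfl⟩, ?_⟩
          simp only [h3, h4, add_assoc]

end ZTree

/-! ### Correctness of the computed automaton -/

namespace ZTree

universe u

variable {Γ : Type u} {T : ZTree Γ}

theorem number_child (n : T.Node) (i : ℕ) :
    T.number (n.1 ++ [i]) = T.number n.1 + n.subtree.number [i] := number_append n.sub_eq _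

/-- The leftmost leaf in the jump from a leaf below the child number `i`. -/
theorem number_of_isLeftmost_jump {n : T.Node} {l l' : T.Leaf} {i : ℕ} (hi : l.BelowChild n i)
    (h : IsLeftmost (jump n l) l') :
    T.number l'.1.1 = T.number n.1 + n.subtree.number [(i + 1) % n.arity] := by
  have hlt := Leaf.lt_arity hi
  have hj : (i + 1) % n.arity < n.arity := Nat.mod_lt _ (by omega)
  rw [← number_child]
  refine number_of_isLeftmost (n := n.child _ hj) ⟨?_, fun m hm => h.2 m (Or.inr ⟨i, hi, hm⟩)⟩
  rcases h.1 with ⟨rfl, -⟩ | ⟨j, h1, h2⟩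
  · have := l.2
    omega
  · obtain rfl := hi.unique h1
    exact h2

/-- Eliminates the leaves. Those below child `i` of `n` take exactly the numbers of that child's
interval, and all of them leave the child with output `n` on the letters of `n` missing in the
child. The target depends only on `n` and `i`, because the leftmost leaf under the next child has
that child's first number. -/
theorem mem_trans_rabinAutomaton_iff (hT : T.IsDecreasing) {q q' : Fin T.memory} {γ : Γ}
    {n : T.Node} : ((q, γ, n, q') ∈ (rabinAutomaton (leafNumber (T := T))).trans) ↔
      ∃ x x', RootStep n.subtree γ x x' ∧ (q : ℕ) = T.number n.1 + x ∧
        (q' : ℕ) = T.number n.1 + x' := by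
  constructor
  · rintro ⟨l, l', ⟨h1, h2⟩, hq, hq'⟩
    obtain ⟨h3, h4, h5⟩ := (isLastAncestor_iff hT).1 h1
    replace hq : (q : ℕ) = T.number l.1.1 := congrArg Fin.val hq
    replace hq' : (q' : ℕ) = T.number l'.1.1 := congrArg Fin.val hq'
    by_cases hn : n = l.1
    · subst hn
      have hl' : l' = l := by
        rcases h2.1 with ⟨-, h⟩ | ⟨i, h, -⟩
        · exact h
        · have := Leaf.lt_arity h
          rw [l.2] at this
          omega
      subst hl'
      exact ⟨0, 0, .leaf l'.2 (h4 rfl) rfl rfl, by rw [hq, add_zero], by rw [hq', add_zero]⟩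
    · obtain ⟨i, hi⟩ := Leaf.exists_belowChild h3 hn
      have hlt := Leaf.lt_arity hi
      obtain ⟨p, hp⟩ := hi
      have hsub := l.1.sub_eq
      rw [← hp, List.append_assoc, sub_append, n.sub_eq, Option.bind_some, sub_append,
        n.sub_child hlt, Option.bind_some] at hsub
      have hnum : T.number l.1.1 =
          T.number n.1 + (n.subtree.number [i] + (n.child i hlt).subtree.number p) := by
        rw [← hp, List.append_assoc, number_append n.sub_eq, number_append (n.sub_child hlt)]
      have hlt' := number_lt (Option.isSome_iff_exists.2 ⟨_, hsub⟩)
      refine ⟨_, _, .child i _ (n.sub_child hlt) (h4 rfl)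
        (fun h => h5 i hlt ⟨p, hp⟩ (Set.singleton_subset_iff.2 h)) (Nat.le_add_right _ _)
        (Nat.add_lt_add_left hlt' _) rfl, hq.trans hnum,
        hq'.trans (number_of_isLeftmost_jump ⟨p, hp⟩ h2)⟩
  · rintro ⟨x, x', ⟨hk, hγ, rfl, rfl⟩ | ⟨i, t, ht, hγ, hγ', hx, hx', rfl⟩, hq, hq'⟩
    · let l : T.Leaf := ⟨n, hk⟩
      refine ⟨l, l, ⟨(isLastAncestor_iff hT).2 ⟨List.prefix_rfl, Set.singleton_subset_iff.2 hγ,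
        fun i h => ?_⟩, Or.inl ⟨rfl, rfl⟩, ?_⟩, Fin.ext hq, Fin.ext hq'⟩
      · rw [show n.arity = 0 from hk] at h
        omega
      · rintro m (⟨-, rfl⟩ | ⟨i, h, -⟩)
        · exact le_rfl
        · have := Leaf.lt_arity h
          rw [show n.arity = 0 from hk] at this
          omega
    · have hi : i < n.arity := (isSome_sub_singleton _ _).1 (by rw [ht]; rfl)
      obtain rfl := Option.some.inj (ht.symm.trans (n.sub_child hi))
      -- A leaf below child `i` whose state is the given one; it exists as every number of the
      -- interval is taken.
      obtain ⟨p, s, h1, h2, h3⟩ := exists_number_eq (n.child i hi).subtree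
        (x := x - n.subtree.number [i]) (by omega)
      have hsub : T.sub (n.1 ++ [i] ++ p) = some s := by
        rw [sub_append]
        exact (congrArg (Option.bind · _) (n.child i hi).sub_eq).trans h1
      let l : T.Leaf := ⟨⟨n.1 ++ [i] ++ p, by rw [hsub]; rfl⟩,
        (congrArg rootArity (Node.subtree_eq_of_sub hsub)).trans h2⟩
      have hl : l.BelowChild n i := ⟨p, rfl⟩
      have hnum : T.number l.1.1 = T.number n.1 + x := by
        change T.number (n.1 ++ [i] ++ p) = _
        have h4 := number_append (n.child i hi).sub_eq p
        have h5 := number_child n i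
        simp only [Node.child] at h4
        simp only [Node.child] at h3
        omega
      obtain ⟨l', hl'⟩ := exists_isLeftmost (jump_nonempty (n := n) (l := l) hl.isAncestor)
      refine ⟨l, l', ⟨(isLastAncestor_iff hT).2 ⟨hl.isAncestor, Set.singleton_subset_iff.2 hγ,
        fun j hj hlj hs => ?_⟩, hl'⟩, Fin.ext (hq.trans hnum.symm),
        Fin.ext (hq'.trans (number_of_isLeftmost_jump hl hl').symm)⟩
      obtain rfl := hl.unique hlj
      exact hγ' (Set.singleton_subset_iff.1 hs)

theorem init_rabinAutomaton_leafNumber :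
    (rabinAutomaton (leafNumber (T := T))).init = {(⟨0, T.memory_pos⟩ : Fin T.memory)} := by
  obtain ⟨l, hl⟩ := T.exists_leftmost
  have h : ∀ m, IsLeftmost Set.univ m → leafNumber m = (⟨0, T.memory_pos⟩ : Fin T.memory) :=
    fun m hm => Fin.ext (isNormalized_leafNumber m hm)
  ext q
  constructor
  · rintro ⟨m, hm, rfl⟩
    exact h m hm
  · rintro rfl
    exact ⟨l, hl, h l hl⟩

theorem exists_map_eq {α β : Type*} {f : α → β} {L : List β} (h : ∀ b ∈ L, ∃ a, f a = b) :
    ∃ L' : List α, L'.map f = L := by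
  have : L ∈ Set.range (List.map f) := by
    rw [Set.range_list_map]
    exact h
  exact this

theorem isCode_rabinData {N : ℕ} (e : Γ ≃ Fin N) (hT : T.IsDecreasing) :
    IsCodeOfRabinAutomaton e (leafNumber (T := T))
      (enc (Forest.rabinData (Forest.ofRoot (T.toRoot e)))) := by
  let f : Fin T.memory × Γ × T.Node × Fin T.memory → Forest.Trans := fun t =>
    ((t.1 : ℕ), (e t.2.1 : ℕ), t.2.2.1.1, (t.2.2.2 : ℕ), ())
  have hf : Function.Injective f := by
    rintro ⟨q, γ, n, q'⟩ ⟨s, δ, m, s'⟩ h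
    simp only [f, Prod.mk.injEq, and_true] at h
    obtain ⟨h1, h2, h3, h4⟩ := h
    rw [Fin.ext h1, e.injective (Fin.ext h2), Node.ext h3, Fin.ext h4]
  have hft : ∀ t, f t ∈ (T.value e Forest.infoStep).2.2 ↔
      t ∈ (rabinAutomaton (leafNumber (T := T))).trans := by
    rintro ⟨q, γ, n, q'⟩
    rw [mem_trans_rabinAutomaton_iff hT, mem_value_infoStep]
    constructor
    · rintro ⟨δ, t, x, x', h1, h2, h3, h4, h5⟩
      obtain rfl : δ = γ := e.injective (Fin.ext h1)
      obtain rfl := Node.subtree_eq_of_sub h2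
      exact ⟨x, x', h3, h4, h5⟩
    · rintro ⟨x, x', h3, h4, h5⟩
      exact ⟨γ, _, x, x', rfl, n.sub_eq, h3, h4, h5⟩
  -- The computed lists contain bare numbers and addresses. They are lifted to states and nodes,
  -- which requires that the computed states are below the memory of the tree.
  obtain ⟨ts, hts⟩ : ∃ ts, List.map f ts = (T.value e Forest.infoStep).2.2 := by
    refine exists_map_eq ?_
    rintro ⟨q, c, p, q', ⟨⟩⟩ ht
    obtain ⟨γ, t, x, x', rfl, h2, h3, rfl, rfl⟩ := (mem_value_infoStep e).1 ht
    have hmem := number_add_memory_le h2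
    have hx : x < t.memory ∧ x' < t.memory := by
      rcases h3 with ⟨-, -, rfl, rfl⟩ | ⟨i, s, hs, -, -, hx, hx', rfl⟩
      · exact ⟨t.memory_pos, t.memory_pos⟩
      · have := number_add_memory_le hs
        have hi : i < t.rootArity := (isSome_sub_singleton _ _).1 (by rw [hs]; rfl)
        exact ⟨by omega, number_lt ((isSome_sub_singleton _ _).2 (Nat.mod_lt _ (by omega)))⟩
    exact ⟨(⟨T.number p + x, by omega⟩, γ, ⟨p, by rw [h2]; rfl⟩, ⟨T.number p + x', by omega⟩), rfl⟩
  let g : T.Node → List ℕ × Bool := fun n => (n.1, n.subtree.rootRound)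
  have hgn : ∀ n, g n ∈ T.value e Forest.nodesStep := fun n =>
    (mem_value_nodesStep e).2 ⟨_, n.sub_eq, rfl⟩
  obtain ⟨ns, hns⟩ : ∃ ns, List.map g ns = T.value e Forest.nodesStep := by
    refine exists_map_eq ?_
    rintro ⟨p, r⟩ h
    obtain ⟨t, h1, rfl⟩ := (mem_value_nodesStep e).1 h
    let n : T.Node := ⟨p, by rw [h1]; rfl⟩
    exact ⟨n, by simp only [g, Node.subtree_eq_of_sub (n := n) h1, n]⟩
  have hmem : ∀ n, n ∈ ns := fun n => by
    have := hgn n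
    rw [← hns] at this
    obtain ⟨m, hm, hmn⟩ := List.mem_map.1 this
    rwa [← Node.ext (Prod.mk.inj hmn).1]
  have hnodup : ns.Nodup := by
    have := T.nodup_value_nodesStep e
    rw [← hns] at this
    exact (this.of_map _).of_map _
  obtain ⟨idx, hidx⟩ : ∃ idx : List {n : T.Node // n.IsRound},
      idx.map Subtype.val = ns.filter fun n => n.subtree.rootRound := by
    refine exists_map_eq fun n hn => ?_
    exact ⟨⟨n, (List.mem_filter.1 hn).2⟩, rfl⟩
  have hroot : Forest.rabinData (Forest.ofRoot (T.toRoot e)) =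
      (List.range T.memory, [0], ts.map f, idx.map fun i => ([i.1.1],
        (ns.filter fun m => !(i.1.1.isPrefixOf m.1)).map fun m => m.1), ()) := by
    rw [ofRoot_toRoot, Forest.rabinData, fold_toForest, fold_toForest, hts]
    simp only [Forest.fold, List.map_cons, List.map_nil, List.sum_cons, List.sum_nil, add_zero,
      value_infoStep_fst, List.flatMap_cons, List.flatMap_nil, List.append_nil, List.flatten_cons,
      List.flatten_nil, Prod.mk.injEq, true_and, and_true, Forest.pairs]
    have hval : ∀ F : T.Node → List (List ℕ) × List (List ℕ),
        (idx.map fun i => F i.1) = (ns.filter fun n => n.subtree.rootRound).map F := fun F => by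
      rw [← hidx, List.map_map]
      rfl
    rw [hval fun n => ([n.1], (ns.filter fun m => !(n.1.isPrefixOf m.1)).map fun m => m.1), ← hns,
      List.filter_map, List.map_map]
    refine List.map_congr_left fun n _ => ?_
    simp only [Function.comp_apply, List.filter_map, List.map_map]
    rfl
  refine ⟨List.finRange T.memory, [(⟨0, T.memory_pos⟩ : Fin T.memory)], ts, idx,
    idx.map fun i => ([i.1], ns.filter fun m => !(i.1.1.isPrefixOf m.1)),
    ⟨List.nodup_finRange _, List.mem_finRange⟩, fun q => ?_, fun t => ?_, ⟨?_, fun i => ?_⟩, ?_, ?_⟩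
  · rw [init_rabinAutomaton_leafNumber]
    exact List.mem_singleton
  · refine Iff.trans ?_ (hft t)
    rw [← hts]
    exact (List.mem_map_of_injective hf).symm
  · exact List.Nodup.of_map Subtype.val (hidx ▸ hnodup.filter _)
  · have : i.1 ∈ idx.map Subtype.val := by
      rw [hidx]
      exact List.mem_filter.2 ⟨hmem _, i.2⟩
    obtain ⟨j, hj, hji⟩ := List.mem_map.1 this
    rwa [← Subtype.ext hji]
  · refine List.forall₂_map_right_iff.2 (List.forall₂_same.2 fun i _ =>
      ⟨fun n => List.mem_singleton, fun n => ?_⟩)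
    simp only [List.mem_filter, hmem, true_and, Bool.not_eq_eq_eq_not, Bool.not_true,
      ← Bool.not_eq_true, List.isPrefixOf_iff_prefix]
    -- The list of red nodes is defined by the prefix test alone; `n` itself is excluded since it is
    -- a prefix of itself.
    refine ⟨fun h => ⟨?_, h⟩, fun h => h.2⟩
    rintro rfl
    exact h List.prefix_rfl
  · rw [hroot, ← List.map_coe_finRange_eq_range]
    simp only [enc, List.map_map, Data.ofList, Function.comp_def]
    rfl

end ZTree

/-! ### The theorem -/

theorem mainTheorem3 :
    ∃ (P : Program) (time : Polynomial ℕ),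
      ∀ (Γ : Type*) [Finite Γ] [Nonempty Γ] (F : Set (Set Γ)), ∅ ∉ F →
        -- a good-for-games Rabin automaton of the right size
        (∃ (C : Type) (_ : Finite C) (𝒜 : Automaton Γ C) (R : RabinCondition C),
          𝒜.IsRabinWith R ∧ 𝒜.IsGFG ∧ 𝒜.language = mullerLanguage F ∧
            𝒜.size = memgen (mullerLanguage F)) ∧
        -- it is given by any ordered Zielonka tree and any labelling with property (⋆)
        (∃ T : ZTree Γ, T.IsZielonkaTree F) ∧
        ∀ T : ZTree Γ, T.IsZielonkaTree F →
          (∃ η : T.Leaf → Fin T.memory, ZTree.IsStarLabelling η ∧ ZTree.IsNormalized η) ∧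
          (∀ η : T.Leaf → Fin T.memory, ZTree.IsStarLabelling η →
            (ZTree.rabinAutomaton η).IsRabinWith T.rabinCondition ∧
            (ZTree.rabinAutomaton η).language = mullerLanguage F ∧
            (ZTree.rabinAutomaton η).IsGFG ∧
            (ZTree.rabinAutomaton η).size = memgen (mullerLanguage F) ∧
            -- the resolver is the Zielonka tree parity automaton
            (∃ r₀ r, ZTree.IsGivenByParityAutomaton η r₀ r) ∧
            ∀ r₀ r, ZTree.IsGivenByParityAutomaton η r₀ r →
              (ZTree.rabinAutomaton η).IsResolver r₀ r) ∧
          T.parityAutomaton.IsDeterministic ∧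
          T.parityAutomaton.language = mullerLanguage F ∧
          -- the construction takes polynomial time in the size of the Zielonka tree
          ∀ (k : ℕ) (e : Γ ≃ Fin k),
            ∃ η : T.Leaf → Fin T.memory, ZTree.IsStarLabelling η ∧ ZTree.IsNormalized η ∧
              ∃ (d : Data) (t : ℕ), P.Computes (T.encode e) d t ∧
                t ≤ time.eval (T.encode e).size ∧ ZTree.IsCodeOfRabinAutomaton e η d := by
  -- The program and its time bound are fixed before the alphabet, the condition and the tree; it
  -- always uses the labelling `leafNumber`.
  have hmain := Forest.polyTime_rabinData.comp Forest.polyTime_ofRoot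
  obtain ⟨P, time, hP⟩ := hmain.exists_program
  refine ⟨P, time, fun Γ _ _ F hF => ?_⟩
  have hauto : ∀ T : ZTree Γ, T.IsZielonkaTree F → ∀ η : T.Leaf → Fin T.memory,
      ZTree.IsStarLabelling η →
        (ZTree.rabinAutomaton η).IsGFG ∧ (ZTree.rabinAutomaton η).size = memgen (mullerLanguage F) :=
    fun T hT η hη => by
      obtain ⟨r₀, r, h⟩ := hT.exists_isGivenByParityAutomaton η
      refine ⟨⟨r₀, r, hT.isResolver hη h⟩, ?_⟩
      rw [hT.memgen_eq hF]
      exact Nat.card_fin _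
  have hex : ∃ T : ZTree Γ, T.IsZielonkaTree F := ZTree.exists_alternates F Set.univ
  refine ⟨?_, hex, fun T hT => ⟨⟨_, ZTree.isStarLabelling_leafNumber, ZTree.isNormalized_leafNumber⟩,
    fun η hη => ⟨rfl, hT.language_rabinAutomaton hη, (hauto T hT η hη).1, (hauto T hT η hη).2,
      hT.exists_isGivenByParityAutomaton η, fun _ _ h => hT.isResolver hη h⟩,
    hT.isDeterministic, hT.language_parityAutomaton, fun k e => ?_⟩⟩
  · obtain ⟨T, hT⟩ := hex
    have h := hauto T hT _ ZTree.isStarLabelling_leafNumber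
    exact ⟨T.Node, inferInstance, ZTree.rabinAutomaton ZTree.leafNumber, T.rabinCondition, rfl, h.1,
      hT.language_rabinAutomaton ZTree.isStarLabelling_leafNumber, h.2⟩
  · obtain ⟨t, h1, h2⟩ := hP (T.toRoot e)
    rw [Code.size, ZTree.enc_toRoot] at h2
    rw [ZTree.enc_toRoot] at h1
    exact ⟨_, ZTree.isStarLabelling_leafNumber, ZTree.isNormalized_leafNumber, _, t, h1, h2,
      ZTree.isCode_rabinData e hT.2.isDecreasing⟩
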